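/- Let $\mathbb K$ be a field of characteristic zero, $u$ an indeterminate, and $n,d\ge 1$ integers. The Rook Yokonuma--Hecke algebra $\mathcal{RY}_{d,n}(u)$ is the unital associative $\mathbb K(u)$-algebra generated by $T_1,\dots,T_{n-1}$, $F_1,\dots,F_n$, $N$ subject to \begin{gather*} T_iT_jT_i=T_jT_iT_j\ (|i-j|=1),\qquad T_iT_j=T_jT_i\ (|i-j|>1),\qquad F_i^d=1,\qquad F_iF_j=F_jF_i,\\ T_i^2=u+(u-1)F_i^{(d^2-d)/2}E_iT_i,\qquad T_iF_j=F_{s_i(j)}T_i,\\ F_iN=NF_{i+1}\ (i<n),\qquad NF_1=F_nN=N,\qquad N^{i+1}T_i=uN^{i+1},\qquad T_iN^{n-i+1}=uN^{n-i+1},\\ T_iN=NT_{i+1}\ (i<n-1),\qquad NT_1\cdots T_{n-1}N=u^{n-1}N, \end{gather*} where $s_i=(i\ \,i+1)$ and $E_i=\frac1d\sum_{k=0}^{d-1}F_i^kF_{i+1}^{-k}$. For $j\le k$ put $T_{k,j}=T_{k-1}T_{k-2}\cdots T_j$ ($=1$ if $k=j$). For $0\le r\le n$ and $r$-element subsets $A=\{a_1<\dots<a_r\}$,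 $B=\{b_1<\dots<b_r\}$ of $\{1,\dots,n\}$, put $T_A=T_{a_1,1}\cdots T_{a_r,r}$ and $\overline T_B=T_{n-r+1,b_1}\cdots T_{n,b_r}$. For $\mathbf m\in(\mathbb Z/d\mathbb Z)^r$ put $F_{\mathbf m}=F_1^{m_1}\cdots F_r^{m_r}$. For $\omega\in\mathfrak S_r$ let $T_\omega$ be the product of the $T_i$ along a reduced expression of $\omega$. Let $$C_n=\bigl\{T_AF_{\mathbf m}T_\omega N^{n-r}\overline T_B \ :\ 0\le r\le n,\ |A|=|B|=r,\ \mathbf m\in(\mathbb Z/d\mathbb Z)^r,\ \omega\in\mathfrak S_r\bigr\}.$$ **Theorem.** The elements of $C_n$ (indexed by the parameters $(r,A,B,\mathbf m,\omega)$) are linearly independent over $\mathbb K(u)$ and span $\mathcal{RY}_{d,n}(u)$. Hence $C_n$ is a basis, and $$\dim_{\mathbb K(u)}\mathcal{RY}_{d,n}(u)=|C_n|=\sum_{r=0}^n d^r\binom nr^2 r!.$$ Moreover, let $\mathbb S=\mathbb K(u^{1/2})$, let $\xi\in\mathbb S$ be a primitive $d$-th root of unity, and let $U$ be the free $\mathbb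 S$-module with basis $v_0$ and $v_i^s$ ($1\le i\le n$, $1\le s\le d$). Give $v_i^s$ the lower index $i$ and the upper index $s$, and give $v_0$ the lower index $0$ and the upper index $d$. Define operators on $U^{\otimes n}$ as follows. $\mathbf F_i$ acts in the $i$-th factor by $v_i^s\mapsto\xi^sv_i^s$, $v_0\mapsto v_0$. $\mathbf T_i$ acts in the factors $i,i+1$ by the operator that sends $x\otimes y$, for basis vectors $x,y$ of $U$ with lower indices $a,b$ and upper indices $s,t$, to $$\begin{cases}u^{1/2}\,y\otimes x & s\ne t,\\ (-1)^{(d-1)s}u\,x\otimes y & s=t,\ a=b,\\ (-1)^{(d-1)s}u^{1/2}\,y\otimes x & s=t,\ a>b,\\ (-1)^{(d-1)s}\bigl((u-1)\,x\otimes y+u^{1/2}\,y\otimes x\bigr)& s=t,\ a<b.\end{cases}$$ $\mathbf N$ sends a tensor $x_1\otimes\cdots\otimes x_n$ of basis vectors, $\varepsilon$ of which differ from $v_0$, to $u^{\varepsilon/2}x_2\otimes\cdots\otimes x_n\otimes v_0$ if $x_1=v_0$ and to $0$ otherwise. Then $F_i\mapsto\mathbf F_i$, $T_i\mapsto\mathbf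 T_i$, $N\mapsto\mathbf N$ defines a representation $\rho$ of $\mathcal{RY}_{d,n}(u)$ on $U^{\otimes n}$, and $\rho$ is faithful whenever $d\ge n$. -/

import Mathlib

open scoped TensorProduct

namespace RookYH

/-! ### Words in the symmetric group -/

/-- The left position `i` exchanged by the `i`th simple transposition of `n` points. -/
def lo {n : ℕ} (i : Fin (n - 1)) : Fin n := ⟨i, by omega⟩

/-- The right position `i + 1` exchanged by the `i`th simple transposition of `n` points. -/
def hi {n : ℕ} (i : Fin (n - 1)) : Fin n := ⟨i + 1, by omega⟩

/-- The `i`th simple transposition. -/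
def simple {n : ℕ} (i : Fin (n - 1)) : Equiv.Perm (Fin n) := Equiv.swap (lo i) (hi i)

/-- The word `l` in the simple transpositions is a reduced expression of `ω`. -/
def IsReducedWord {r : ℕ} (l : List (Fin (r - 1))) (ω : Equiv.Perm (Fin r)) : Prop :=
  (l.map simple).prod = ω ∧
    ∀ l' : List (Fin (r - 1)), (l'.map simple).prod = ω → l.length ≤ l'.length

theorem exists_word {r : ℕ} (ω : Equiv.Perm (Fin r)) :
    ∃ l : List (Fin (r - 1)), (l.map simple).prod = ω := by
  cases r with
  | zero => exact ⟨[], Subsingleton.elim _ _⟩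
  | succ n =>
    have h : ω ∈ Submonoid.closure
        (Set.range fun i : Fin n => Equiv.swap i.castSucc i.succ) := by
      rw [Equiv.Perm.mclosure_swap_castSucc_succ]; trivial
    induction h using Submonoid.closure_induction with
    | mem x hx =>
      obtain ⟨i, rfl⟩ := hx
      exact ⟨[i], by simp [simple, lo, hi]; rfl⟩
    | one => exact ⟨[], rfl⟩
    | mul x y _ _ hx hy =>
      obtain ⟨l, rfl⟩ := hx
      obtain ⟨l', rfl⟩ := hy
      exact ⟨l ++ l', by simp⟩

theorem exists_reducedWord {r : ℕ} (ω : Equiv.Perm (Fin r)) :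
    ∃ l : List (Fin (r - 1)), IsReducedWord l ω := by
  classical
  have h : ∃ k : ℕ, ∃ l : List (Fin (r - 1)), (l.map simple).prod = ω ∧ l.length = k := by
    obtain ⟨l, hl⟩ := exists_word ω
    exact ⟨_, l, hl, rfl⟩
  obtain ⟨l, hl, hk⟩ := Nat.find_spec h
  exact ⟨l, hl, fun l' hl' => hk ▸ Nat.find_min' h ⟨l', hl', rfl⟩⟩

/-- A reduced expression of `ω`. -/
noncomputable def reducedWord {r : ℕ} (ω : Equiv.Perm (Fin r)) : List (Fin (r - 1)) :=
  (exists_reducedWord ω).choose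

/-! ### The Rook Yokonuma-Hecke algebra by generators and relations

The generators `T_1, …, T_{n-1}` and `F_1, …, F_n` are indexed from `0` here. -/

inductive Gen (n : ℕ) : Type
  | T (i : Fin (n - 1))
  | F (i : Fin n)
  | N

/-- The indeterminate `u` of the field `K(u)`. -/
noncomputable abbrev u (K : Type*) [Field K] : RatFunc K := RatFunc.X

section Presentation

variable (K : Type*) [Field K] (d n : ℕ)

noncomputable def freeT (i : Fin (n - 1)) : FreeAlgebra (RatFunc K) (Gen n) :=
  FreeAlgebra.ι (RatFunc K) (Gen.T i)

noncomputable def freeF (i : Fin n) : FreeAlgebra (RatFunc K) (Gen n) :=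
  FreeAlgebra.ι (RatFunc K) (Gen.F i)

noncomputable def freeN : FreeAlgebra (RatFunc K) (Gen n) :=
  FreeAlgebra.ι (RatFunc K) Gen.N

/-- `E_i = (1/d) ∑_{k<d} F_i^k F_{i+1}^{-k}`, where `F^{-k}` is written `F^{d-k}`
(recall that `F^d = 1`). -/
noncomputable def freeE (i : Fin (n - 1)) : FreeAlgebra (RatFunc K) (Gen n) :=
  ((d : RatFunc K)⁻¹) • ∑ k ∈ Finset.range d, freeF K n (lo i) ^ k * freeF K n (hi i) ^ (d - k)

inductive Rel : FreeAlgebra (RatFunc K) (Gen n) → FreeAlgebra (RatFunc K) (Gen n) → Prop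
  | braid (i j : Fin (n - 1)) (h : (i : ℕ) + 1 = j) :
      Rel (freeT K n i * freeT K n j * freeT K n i) (freeT K n j * freeT K n i * freeT K n j)
  | T_comm (i j : Fin (n - 1)) (h : (i : ℕ) + 1 < j) :
      Rel (freeT K n i * freeT K n j) (freeT K n j * freeT K n i)
  | F_pow (i : Fin n) : Rel (freeF K n i ^ d) 1
  | F_comm (i j : Fin n) : Rel (freeF K n i * freeF K n j) (freeF K n j * freeF K n i)
  | quadratic (i : Fin (n - 1)) :
      Rel (freeT K n i ^ 2)
        (u K • 1 +
          (u K - 1) • (freeF K n (lo i) ^ ((d ^ 2 - d) / 2) * freeE K d n i * freeT K n i))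
  | T_F (i : Fin (n - 1)) (j : Fin n) :
      Rel (freeT K n i * freeF K n j) (freeF K n (simple i j) * freeT K n i)
  | F_N (i : Fin (n - 1)) :
      Rel (freeF K n (lo i) * freeN K n) (freeN K n * freeF K n (hi i))
  | N_F_first (j : Fin n) (h : (j : ℕ) = 0) : Rel (freeN K n * freeF K n j) (freeN K n)
  | F_last_N (j : Fin n) (h : (j : ℕ) + 1 = n) : Rel (freeF K n j * freeN K n) (freeN K n)
  | N_pow_T (i : Fin (n - 1)) :
      Rel (freeN K n ^ ((i : ℕ) + 2) * freeT K n i) (u K • freeN K n ^ ((i : ℕ) + 2))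
  | T_N_pow (i : Fin (n - 1)) :
      Rel (freeT K n i * freeN K n ^ (n - (i : ℕ))) (u K • freeN K n ^ (n - (i : ℕ)))
  | T_N (i j : Fin (n - 1)) (h : (i : ℕ) + 1 = j) :
      Rel (freeT K n i * freeN K n) (freeN K n * freeT K n j)
  | N_T_N :
      Rel (freeN K n * (List.ofFn (freeT K n)).prod * freeN K n) (u K ^ (n - 1) • freeN K n)

/-- The Rook Yokonuma-Hecke algebra over `K(u)`. -/
abbrev RY : Type _ := RingQuot (Rel K d n)

noncomputable def mkRY : FreeAlgebra (RatFunc K) (Gen n) →ₐ[RatFunc K] RY K d n :=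
  RingQuot.mkAlgHom (RatFunc K) (Rel K d n)

noncomputable def T (i : Fin (n - 1)) : RY K d n := mkRY K d n (freeT K n i)

noncomputable def F (i : Fin n) : RY K d n := mkRY K d n (freeF K n i)

noncomputable def N : RY K d n := mkRY K d n (freeN K n)

end Presentation

/-! ### The standard elements -/

section Elements

variable (K : Type*) [Field K] (d n : ℕ)

/-- `T_i` for a natural number `i` (only used with `i < n - 1`). -/
noncomputable def Tnat (i : ℕ) : RY K d n :=
  if h : i < n - 1 then T K d n ⟨i, h⟩ else 1

/-- `T_{k,j} = T_{k-1} T_{k-2} ⋯ T_j`, equal to `1` if `k = j`. -/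
noncomputable def Tshift (k j : ℕ) : RY K d n :=
  ((List.range' j (k - j)).reverse.map (Tnat K d n)).prod

/-- `T_A = T_{a_1,1} ⋯ T_{a_r,r}` for `A = {a_1 < ⋯ < a_r}`. -/
noncomputable def Tset {r : ℕ} (A : {A : Finset (Fin n) // A.card = r}) : RY K d n :=
  (List.ofFn fun i : Fin r => Tshift K d n (A.1.orderEmbOfFin A.2 i : ℕ) i).prod

/-- `T̄_B = T_{n-r+1,b_1} ⋯ T_{n,b_r}` for `B = {b_1 < ⋯ < b_r}`. -/
noncomputable def TsetBar {r : ℕ} (B : {B : Finset (Fin n) // B.card = r}) : RY K d n :=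
  (List.ofFn fun i : Fin r => Tshift K d n (n - r + i) (B.1.orderEmbOfFin B.2 i : ℕ)).prod

/-- `F_m = F_1^{m_1} ⋯ F_r^{m_r}`. -/
noncomputable def Fpow {r : ℕ} (hr : r ≤ n) (m : Fin r → ZMod d) : RY K d n :=
  (List.ofFn fun i : Fin r => F K d n (Fin.castLE hr i) ^ (m i).val).prod

/-- `T_ω`, the product of the `T_i` along a reduced expression of `ω ∈ S_r`. -/
noncomputable def Tperm {r : ℕ} (ω : Equiv.Perm (Fin r)) : RY K d n :=
  ((reducedWord ω).map fun i => Tnat K d n i).prod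

/-- The parameters `(A, B, m, ω)` with `|A| = |B| = r`, `m ∈ (ℤ/d)^r`, `ω ∈ S_r`. -/
abbrev Index (r : ℕ) : Type :=
  {A : Finset (Fin n) // A.card = r} × {B : Finset (Fin n) // B.card = r} ×
    (Fin r → ZMod d) × Equiv.Perm (Fin r)

/-- `T_A F_m T_ω N^{n-r} T̄_B`. -/
noncomputable def stdElt (p : Σ r : Fin (n + 1), Index d n r) : RY K d n :=
  Tset K d n p.2.1 * Fpow K d n (Nat.lt_succ_iff.mp p.1.2) p.2.2.2.1 * Tperm K d n p.2.2.2.2 *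
    N K d n ^ (n - (p.1 : ℕ)) * TsetBar K d n p.2.2.1

/-- The set `C_n`. -/
def stdSet : Set (RY K d n) := Set.range (stdElt K d n)

end Elements

/-! ### The tensor representation -/

section Tensor

variable (K : Type*) [Field K] (d n : ℕ)

/-- The field `K(u^{1/2})`. -/
abbrev S : Type _ := AdjoinRoot (Polynomial.X ^ 2 - Polynomial.C (u K))

/-- The square root `u^{1/2}`. -/
noncomputable def v : S K := AdjoinRoot.root _

/-- Labels of the basis of `U`: `none` is `v_0`, and `some (i, s)` is the vector `v_{i+1}^{s+1}`,
so that lower indices run through `1, …, n` and upper indices through `1, …, d`. -/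
abbrev Label : Type := Option (Fin n × Fin d)

variable {d n} in
/-- The lower index; that of `v_0` is `0`. -/
def lower : Label d n → ℕ
  | none => 0
  | some (i, _) => i + 1

variable {d n} in
/-- The upper index; that of `v_0` is `d`, as `v_0` and the vectors `v_i^d` have the same
eigenvalue `ξ^d = 1` under `F`. -/
def upper : Label d n → ℕ
  | none => d
  | some (_, s) => s + 1

/-- The free module `U` on `v_0` and the `v_i^s`. -/
abbrev U : Type _ := Label d n →₀ S K

/-- The tensor space `U^{⊗ n}`. -/
abbrev TensorU : Type _ := ⨂[S K] _ : Fin n, U K d n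

/-- The basis tensors `v_{f 1} ⊗ ⋯ ⊗ v_{f n}` of `U^{⊗ n}`. -/
noncomputable def tensorBasis : Module.Basis (Fin n → Label d n) (S K) (TensorU K d n) :=
  Basis.piTensorProduct fun _ => Finsupp.basisSingleOne

/-- The operator `F` in the `i`th factor: `F v_i^s = ξ^s v_i^s` and `F v_0 = v_0`. -/
noncomputable def opF (ξ : S K) (i : Fin n) : Module.End (S K) (TensorU K d n) :=
  (tensorBasis K d n).constr (S K) fun f =>
    (match f i with
      | none => (1 : S K)
      | some (_, s) => ξ ^ ((s : ℕ) + 1)) • tensorBasis K d n f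

/-- The operator `T` in the factors `i` and `i + 1`. -/
noncomputable def opT (i : Fin (n - 1)) : Module.End (S K) (TensorU K d n) :=
  (tensorBasis K d n).constr (S K) fun f =>
    let x := f (lo i)
    let y := f (hi i)
    let same : TensorU K d n := tensorBasis K d n f
    let flip : TensorU K d n := tensorBasis K d n (f ∘ simple i)
    let sgn : S K := (-1) ^ ((d - 1) * upper x)
    if upper x ≠ upper y then v K • flip
    else if lower x = lower y then (sgn * v K ^ 2) • same
    else if lower y < lower x then (sgn * v K) • flip
    else (sgn * (v K ^ 2 - 1)) • same + (sgn * v K) • flip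

/-- The operator `N`: it sends `x_1 ⊗ ⋯ ⊗ x_n` to `u^{ε/2} x_2 ⊗ ⋯ ⊗ x_n ⊗ v_0` if `x_1 = v_0`,
where `ε` is the number of factors other than `v_0`, and to `0` otherwise. -/
noncomputable def opN : Module.End (S K) (TensorU K d n) :=
  (tensorBasis K d n).constr (S K) fun f =>
    if ∀ k : Fin n, (k : ℕ) = 0 → f k = none then
      v K ^ (Finset.univ.filter fun k => f k ≠ none).card • tensorBasis K d n (f ∘ finRotate n)
    else 0

end Tensor

end RookYH

/-! The dimension is bounded above by a spanning argument and below by a triangularity argument in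
the tensor representation. The two bounds agree, so the standard elements form a basis.

Upper bound. Let `H` be the subalgebra generated by the `T i` and `F i`. Since `N ^ k` absorbs `F j`
for `j < k` and turns `T i` into the scalar `u` for `i + 1 < k`, the space `N ^ k * H` is spanned by
products of `N ^ k`, a monomial in the last `r = n - k` of the `F j`, and coset representatives of
`S_k` in `S_n`; its rank is at most `d ^ r * n! / (n - r)!` (`rank_powSpan_le`). Multiplying on the
left by the `T_A` with `|A| = r` gives `layer r`, which costs a factor `n.choose r`. Each layer is
stable under left multiplication by `T i` and `F i`, and `N` maps `layer r` into `layer r ⊔ layer (r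
- 1)`. The sum of the layers is therefore a left ideal containing `1`, hence everything (`rank_le`).

Lower bound. The operators satisfy the relations over any domain containing `K(u)`, a square root
`v` of `u` and a primitive `d`-th root of unity (`genRep`). A word in the `T i` sends a basis tensor
to a nonzero multiple of the permuted tensor plus terms from shorter subwords (`wordOp_apply`).
Lengths then control which terms survive: `N ^ (n - r)` demands that the first `n - r` factors be
`v_0`, and a suitable coordinate of the result detects `A` and `ω`. In a vanishing combination, take
a term whose lengths are lexicographically maximal: one test vector and one coordinate leave only
the terms with the same `(r, A, B, ω)` (`coord_stdOp`). Varying the upper indices of the test vector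
turns what is left into a Fourier transform on `(ℤ/d)^r`, which is injective.

Independence is obtained over the algebraic closure of `K(u)`, so it needs no root of unity in `K`.
The same triangularity, applied over `K(u^{1/2})`, shows that the images of the basis under `ρ` are
independent, whence faithfulness. -/

namespace RookYH

/-! ### Descending products -/

/-! ### Upper bound for the dimension: words and the spanning argument. -/

section Desc

variable {R : Type*} [Ring R]

/-- The product `T_{k-1} T_{k-2} ⋯ T_j`, equal to `1` if `k ≤ j`. -/
def descProd (T : ℕ → R) (k j : ℕ) : R := ((List.range' j (k - j)).reverse.map T).prod

theorem descProd_of_le (T : ℕ → R) {k j : ℕ} (h : k ≤ j) : descProd T k j = 1 := by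
  simp [descProd, Nat.sub_eq_zero_of_le h]

theorem descProd_succ_left (T : ℕ → R) {k j : ℕ} (h : j ≤ k) :
    descProd T (k + 1) j = T k * descProd T k j := by
  have : k + 1 - j = (k - j) + 1 := by omega
  rw [descProd, descProd, this, List.range'_concat]
  simp [Nat.add_sub_cancel' h]

theorem descProd_eq_mul_right (T : ℕ → R) {k j : ℕ} (h : j < k) :
    descProd T k j = descProd T k (j + 1) * T j := by
  have : k - j = (k - (j + 1)) + 1 := by omega
  rw [descProd, descProd, this, List.range'_succ]
  simp

/-- An intertwiner of the letters is an intertwiner of the product. -/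
theorem descProd_intertwine (T : ℕ → R) (x : R) (k j k' j' : ℕ) (hk : k - j = k' - j')
    (h : ∀ i, i < k - j → x * T (j + i) = T (j' + i) * x) :
    x * descProd T k j = descProd T k' j' * x := by
  have key : ∀ m j j', (∀ i, i < m → x * T (j + i) = T (j' + i) * x) →
      x * descProd T (j + m) j = descProd T (j' + m) j' * x := by
    intro m
    induction m with
    | zero => intro j j' _; simp [descProd_of_le]
    | succ m ih =>
      intro j j' h
      rw [← add_assoc, ← add_assoc, descProd_succ_left _ (by omega),
        descProd_succ_left _ (by omega), ← mul_assoc, h m (by omega), mul_assoc,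
        ih j j' (fun i hi => h i (by omega)), mul_assoc]
  have := key (k - j) j j' h
  rcases le_total k j with hkj | hkj
  · rw [descProd_of_le _ hkj, descProd_of_le _ (by omega)]; simp
  rcases le_total k' j' with hkj' | hkj'
  · rw [descProd_of_le _ hkj', descProd_of_le _ (by omega)]; simp
  · rwa [show j + (k - j) = k by omega, show j' + (k - j) = k' by omega] at this

end Desc

/-! ### The relations in an abstract algebra -/

section Abstract

variable {𝕜 R : Type*} [Field 𝕜] [Ring R] [Algebra 𝕜 R]

/-- The defining relations, for families indexed by all natural numbers. -/
structure Relations (d n : ℕ) (u : 𝕜) (T F : ℕ → R) (N : R) : Prop where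
  braid : ∀ i, i + 2 < n → T i * T (i + 1) * T i = T (i + 1) * T i * T (i + 1)
  -- No upper bound on `j` is imposed: generators with an index out of range will be `1`.
  comm : ∀ i j, i + 1 < j → T i * T j = T j * T i
  F_pow : ∀ i, F i ^ d = 1
  F_comm : ∀ i j, F i * F j = F j * F i
  F_of_le : ∀ i, n ≤ i → F i = 1
  -- The dimension count does not depend on the precise coefficient, only on its lying in the
  -- algebra of the `F j`.
  quadratic : ∀ i, i + 1 < n → ∃ e ∈ Algebra.adjoin 𝕜 (Set.range F),
    T i * T i = u • 1 + e * T i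
  T_F : ∀ i j, i + 1 < n → T i * F j = F (Equiv.swap i (i + 1) j) * T i
  F_N : ∀ i, i + 1 < n → F i * N = N * F (i + 1)
  N_F_first : N * F 0 = N
  F_last_N : ∀ i, n ≤ i + 1 → F i * N = N
  N_pow_T : ∀ i, i + 1 < n → N ^ (i + 2) * T i = u • N ^ (i + 2)
  T_N_pow : ∀ i, i + 1 < n → T i * N ^ (n - i) = u • N ^ (n - i)
  T_N : ∀ i, i + 2 < n → T i * N = N * T (i + 1)
  N_T_N : N * ((List.range (n - 1)).map T).prod * N = u ^ (n - 1) • N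

namespace Relations

variable {d n : ℕ} {u : 𝕜} {T F : ℕ → R} {N : R} (h : Relations d n u T F N)

include h

theorem F_T (i j : ℕ) (hi : i + 1 < n) : F j * T i = T i * F (Equiv.swap i (i + 1) j) := by
  rw [h.T_F i _ hi, Equiv.swap_apply_self]

theorem T_mul_T_mul (i : ℕ) (hi : i + 1 < n) : ∃ e ∈ Algebra.adjoin 𝕜 (Set.range F),
    ∀ x, T i * (T i * x) = u • x + e * (T i * x) := by
  obtain ⟨e, he, hT⟩ := h.quadratic i hi
  exact ⟨e, he, fun x => by rw [← mul_assoc, hT]; simp [add_mul, mul_assoc]⟩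

theorem adjoin_F_mul_T (i : ℕ) (hi : i + 1 < n) {e : R}
    (he : e ∈ Algebra.adjoin 𝕜 (Set.range F)) :
    ∃ e' ∈ Algebra.adjoin 𝕜 (Set.range F), e * T i = T i * e' := by
  induction he using Algebra.adjoin_induction with
  | mem x hx =>
    obtain ⟨j, rfl⟩ := hx
    exact ⟨_, Algebra.subset_adjoin ⟨_, rfl⟩, h.F_T i j hi⟩
  | algebraMap c => exact ⟨_, Subalgebra.algebraMap_mem _ c, Algebra.commutes _ _⟩
  | add x y _ _ hx hy =>
    obtain ⟨a, ha, hxa⟩ := hx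
    obtain ⟨b, hb, hyb⟩ := hy
    exact ⟨a + b, add_mem ha hb, by rw [add_mul, mul_add, hxa, hyb]⟩
  | mul x y _ _ hx hy =>
    obtain ⟨a, ha, hxa⟩ := hx
    obtain ⟨b, hb, hyb⟩ := hy
    exact ⟨a * b, mul_mem ha hb, by rw [mul_assoc, hyb, ← mul_assoc, hxa, mul_assoc]⟩

theorem mul_T_mul_T (i : ℕ) (hi : i + 1 < n) : ∃ e ∈ Algebra.adjoin 𝕜 (Set.range F),
    ∀ x, x * T i * T i = u • x + x * T i * e := by
  obtain ⟨e, he, hT⟩ := h.quadratic i hi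
  obtain ⟨e', he', hee⟩ := h.adjoin_F_mul_T i hi he
  exact ⟨e', he', fun x => by rw [mul_assoc, hT, hee]; simp [mul_add, mul_assoc]⟩

theorem T_comm_desc {i k l : ℕ} (hi : i + 1 < l ∨ k < i) :
    T i * descProd T k l = descProd T k l * T i := by
  refine descProd_intertwine T _ _ _ _ _ rfl fun j hj => ?_
  rcases hi with hi | hi
  · exact h.comm _ _ (by omega)
  · exact (h.comm _ _ (by omega)).symm

theorem desc_F (k l j : ℕ) (hk : k < n) :
    ∃ j', F j * descProd T k l = descProd T k l * F j' := by
  rcases le_total k l with hkl | hkl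
  · exact ⟨j, by rw [descProd_of_le _ hkl]; simp⟩
  induction k, hkl using Nat.le_induction generalizing j with
  | base => exact ⟨j, by rw [descProd_of_le _ le_rfl]; simp⟩
  | succ k hlk ih =>
    obtain ⟨j', hj'⟩ := ih (Equiv.swap k (k + 1) j) (by omega)
    exact ⟨j', by rw [descProd_succ_left _ hlk, ← mul_assoc, h.F_T _ _ hk, mul_assoc, hj',
      mul_assoc]⟩

theorem F_desc (k l j : ℕ) (hk : k < n) :
    ∃ j', descProd T k l * F j = F j' * descProd T k l := by
  rcases le_total k l with hkl | hkl
  · exact ⟨j, by rw [descProd_of_le _ hkl]; simp⟩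
  induction k, hkl using Nat.le_induction with
  | base => exact ⟨j, by rw [descProd_of_le _ le_rfl]; simp⟩
  | succ k hlk ih =>
    obtain ⟨j', hj'⟩ := ih (by omega)
    exact ⟨Equiv.swap k (k + 1) j', by rw [descProd_succ_left _ hlk, mul_assoc, hj', ← mul_assoc,
      h.T_F _ _ hk, mul_assoc]⟩

/-- `T i` commutes with the letters above `i + 1`, the braid relation turns `T i * T (i+1) * T i`
into `T (i+1) * T i * T (i+1)`, and the new `T (i+1)` commutes with the letters below `i`. -/
theorem T_desc {i k l : ℕ} (hli : l ≤ i) (hik : i + 1 < k) (hk : k < n) :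
    T i * descProd T k l = descProd T k l * T (i + 1) := by
  induction k, (show i + 2 ≤ k from hik) using Nat.le_induction with
  | base =>
    rw [descProd_succ_left _ (by omega), descProd_succ_left _ (by omega)]
    simp only [← mul_assoc]
    rw [h.braid i (by omega)]
    simp only [mul_assoc]
    rw [h.T_comm_desc (Or.inr (by omega))]
  | succ k hik ih =>
    rw [descProd_succ_left _ (by omega), ← mul_assoc, h.comm i k (by omega), mul_assoc,
      ih (by omega) (by omega), mul_assoc]

theorem desc_mul_desc {l a c : ℕ} (hla : l ≤ a) (hac : a ≤ c) (hc : c + 1 < n) :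
    descProd T a l * descProd T (c + 1) l = descProd T (c + 1) l * descProd T (a + 1) (l + 1) := by
  induction a, hla using Nat.le_induction with
  | base => rw [descProd_of_le _ le_rfl, descProd_of_le _ le_rfl]; simp
  | succ a hla ih =>
    rw [descProd_succ_left _ hla, mul_assoc, ih (by omega), ← mul_assoc,
      h.T_desc hla (by omega) hc, descProd_succ_left _ (show l + 1 ≤ a + 1 by omega), mul_assoc]

/-- The case of `T c * T_A` with both `c` and `c + 1` in `A`: the subset is unchanged and a letter
`T l` comes out on the right. -/
theorem desc_succ_mul_desc {l c : ℕ} (hlc : l ≤ c) (hc : c + 1 < n) :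
    descProd T (c + 1) l * descProd T (c + 1) (l + 1) =
      descProd T c l * (descProd T (c + 1) (l + 1) * T l) := by
  rw [← descProd_eq_mul_right _ (by omega), h.desc_mul_desc hlc le_rfl hc]

/-! ### Powers of `N` -/

theorem T_mul_N_pow (k i : ℕ) (hi : i + k + 1 < n) : T i * N ^ k = N ^ k * T (i + k) := by
  induction k with
  | zero => simp
  | succ k ih =>
    rw [pow_succ, ← mul_assoc, ih (by omega), mul_assoc, h.T_N _ (by omega), mul_assoc, add_assoc]

theorem F_mul_N_pow (k i : ℕ) (hi : i + k < n) : F i * N ^ k = N ^ k * F (i + k) := by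
  induction k with
  | zero => simp
  | succ k ih =>
    rw [pow_succ, ← mul_assoc, ih (by omega), mul_assoc, h.F_N _ (by omega), mul_assoc, add_assoc]

/-- Moving `F j` to the left through `N ^ j` lowers its index to `0`, where the next `N` absorbs it.
-/
theorem N_pow_mul_F (k j : ℕ) (hj : j < k) (hjn : j < n) : N ^ k * F j = N ^ k := by
  have h0 : N ^ j * F j = F 0 * N ^ j := by rw [h.F_mul_N_pow j 0 (by omega), zero_add]
  rw [show k = (k - j - 1) + 1 + j by omega, pow_add, mul_assoc, h0, pow_succ, mul_assoc,
    ← mul_assoc N, h.N_F_first]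
  simp [mul_assoc]

theorem F_mul_N_pow_of_le (k i : ℕ) (hi : n ≤ i + k) (hk : 0 < k) : F i * N ^ k = N ^ k := by
  rcases le_or_gt n i with hni | hni
  · rw [show k = k - 1 + 1 by omega, pow_succ', ← mul_assoc, h.F_last_N _ (by omega)]
  have h0 : F i * N ^ (n - 1 - i) = N ^ (n - 1 - i) * F (n - 1) := by
    rw [h.F_mul_N_pow _ _ (by omega)]; congr 2; omega
  rw [show k = (n - 1 - i) + 1 + (k - (n - 1 - i) - 1) by omega, pow_add, pow_succ,
    ← mul_assoc, ← mul_assoc, h0, mul_assoc (N ^ _) (F _) N, h.F_last_N _ (by omega)]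

theorem N_pow_mul_T (k i : ℕ) (hi : i + 1 < k) (hin : i + 1 < n) :
    N ^ k * T i = u • N ^ k := by
  rw [show k = (k - (i + 2)) + (i + 2) by omega, pow_add, mul_assoc, h.N_pow_T _ hin,
    mul_smul_comm]

theorem T_mul_N_pow_of_le (k i : ℕ) (hi : n ≤ i + k) (hin : i + 1 < n) :
    T i * N ^ k = u • N ^ k := by
  rw [show k = (n - i) + (k - (n - i)) by omega, pow_add, ← mul_assoc, h.T_N_pow _ hin,
    smul_mul_assoc]

theorem range_prod_mul_N_pow (k m : ℕ) (hm : m < n) (hmk : n ≤ m + k) :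
    ((List.range (n - 1)).map T).prod * N ^ k =
      u ^ (n - 1 - m) • (((List.range m).map T).prod * N ^ k) := by
  have key : ∀ t, m + t ≤ n - 1 → ((List.range (m + t)).map T).prod * N ^ k =
      u ^ t • (((List.range m).map T).prod * N ^ k) := by
    intro t
    induction t with
    | zero => simp
    | succ t ih =>
      intro ht
      rw [← add_assoc, List.range_succ, List.map_append, List.prod_append]
      simp only [List.map_cons, List.map_nil, List.prod_cons, List.prod_nil, mul_one]
      rw [mul_assoc, h.T_mul_N_pow_of_le _ _ (by omega) (by omega), mul_smul_comm,
        ih (by omega), smul_smul, pow_succ']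
  have := key (n - 1 - m) (by omega)
  rwa [show m + (n - 1 - m) = n - 1 by omega] at this

/-- A truncated form of the relation `N_T_N`: in front of `N ^ k` the letters `T m, …, T (n-2)` act
by `u`, and the resulting power of `u` is cancelled. This is where `u` must be invertible. -/
theorem N_mul_range_prod_mul_N_pow (hu : u ≠ 0) (k m : ℕ) (hmk : n = m + k) (hk : 0 < k) :
    N * ((List.range m).map T).prod * N ^ k = u ^ m • N ^ k := by
  have h1 : N * ((List.range (n - 1)).map T).prod * N ^ k = u ^ (n - 1) • N ^ k := by
    rw [show k = 1 + (k - 1) by omega, pow_add, pow_one, ← mul_assoc, h.N_T_N, smul_mul_assoc]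
  rw [mul_assoc, h.range_prod_mul_N_pow k m (by omega) (by omega), mul_smul_comm,
    ← mul_assoc] at h1
  have h2 : u ^ (n - 1) = u ^ (n - 1 - m) * u ^ m := by rw [← pow_add]; congr 1; omega
  rw [h2, mul_smul] at h1
  exact smul_right_injective R (pow_ne_zero _ hu) h1

theorem N_mul_range_prod_mul_T (l i : ℕ) (hl : l < i) (hi : i + 1 < n) :
    N * ((List.range l).map T).prod * T i = T (i - 1) * (N * ((List.range l).map T).prod) := by
  have h1 : ∀ l, l < i → ((List.range l).map T).prod * T i = T i * ((List.range l).map T).prod := by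
    intro l
    induction l with
    | zero => simp
    | succ l ih =>
      intro hl
      rw [List.range_succ, List.map_append, List.prod_append]
      simp only [List.map_cons, List.map_nil, List.prod_cons, List.prod_nil, mul_one]
      rw [mul_assoc, h.comm l i hl, ← mul_assoc, ih (by omega), mul_assoc]
  have h2 := h.T_N (i - 1) (by omega)
  rw [show i - 1 + 1 = i by omega] at h2
  rw [mul_assoc, h1 l hl, ← mul_assoc, ← h2, mul_assoc]

end Relations

/-! ### Submodules closed under multiplication -/

/-- The sum of the submodules `Q * x c` for `c < m`. -/
def rightSum (Q : Submodule 𝕜 R) (x : ℕ → R) (m : ℕ) : Submodule 𝕜 R :=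
  (Finset.range m).sup fun c => Q.map (LinearMap.mulRight 𝕜 (x c))

theorem mul_mem_rightSum {Q : Submodule 𝕜 R} (x : ℕ → R) {m c : ℕ} (hc : c < m) {z : R}
    (hz : z ∈ Q) : z * x c ∈ rightSum Q x m :=
  Finset.le_sup (f := fun c => Q.map (LinearMap.mulRight 𝕜 (x c))) (Finset.mem_range.mpr hc)
    ⟨z, hz, rfl⟩

theorem rightSum_le {Q P : Submodule 𝕜 R} {x : ℕ → R} {m : ℕ}
    (h : ∀ c < m, ∀ z ∈ Q, z * x c ∈ P) : rightSum Q x m ≤ P := by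
  refine Finset.sup_le fun c hc => ?_
  rintro _ ⟨z, hz, rfl⟩
  exact h c (Finset.mem_range.mp hc) z hz

theorem rightSum_mul_mem {Q P : Submodule 𝕜 R} {x : ℕ → R} {m : ℕ} {a : R}
    (h : ∀ c < m, ∀ z ∈ Q, z * x c * a ∈ P) : ∀ z ∈ rightSum Q x m, z * a ∈ P := by
  have : rightSum Q x m ≤ P.comap (LinearMap.mulRight 𝕜 a) := rightSum_le h
  exact fun z hz => this hz

theorem rank_rightSum_le (Q : Submodule 𝕜 R) (x : ℕ → R) (m b : ℕ)
    (hQ : Module.rank 𝕜 Q ≤ b) : Module.rank 𝕜 (rightSum Q x m) ≤ ((m * b : ℕ) : Cardinal) := by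
  induction m with
  | zero =>
    have : rightSum Q x 0 = ⊥ := by simp [rightSum]
    rw [this]; simp
  | succ m ih =>
    have : rightSum Q x (m + 1) =
        Q.map (LinearMap.mulRight 𝕜 (x m)) ⊔ rightSum Q x m := by
      rw [rightSum, Finset.range_add_one, Finset.sup_insert]; rfl
    rw [this]
    refine (Submodule.rank_add_le_rank_add_rank _ _).trans ?_
    rw [Nat.succ_mul, Nat.cast_add, add_comm]
    exact add_le_add ih ((rank_map_le _ _).trans hQ)

theorem mul_adjoin_mem {Q : Submodule 𝕜 R} {s : Set R} (hQ : ∀ x ∈ s, ∀ z ∈ Q, z * x ∈ Q)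
    {e : R} (he : e ∈ Algebra.adjoin 𝕜 s) : ∀ z ∈ Q, z * e ∈ Q := by
  induction he using Algebra.adjoin_induction with
  | mem x hx => exact hQ x hx
  | algebraMap c =>
    intro z hz
    rw [← Algebra.commutes, ← Algebra.smul_def]; exact Q.smul_mem _ hz
  | add x y _ _ hx hy => intro z hz; rw [mul_add]; exact add_mem (hx z hz) (hy z hz)
  | mul x y _ _ hx hy => intro z hz; rw [← mul_assoc]; exact hy _ (hx z hz)

theorem adjoin_mul_mem {Q : Submodule 𝕜 R} {s : Set R} (hQ : ∀ x ∈ s, ∀ z ∈ Q, x * z ∈ Q)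
    {e : R} (he : e ∈ Algebra.adjoin 𝕜 s) : ∀ z ∈ Q, e * z ∈ Q := by
  induction he using Algebra.adjoin_induction with
  | mem x hx => exact hQ x hx
  | algebraMap c =>
    intro z hz
    rw [← Algebra.smul_def]; exact Q.smul_mem _ hz
  | add x y _ _ hx hy => intro z hz; rw [add_mul]; exact add_mem (hx z hz) (hy z hz)
  | mul x y _ _ hx hy => intro z hz; rw [mul_assoc]; exact hx _ (hy z hz)

/-- The span of the monomials `N ^ k * F_k ^ e_k ⋯ F_{k+t-1} ^ e_{k+t-1}`. -/
def monomialSpan (𝕜 : Type*) {R : Type*} [Field 𝕜] [Ring R] [Algebra 𝕜 R] (d k : ℕ) (F : ℕ → R)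
    (N : R) : ℕ → Submodule 𝕜 R
  | 0 => Submodule.span 𝕜 {N ^ k}
  | t + 1 => rightSum (monomialSpan 𝕜 d k F N t) (fun e => F (k + t) ^ e) d

/-- The sum of the `Q * T_{k,c_0} * ⋯ * T_{k+t-1,c_{t-1}}` with `c_j ≤ k + j`. -/
def cosetSpan (Q : Submodule 𝕜 R) (T : ℕ → R) (k : ℕ) : ℕ → Submodule 𝕜 R
  | 0 => Q
  | t + 1 => rightSum (cosetSpan Q T k t) (fun c => descProd T (k + t) c) (k + t + 1)

/-- The sum of the `T_{a_0,l} * ⋯ * T_{a_{q-1},l+q-1} * M` with `c ≤ a_0 < ⋯ < a_{q-1} < c + t`. -/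
def subsetSpan (M : Submodule 𝕜 R) (T : ℕ → R) : ℕ → ℕ → ℕ → ℕ → Submodule 𝕜 R
  | 0, 0, _, _ => M
  | 0, _ + 1, _, _ => ⊥
  | _ + 1, 0, _, _ => M
  | t + 1, q + 1, c, l =>
    (subsetSpan M T t q (c + 1) (l + 1)).map (LinearMap.mulLeft 𝕜 (descProd T c l)) ⊔
      subsetSpan M T t (q + 1) (c + 1) l

theorem subsetSpan_zero (M : Submodule 𝕜 R) (T : ℕ → R) (t c l : ℕ) :
    subsetSpan M T t 0 c l = M := by
  cases t <;> rfl

/-- The two summands of the recursion collect the subsets that contain `c` and those that do not, so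
the count is Pascal's rule. -/
theorem rank_subsetSpan_le (M : Submodule 𝕜 R) (T : ℕ → R) (b : ℕ) (hM : Module.rank 𝕜 M ≤ b)
    (t q c l : ℕ) :
    Module.rank 𝕜 (subsetSpan M T t q c l) ≤ ((t.choose q * b : ℕ) : Cardinal) := by
  induction t generalizing q c l with
  | zero => cases q with
    | zero =>
      change Module.rank 𝕜 M ≤ _
      simpa using hM
    | succ q =>
      change Module.rank 𝕜 (⊥ : Submodule 𝕜 R) ≤ _
      rw [rank_bot]; exact zero_le
  | succ t ih => cases q with
    | zero =>
      change Module.rank 𝕜 M ≤ _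
      simpa using hM
    | succ q =>
      rw [subsetSpan, Nat.choose_succ_succ, add_mul, Nat.cast_add]
      exact (Submodule.rank_add_le_rank_add_rank _ _).trans
        (add_le_add ((rank_map_le _ _).trans (ih _ _ _)) (ih _ _ _))

theorem subsetSpan_le_succ (M : Submodule 𝕜 R) (T : ℕ → R) (t q c l : ℕ) :
    subsetSpan M T t q (c + 1) l ≤ subsetSpan M T (t + 1) q c l := by
  cases q with
  | zero => simp [subsetSpan_zero]
  | succ q => exact le_sup_right

theorem desc_mul_mem_subsetSpan {M : Submodule 𝕜 R} {T : ℕ → R} {t q c l : ℕ} {x : R}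
    (hx : x ∈ subsetSpan M T t q (c + 1) (l + 1)) :
    descProd T c l * x ∈ subsetSpan M T (t + 1) (q + 1) c l :=
  Submodule.mem_sup_left ⟨x, hx, rfl⟩

theorem mul_mem_of_mem_subsetSpan_succ {M P : Submodule 𝕜 R} {T : ℕ → R} {t q c l : ℕ} {a : R}
    (h1 : ∀ x ∈ subsetSpan M T t q (c + 1) (l + 1), a * (descProd T c l * x) ∈ P)
    (h2 : ∀ x ∈ subsetSpan M T t (q + 1) (c + 1) l, a * x ∈ P) :
    ∀ x ∈ subsetSpan M T (t + 1) (q + 1) c l, a * x ∈ P := by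
  have : subsetSpan M T (t + 1) (q + 1) c l ≤ P.comap (LinearMap.mulLeft 𝕜 a) := by
    rw [subsetSpan]
    refine sup_le ?_ h2
    rintro _ ⟨x, hx, rfl⟩
    exact h1 x hx
  exact fun x hx => this hx

namespace Relations

variable {d n : ℕ} {u : 𝕜} {T F : ℕ → R} {N : R} (h : Relations d n u T F N)

include h

/-! ### The right module generated by a power of `N` -/

/-- The `F j` commute: an index below `k` reaches `N ^ k` and is absorbed, any other raises one
exponent modulo `d`. -/
theorem monomialSpan_mul_F (hd : 1 ≤ d) (k t j : ℕ) (hj : j < k + t) (hjn : j < n) :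
    ∀ z ∈ monomialSpan 𝕜 d k F N t, z * F j ∈ monomialSpan 𝕜 d k F N t := by
  induction t with
  | zero =>
    intro z hz
    obtain ⟨c, rfl⟩ := Submodule.mem_span_singleton.mp hz
    rw [smul_mul_assoc, h.N_pow_mul_F k j (by omega) hjn]
    exact hz
  | succ t ih =>
    refine rightSum_mul_mem fun e he z hz => ?_
    rcases (show j < k + t ∨ j = k + t by omega) with hj | rfl
    · rw [mul_assoc, (show Commute (F (k + t)) (F j) from h.F_comm _ _).pow_left e, ← mul_assoc]
      exact mul_mem_rightSum _ he (ih hj z hz)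
    · rw [mul_assoc, ← pow_succ]
      rcases (show e + 1 < d ∨ e + 1 = d by omega) with he' | he'
      · exact mul_mem_rightSum (fun e => F (k + t) ^ e) he' hz
      · rw [he', h.F_pow]
        have := mul_mem_rightSum (fun e => F (k + t) ^ e) (c := 0) hd hz
        rwa [pow_zero] at this

theorem monomialSpan_mul_T (k t i : ℕ) (hi : i + 1 < k) (hin : i + 1 < n) :
    ∀ z ∈ monomialSpan 𝕜 d k F N t, z * T i ∈ monomialSpan 𝕜 d k F N t := by
  induction t with
  | zero =>
    intro z hz
    obtain ⟨c, rfl⟩ := Submodule.mem_span_singleton.mp hz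
    rw [smul_mul_assoc, h.N_pow_mul_T k i hi hin]
    exact Submodule.smul_mem _ _ (Submodule.smul_mem _ _ (Submodule.mem_span_singleton_self _))
  | succ t ih =>
    refine rightSum_mul_mem fun e he z hz => ?_
    have hc : Commute (F (k + t)) (T i) := by
      have := h.F_T i (k + t) hin
      rwa [Equiv.swap_apply_of_ne_of_ne (by omega) (by omega)] at this
    rw [mul_assoc, hc.pow_left e, ← mul_assoc]
    exact mul_mem_rightSum _ he (ih z hz)

omit h in
theorem rank_monomialSpan_le (k t : ℕ) :
    Module.rank 𝕜 (monomialSpan 𝕜 d k F N t) ≤ ((d ^ t : ℕ) : Cardinal) := by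
  induction t with
  | zero =>
    change Module.rank 𝕜 (Submodule.span 𝕜 ({N ^ k} : Set R)) ≤ _
    simpa using (rank_span_le (R := 𝕜) ({N ^ k} : Set R))
  | succ t ih => rw [pow_succ']; exact rank_rightSum_le _ _ _ _ ih

theorem monomialSpan_mul_F_all (hd : 1 ≤ d) (k t j : ℕ) (ht : n ≤ k + t) :
    ∀ z ∈ monomialSpan 𝕜 d k F N t, z * F j ∈ monomialSpan 𝕜 d k F N t := by
  rcases lt_or_ge j n with hj | hj
  · exact h.monomialSpan_mul_F hd k t j (by omega) hj
  · intro z hz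
    rwa [h.F_of_le j hj, mul_one]

theorem cosetSpan_mul_F {Q : Submodule 𝕜 R} (hF : ∀ j, ∀ z ∈ Q, z * F j ∈ Q) (k t j : ℕ)
    (ht : k + t ≤ n) : ∀ z ∈ cosetSpan Q T k t, z * F j ∈ cosetSpan Q T k t := by
  induction t generalizing j with
  | zero => exact hF j
  | succ t ih =>
    refine rightSum_mul_mem fun c hc z hz => ?_
    obtain ⟨j', hj'⟩ := h.F_desc (k + t) c j (by omega)
    rw [mul_assoc, hj', ← mul_assoc]
    exact mul_mem_rightSum (fun c => descProd T (k + t) c) hc (ih j' (by omega) z hz)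

/-- Right multiplication on the coset representatives `T_{k+t,c}`: according to the position of `i`
relative to `c`, the letter commutes through, lengthens the representative, shortens it by the
quadratic relation, or passes to the left as `T (i-1)`. -/
theorem cosetSpan_mul_T {Q : Submodule 𝕜 R} (hF : ∀ j, ∀ z ∈ Q, z * F j ∈ Q) (k t i : ℕ)
    (hT : ∀ i, i + 1 < k → i + 1 < n → ∀ z ∈ Q, z * T i ∈ Q) (ht : k + t ≤ n)
    (hi : i + 1 < k + t) : ∀ z ∈ cosetSpan Q T k t, z * T i ∈ cosetSpan Q T k t := by
  induction t generalizing i with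
  | zero => exact hT i hi (by omega)
  | succ t ih =>
    have hmem {c : ℕ} (hc : c < k + t + 1) {z : R} (hz : z ∈ cosetSpan Q T k t) :
        z * descProd T (k + t) c ∈ cosetSpan Q T k (t + 1) :=
      mul_mem_rightSum (fun c => descProd T (k + t) c) hc hz
    refine rightSum_mul_mem fun c hc z hz => ?_
    rcases (show i + 1 < c ∨ i + 1 = c ∨ i = c ∨ c < i by omega) with hic | rfl | rfl | hic
    · rw [mul_assoc, ← h.T_comm_desc (Or.inl hic), ← mul_assoc]
      exact hmem hc (ih i (by omega) (by omega) z hz)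
    · rw [mul_assoc, ← descProd_eq_mul_right _ (by omega)]
      exact hmem (by omega) hz
    · obtain ⟨e, he, hTe⟩ := h.mul_T_mul_T i (by omega)
      rw [descProd_eq_mul_right _ (by omega), ← mul_assoc, hTe, mul_assoc z,
        ← descProd_eq_mul_right _ (by omega)]
      refine add_mem (Submodule.smul_mem _ _ (hmem (by omega) hz))
        (mul_adjoin_mem ?_ he _ (hmem (by omega) hz))
      rintro _ ⟨j, rfl⟩
      exact h.cosetSpan_mul_F hF k (t + 1) j (by omega)
    · have := h.T_desc (i := i - 1) (k := k + t) (l := c) (by omega) (by omega) (by omega)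
      rw [show i - 1 + 1 = i by omega] at this
      rw [mul_assoc, ← this, ← mul_assoc]
      exact hmem hc (ih (i - 1) (by omega) (by omega) z hz)

omit h in
theorem rank_cosetSpan_le {Q : Submodule 𝕜 R} (k t b : ℕ) (hQ : Module.rank 𝕜 Q ≤ b) :
    Module.rank 𝕜 (cosetSpan Q T k t) ≤ (((k + 1).ascFactorial t * b : ℕ) : Cardinal) := by
  induction t with
  | zero =>
    change Module.rank 𝕜 Q ≤ _
    simpa using hQ
  | succ t ih =>
    rw [Nat.ascFactorial_succ, mul_assoc, show k + 1 + t = k + t + 1 by ring]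
    exact rank_rightSum_le _ _ _ _ ih

/-- The subspace `N ^ k * H`, where `H` is the subalgebra generated by the `T_i` and `F_i`. -/
def powSpan (_h : Relations d n u T F N) (k : ℕ) : Submodule 𝕜 R :=
  (Algebra.adjoin 𝕜 (T '' {i | i + 1 < n} ∪ Set.range F)).toSubmodule.map
    (LinearMap.mulLeft 𝕜 (N ^ k))

theorem N_pow_mul_mem (k : ℕ) {x : R}
    (hx : x ∈ Algebra.adjoin 𝕜 (T '' {i | i + 1 < n} ∪ Set.range F)) :
    N ^ k * x ∈ h.powSpan k := ⟨x, hx, rfl⟩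

omit h in
theorem powSpan_le (h : Relations d n u T F N) {k : ℕ} {P : Submodule 𝕜 R}
    (hP : ∀ x ∈ Algebra.adjoin 𝕜 (T '' {i | i + 1 < n} ∪ Set.range F), N ^ k * x ∈ P) :
    h.powSpan k ≤ P := by
  rintro _ ⟨x, hx, rfl⟩
  exact hP x hx

theorem rank_powSpan_le (hd : 1 ≤ d) (k r : ℕ) (hr : k + r = n) :
    Module.rank 𝕜 (h.powSpan k) ≤ (((k + 1).ascFactorial r * d ^ r : ℕ) : Cardinal) := by
  have hF := fun j => h.monomialSpan_mul_F_all hd k r j hr.ge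
  refine (Submodule.rank_mono (h.powSpan_le fun x hx => ?_)).trans
    (rank_cosetSpan_le (T := T) k r _ (rank_monomialSpan_le (𝕜 := 𝕜) (F := F) (N := N) k r))
  -- The span contains `N ^ k` and is stable under right multiplication by the generators of `H`, so
  -- it contains `N ^ k * H`.
  refine mul_adjoin_mem ?_ hx _ ?_
  · rintro _ (⟨i, hi, rfl⟩ | ⟨j, rfl⟩)
    · exact h.cosetSpan_mul_T hF k r i (fun i hi hin => h.monomialSpan_mul_T k r i hi hin) hr.le
        (hr ▸ hi)
    · exact h.cosetSpan_mul_F hF k r j hr.le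
  · have h1 : ∀ t, N ^ k ∈ monomialSpan 𝕜 d k F N t := by
      intro t
      induction t with
      | zero => exact Submodule.mem_span_singleton_self _
      | succ t ih =>
        have := mul_mem_rightSum (fun e => F (k + t) ^ e) (c := 0) hd ih
        rwa [pow_zero, mul_one] at this
    have h2 : ∀ t, N ^ k ∈ cosetSpan (monomialSpan 𝕜 d k F N r) T k t := by
      intro t
      induction t with
      | zero => exact h1 r
      | succ t ih =>
        have := mul_mem_rightSum (fun c => descProd T (k + t) c) (c := k + t) (Nat.lt_succ_self _) ih
        rwa [descProd_of_le _ le_rfl, mul_one] at this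
    exact h2 r

theorem F_mul_mem_powSpan (k j : ℕ) (hk : k ≤ n) : ∀ z ∈ h.powSpan k, F j * z ∈ h.powSpan k := by
  rintro _ ⟨x, hx, rfl⟩
  change F j * (N ^ k * x) ∈ _
  have hFa (j) : F j ∈ Algebra.adjoin 𝕜 (T '' {i | i + 1 < n} ∪ Set.range F) :=
    Algebra.subset_adjoin (Or.inr ⟨j, rfl⟩)
  rcases lt_or_ge (j + k) n with hj | hj
  · rw [← mul_assoc, h.F_mul_N_pow k j hj, mul_assoc]
    exact h.N_pow_mul_mem k (mul_mem (hFa _) hx)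
  · rcases Nat.eq_zero_or_pos k with rfl | hk
    · rw [pow_zero, one_mul]
      simpa using h.N_pow_mul_mem 0 (mul_mem (hFa j) hx)
    · rw [← mul_assoc, h.F_mul_N_pow_of_le k j hj hk]
      exact h.N_pow_mul_mem k hx

/-- Below the excluded index the letter passes through `N ^ k`; above it, it acts by `u`. The
excluded `T i` exchanges the last of the first `n - k` positions with the next one and must be
accounted for by the subset `A`. -/
theorem T_mul_mem_powSpan (k i : ℕ) (hi : i + 1 < n) (hik : i + k + 1 ≠ n) :
    ∀ z ∈ h.powSpan k, T i * z ∈ h.powSpan k := by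
  rintro _ ⟨x, hx, rfl⟩
  change T i * (N ^ k * x) ∈ _
  rw [← mul_assoc]
  rcases lt_or_ge (i + k + 1) n with hj | hj
  · rw [h.T_mul_N_pow k i hj, mul_assoc]
    exact h.N_pow_mul_mem k (mul_mem (Algebra.subset_adjoin (Or.inl ⟨_, hj, rfl⟩)) hx)
  · rw [h.T_mul_N_pow_of_le k i (by omega) hi, smul_mul_assoc]
    exact Submodule.smul_mem _ _ (h.N_pow_mul_mem k hx)

/-! ### The two-sided span -/

section Subset

variable {M : Submodule 𝕜 R} (hF : ∀ j, ∀ z ∈ M, F j * z ∈ M)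

include hF in
theorem F_mul_mem_subsetSpan (t q c l j : ℕ) (ht : c + t = n) :
    ∀ z ∈ subsetSpan M T t q c l, F j * z ∈ subsetSpan M T t q c l := by
  induction t generalizing q c l j with
  | zero =>
    cases q with
    | zero => exact hF j
    | succ q =>
      intro z hz
      rw [(Submodule.mem_bot 𝕜).mp hz, mul_zero]; exact zero_mem _
  | succ t ih =>
    cases q with
    | zero => exact hF j
    | succ q =>
      refine mul_mem_of_mem_subsetSpan_succ (fun x hx => ?_) fun x hx =>
        Submodule.mem_sup_right (ih _ _ _ _ (by omega) x hx)
      obtain ⟨j', hj'⟩ := h.desc_F c l j (by omega)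
      rw [← mul_assoc, hj', mul_assoc]
      exact desc_mul_mem_subsetSpan (ih _ _ _ _ (by omega) x hx)

variable {r : ℕ} (hT : ∀ i, i + 1 < n → i + 1 ≠ r → ∀ z ∈ M, T i * z ∈ M)

include hT

/-- All blocks involve only letters of index at least `l`, so `T i` commutes with them and reaches
`M`. -/
theorem T_mul_mem_subsetSpan_of_lt (t q c l i : ℕ) (ht : c + t = n) (hl : l + q = r) (hlc : l ≤ c)
    (hi : i + 1 < l) : ∀ z ∈ subsetSpan M T t q c l, T i * z ∈ subsetSpan M T t q c l := by
  induction t generalizing q c l with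
  | zero =>
    cases q with
    | zero => exact hT i (by omega) (by omega)
    | succ q =>
      intro z hz
      rw [(Submodule.mem_bot 𝕜).mp hz, mul_zero]; exact zero_mem _
  | succ t ih =>
    cases q with
    | zero => exact hT i (by omega) (by omega)
    | succ q =>
      refine mul_mem_of_mem_subsetSpan_succ (fun x hx => ?_) fun x hx =>
        Submodule.mem_sup_right (ih _ _ _ (by omega) (by omega) (by omega) (by omega) x hx)
      rw [← mul_assoc, h.T_comm_desc (Or.inl hi), mul_assoc]
      exact desc_mul_mem_subsetSpan
        (ih _ _ _ (by omega) (by omega) (by omega) (by omega) x hx)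

/-- Each block raises `i` and `l` by one together (`T_desc`), so `l ≤ i` persists. On reaching `M`
one has `l = r ≤ i`, which avoids the excluded index `r - 1`. -/
theorem T_mul_mem_subsetSpan_of_le_of_lt (t q c l i : ℕ) (ht : c + t = n) (hl : l + q = r)
    (hli : l ≤ i) (hi : i + 1 < c) :
    ∀ z ∈ subsetSpan M T t q c l, T i * z ∈ subsetSpan M T t q c l := by
  induction t generalizing q c l i with
  | zero =>
    cases q with
    | zero => exact hT i (by omega) (by omega)
    | succ q =>
      intro z hz
      rw [(Submodule.mem_bot 𝕜).mp hz, mul_zero]; exact zero_mem _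
  | succ t ih =>
    cases q with
    | zero => exact hT i (by omega) (by omega)
    | succ q =>
      refine mul_mem_of_mem_subsetSpan_succ (fun x hx => ?_) fun x hx =>
        Submodule.mem_sup_right (ih _ _ _ _ (by omega) (by omega) (by omega) (by omega) x hx)
      rw [← mul_assoc, h.T_desc hli hi (by omega), mul_assoc]
      exact desc_mul_mem_subsetSpan
        (ih _ _ _ _ (by omega) (by omega) (by omega) (by omega) x hx)

include hF

/-- Blocks starting below `i` commute with `T i`, which reduces to `i = c`. Then `T c` acts on
subsets as the transposition of `c` and `c + 1`, up to correction terms, with four cases according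
to which of the two lie in `A`. -/
theorem T_mul_mem_subsetSpan (t q c l i : ℕ) (ht : c + t = n) (hl : l + q = r) (hlc : l ≤ c)
    (hci : c ≤ i) (hi : i + 1 < n) :
    ∀ z ∈ subsetSpan M T t q c l, T i * z ∈ subsetSpan M T t q c l := by
  induction t generalizing q c l with
  | zero => omega
  | succ t ih =>
    cases q with
    | zero => exact hT i (by omega) (by omega)
    | succ q =>
      obtain ⟨t, rfl⟩ : ∃ t', t = t' + 1 := ⟨t - 1, by omega⟩
      rcases eq_or_lt_of_le hci with rfl | hci
      · refine mul_mem_of_mem_subsetSpan_succ (fun x hx => ?_) fun x hx => ?_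
        -- Here `c` is in `A`. If `c + 1` is not, it replaces `c`; if both are, `desc_succ_mul_desc`
        -- applies and the emitted `T l` commutes with the later blocks.
        · rw [← mul_assoc, ← descProd_succ_left _ hlc]
          cases q with
          | zero =>
            refine Submodule.mem_sup_right (desc_mul_mem_subsetSpan ?_)
            rwa [subsetSpan_zero] at hx ⊢
          | succ q =>
            revert x
            refine mul_mem_of_mem_subsetSpan_succ (fun y hy => ?_) fun y hy =>
              Submodule.mem_sup_right (desc_mul_mem_subsetSpan hy)
            rw [← mul_assoc, h.desc_succ_mul_desc hlc hi, mul_assoc, mul_assoc]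
            exact desc_mul_mem_subsetSpan (desc_mul_mem_subsetSpan
              (h.T_mul_mem_subsetSpan_of_lt hT _ _ _ _ l (by omega) (by omega) (by omega)
                (by omega) y hy))
        -- Here `c` is not in `A`. If `c + 1` is, the quadratic relation yields the subset with `c`
        -- instead, plus a correction; if neither is, `T c` travels through to `M`.
        · revert x
          refine mul_mem_of_mem_subsetSpan_succ (fun y hy => ?_) fun y hy =>
            Submodule.mem_sup_right (Submodule.mem_sup_right
              (h.T_mul_mem_subsetSpan_of_le_of_lt hT _ _ _ _ c (by omega) (by omega) hlc
                (by omega) y hy))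
          obtain ⟨e, he, hTe⟩ := h.T_mul_T_mul c hi
          rw [descProd_succ_left _ hlc, mul_assoc, hTe, ← mul_assoc (T c),
            ← descProd_succ_left _ hlc]
          refine add_mem (Submodule.smul_mem _ _
            (desc_mul_mem_subsetSpan (subsetSpan_le_succ _ _ _ _ _ _ hy))) ?_
          refine adjoin_mul_mem ?_ he _ (Submodule.mem_sup_right (desc_mul_mem_subsetSpan hy))
          rintro _ ⟨j, rfl⟩
          exact h.F_mul_mem_subsetSpan hF _ _ _ _ j ht
      · refine mul_mem_of_mem_subsetSpan_succ (fun x hx => ?_) fun x hx =>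
          Submodule.mem_sup_right (ih _ _ _ (by omega) (by omega) (by omega) (by omega) x hx)
        rw [← mul_assoc, h.T_comm_desc (Or.inr hci), mul_assoc]
        exact desc_mul_mem_subsetSpan (ih _ _ _ (by omega) (by omega) (by omega) (by omega) x hx)

end Subset

omit h in
theorem desc_mul_mem {Z : Submodule 𝕜 R} (hZ : ∀ i, i + 1 < n → ∀ z ∈ Z, T i * z ∈ Z) (k l : ℕ)
    (hk : k < n) : ∀ z ∈ Z, descProd T k l * z ∈ Z := by
  rcases le_total k l with hkl | hkl
  · intro z hz; rwa [descProd_of_le _ hkl, one_mul]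
  induction k, hkl using Nat.le_induction with
  | base => intro z hz; rwa [descProd_of_le _ le_rfl, one_mul]
  | succ k hlk ih =>
    intro z hz
    rw [descProd_succ_left _ hlk, mul_assoc]
    exact hZ k hk _ (ih (by omega) z hz)

/-- Blocks ending at `l > 0` let `N` pass, with every index lowered by one, so `N` reaches `M`. -/
theorem N_mul_mem_of_pos {M Z : Submodule 𝕜 R} (hZ : ∀ i, i + 1 < n → ∀ z ∈ Z, T i * z ∈ Z)
    (hM : ∀ z ∈ M, N * z ∈ Z) (t q c l : ℕ) (ht : c + t = n) (hl : 0 < l) (hlc : l ≤ c) :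
    ∀ z ∈ subsetSpan M T t q c l, N * z ∈ Z := by
  induction t generalizing q c l with
  | zero =>
    cases q with
    | zero => exact hM
    | succ q =>
      intro z hz
      rw [(Submodule.mem_bot 𝕜).mp hz, mul_zero]; exact zero_mem _
  | succ t ih =>
    cases q with
    | zero => exact hM
    | succ q =>
      refine mul_mem_of_mem_subsetSpan_succ (fun x hx => ?_) fun x hx =>
        ih _ _ _ (by omega) hl (by omega) x hx
      have : N * descProd T c l = descProd T (c - 1) (l - 1) * N := by
        refine descProd_intertwine T N c l _ _ (by omega) fun i hi => ?_
        have := h.T_N (l - 1 + i) (by omega)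
        rw [show l - 1 + i + 1 = l + i by omega] at this
        exact this.symm
      rw [← mul_assoc, this, mul_assoc]
      exact desc_mul_mem hZ _ _ (by omega) _
        (ih _ _ _ (by omega) (by omega) (by omega) x hx)

/-- This treats subsets avoiding `0`. The last letter `T l` of each block extends `T 0 ⋯ T (l-1)`,
and the rest of the block passes to the left of `N`. After `r` blocks, `N * T 0 ⋯ T (r-1)` meets
`M`, where the truncated relation applies. -/
theorem N_mul_range_prod_mul_mem {M Z : Submodule 𝕜 R} {r : ℕ}
    (hZ : ∀ i, i + 1 < n → ∀ z ∈ Z, T i * z ∈ Z)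
    (hM : ∀ z ∈ M, N * ((List.range r).map T).prod * z ∈ Z) (t q c l : ℕ) (ht : c + t = n)
    (hl : l + q = r) (hlc : l < c) :
    ∀ z ∈ subsetSpan M T t q c l, N * ((List.range l).map T).prod * z ∈ Z := by
  induction t generalizing q c l with
  | zero =>
    cases q with
    | zero => rw [show l = r by omega]; exact hM
    | succ q =>
      intro z hz
      rw [(Submodule.mem_bot 𝕜).mp hz, mul_zero]; exact zero_mem _
  | succ t ih =>
    cases q with
    | zero => rw [show l = r by omega]; exact hM
    | succ q =>
      refine mul_mem_of_mem_subsetSpan_succ (fun x hx => ?_) fun x hx =>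
        ih _ _ _ (by omega) hl (by omega) x hx
      have h1 : N * ((List.range l).map T).prod * descProd T c (l + 1) =
          descProd T (c - 1) l * (N * ((List.range l).map T).prod) := by
        refine descProd_intertwine T _ c (l + 1) _ _ (by omega) fun i hi => ?_
        rw [h.N_mul_range_prod_mul_T _ _ (by omega) (by omega)]
        congr 2; omega
      have h2 : N * ((List.range l).map T).prod * T l = N * ((List.range (l + 1)).map T).prod := by
        rw [List.range_succ, List.map_append, List.prod_append]
        simp [mul_assoc]
      rw [descProd_eq_mul_right _ hlc, ← mul_assoc, ← mul_assoc, h1, mul_assoc (descProd _ _ _), h2,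
        mul_assoc (descProd _ _ _)]
      exact desc_mul_mem hZ _ _ (by omega) _
        (ih _ _ _ (by omega) (by omega) (by omega) x hx)

/-- The span of the `T_A * N ^ (n - r) * H` with `|A| = r`. -/
def layer (h : Relations d n u T F N) (r : ℕ) : Submodule 𝕜 R := subsetSpan (h.powSpan (n - r)) T n r 0 0

theorem F_mul_mem_layer (r j : ℕ) : ∀ z ∈ h.layer r, F j * z ∈ h.layer r :=
  h.F_mul_mem_subsetSpan (fun j => h.F_mul_mem_powSpan _ j (Nat.sub_le _ _)) n r 0 0 j (by omega)

theorem T_mul_mem_layer (r i : ℕ) (hr : r ≤ n) (hi : i + 1 < n) :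
    ∀ z ∈ h.layer r, T i * z ∈ h.layer r :=
  h.T_mul_mem_subsetSpan (r := r) (fun j => h.F_mul_mem_powSpan _ j (Nat.sub_le _ _))
    (fun i hi hir => h.T_mul_mem_powSpan _ i hi (by omega)) n r 0 0 i (by omega) (by omega) le_rfl
    (Nat.zero_le _) hi

/-- For `A` the initial segment of length `r` every block is empty and `T_A = 1`. -/
theorem powSpan_le_layer (r : ℕ) (hr : r ≤ n) : h.powSpan (n - r) ≤ h.layer r := by
  have key : ∀ t q l, q ≤ t →
      h.powSpan (n - r) ≤ subsetSpan (h.powSpan (n - r)) T t q l l := by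
    intro t
    induction t with
    | zero => intro q l hq; obtain rfl : q = 0 := by omega
              exact le_rfl
    | succ t ih =>
      intro q l hq
      cases q with
      | zero => exact le_rfl
      | succ q =>
        intro z hz
        have := desc_mul_mem_subsetSpan (T := T) (ih q (l + 1) (by omega) hz)
        rwa [descProd_of_le _ le_rfl, one_mul] at this
  exact key n r 0 hr

/-- If `0 ∈ A`, then `N` joins `N ^ (n - r)` and the layer drops by one; otherwise the truncated
relation absorbs it and the layer is kept. -/
theorem N_mul_mem_layer (hu : u ≠ 0) (r : ℕ) (hr : r ≤ n) (hn : 1 ≤ n) :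
    ∀ z ∈ h.layer r, N * z ∈ h.layer r ⊔ h.layer (r - 1) := by
  obtain ⟨t, rfl⟩ : ∃ t, n = t + 1 := ⟨n - 1, by omega⟩
  have hsucc (k) : ∀ z ∈ h.powSpan k, N * z ∈ h.powSpan (k + 1) := by
    rintro _ ⟨x, hx, rfl⟩
    change N * (N ^ k * x) ∈ _
    rw [← mul_assoc, ← pow_succ']
    exact h.N_pow_mul_mem _ hx
  have hpow : r < t + 1 → ∀ z ∈ h.powSpan (t + 1 - r),
      N * ((List.range r).map T).prod * z ∈ h.layer r := by
    rintro hr _ ⟨x, hx, rfl⟩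
    change N * ((List.range r).map T).prod * (N ^ (t + 1 - r) * x) ∈ _
    rw [← mul_assoc, h.N_mul_range_prod_mul_N_pow hu (t + 1 - r) r (by omega) (by omega),
      smul_mul_assoc]
    exact Submodule.smul_mem _ _ (h.powSpan_le_layer r hr.le (h.N_pow_mul_mem _ hx))
  cases r with
  | zero =>
    intro z hz
    refine Submodule.mem_sup_left ?_
    have := hpow (by omega) z (by rwa [layer, subsetSpan_zero] at hz)
    simpa using this
  | succ q =>
    refine mul_mem_of_mem_subsetSpan_succ (fun x hx => ?_) fun x hx => ?_
    · rw [descProd_of_le _ le_rfl, one_mul]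
      refine Submodule.mem_sup_right (h.N_mul_mem_of_pos (fun i hi => h.T_mul_mem_layer _ i
        (by omega) hi) (fun z hz => ?_) t q 1 1 (by omega) (by omega) le_rfl x hx)
      refine h.powSpan_le_layer _ (by omega) ?_
      have := hsucc _ z hz
      rwa [show t + 1 - (q + 1) + 1 = t + 1 - (q + 1 - 1) by omega] at this
    · refine Submodule.mem_sup_left ?_
      rcases lt_or_ge (q + 1) (t + 1) with hq | hq
      · have := h.N_mul_range_prod_mul_mem (r := q + 1) (fun i hi => h.T_mul_mem_layer _ i hr hi)
          (hpow hq) t (q + 1) 1 0 (by omega) (by omega) (by omega) x hx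
        simpa using this
      -- When `r = n` no subset of size `r` avoids `0`, so the span in question is zero.
      · have key : ∀ (M : Submodule 𝕜 R) t q c l, t < q → subsetSpan M T t q c l = ⊥ := by
          intro M t
          induction t with
          | zero => intro q c l hq; obtain ⟨q, rfl⟩ : ∃ q', q = q' + 1 := ⟨q - 1, by omega⟩
                    rfl
          | succ t ih =>
            intro q c l hq; obtain ⟨q, rfl⟩ : ∃ q', q = q' + 1 := ⟨q - 1, by omega⟩
            rw [subsetSpan, ih _ _ _ (by omega), ih _ _ _ (by omega)]
            simp
        rw [key _ _ _ _ _ (by omega)] at hx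
        rw [(Submodule.mem_bot 𝕜).mp hx, mul_zero]; exact zero_mem _

/-- An algebra generated by elements satisfying the relations has bounded dimension. -/
theorem rank_le (hd : 1 ≤ d) (hn : 1 ≤ n) (hu : u ≠ 0)
    (hgen : Algebra.adjoin 𝕜 (T '' {i | i + 1 < n} ∪ Set.range F ∪ {N}) = ⊤) :
    Module.rank 𝕜 R ≤
      ((∑ r ∈ Finset.range (n + 1), d ^ r * n.choose r ^ 2 * r.factorial : ℕ) : Cardinal) := by
  set V : Submodule 𝕜 R := (Finset.range (n + 1)).sup fun r => h.layer r with hV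
  have hle (r) (hr : r ≤ n) : h.layer r ≤ V :=
    Finset.le_sup (f := fun r => h.layer r) (Finset.mem_range.mpr (by omega))
  have hmul {a : R} (ha : ∀ r ≤ n, ∀ z ∈ h.layer r, a * z ∈ V) : ∀ z ∈ V, a * z ∈ V := by
    have : V ≤ V.comap (LinearMap.mulLeft 𝕜 a) :=
      Finset.sup_le fun r hr => ha r (by have := Finset.mem_range.mp hr; omega)
    exact fun z hz => this hz
  have hone : (1 : R) ∈ V := by
    refine hle n le_rfl (h.powSpan_le_layer n le_rfl ?_)
    have := h.N_pow_mul_mem 0 (one_mem _)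
    rwa [pow_zero, one_mul, ← Nat.sub_self n] at this
  have htop : V = ⊤ := by
    refine Submodule.eq_top_iff'.mpr fun x => ?_
    have hx : x ∈ Algebra.adjoin 𝕜 (T '' {i | i + 1 < n} ∪ Set.range F ∪ {N}) := hgen ▸ trivial
    rw [← mul_one x]
    refine adjoin_mul_mem ?_ hx 1 hone
    rintro _ ((⟨i, hi, rfl⟩ | ⟨j, rfl⟩) | rfl)
    · exact hmul fun r hr z hz => hle r hr (h.T_mul_mem_layer r i hr hi z hz)
    · exact hmul fun r hr z hz => hle r hr (h.F_mul_mem_layer r j z hz)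
    · exact hmul fun r hr z hz => sup_le (hle r hr) (hle (r - 1) (by omega))
        (h.N_mul_mem_layer hu r hr hn z hz)
  have hrank (s : Finset ℕ) (hs : ∀ r ∈ s, r ≤ n) :
      Module.rank 𝕜 (s.sup fun r => h.layer r : Submodule 𝕜 R) ≤
        ((∑ r ∈ s, d ^ r * n.choose r ^ 2 * r.factorial : ℕ) : Cardinal) := by
    induction s using Finset.induction_on with
    | empty => rw [Finset.sup_empty, rank_bot]; exact zero_le
    | insert r s hrs ih =>
      rw [Finset.sup_insert, Finset.sum_insert hrs, Nat.cast_add]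
      refine (Submodule.rank_add_le_rank_add_rank _ _).trans
        (add_le_add ?_ (ih fun r hr => hs r (Finset.mem_insert_of_mem hr)))
      have hr := hs r (Finset.mem_insert_self _ _)
      refine (rank_subsetSpan_le _ T _ (h.rank_powSpan_le hd (n - r) r (by omega)) _ _ _ _).trans
        (le_of_eq ?_)
      congr 1
      have h1 := Nat.factorial_mul_ascFactorial (n - r) r
      rw [show n - r + r = n by omega] at h1
      have h2 := Nat.choose_mul_factorial_mul_factorial hr
      -- One binomial coefficient comes from the cosets on the right, the other from the subsets `A`
      -- on the left.
      have h3 : (n - r + 1).ascFactorial r = n.choose r * r.factorial := by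
        refine Nat.eq_of_mul_eq_mul_left (Nat.factorial_pos (n - r)) ?_
        rw [h1, ← h2]; ring
      rw [h3]; ring
  have := hrank (Finset.range (n + 1)) fun r hr => by have := Finset.mem_range.mp hr; omega
  rwa [← hV, htop, rank_top] at this

end Relations

end Abstract

/-! ### The relations in the Rook Yokonuma-Hecke algebra -/

theorem coe_simple {n : ℕ} (i : Fin (n - 1)) (j : Fin n) :
    ((simple i j : Fin n) : ℕ) = Equiv.swap (i : ℕ) (i + 1) j := by
  simp only [simple, Equiv.swap_apply_def, lo, hi, Fin.ext_iff]
  split_ifs <;> rfl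

section Presented

variable (K : Type*) [Field K] (d n : ℕ)

/-- `F_i` for a natural number `i`, equal to `1` if `n ≤ i`. -/
noncomputable def Fnat (i : ℕ) : RY K d n := if h : i < n then F K d n ⟨i, h⟩ else 1

variable {K d n} in
theorem Tnat_of_lt {i : ℕ} (h : i < n - 1) : Tnat K d n i = T K d n ⟨i, h⟩ := dif_pos h

variable {K d n} in
theorem Fnat_of_lt {i : ℕ} (h : i < n) : Fnat K d n i = F K d n ⟨i, h⟩ := dif_pos h

variable {K d n} in
theorem mkRY_rel {a b : FreeAlgebra (RatFunc K) (Gen n)} (h : Rel K d n a b) :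
    mkRY K d n a = mkRY K d n b := RingQuot.mkAlgHom_rel _ h

theorem mkRY_freeT (i) : mkRY K d n (freeT K n i) = T K d n i := rfl

theorem mkRY_freeF (i) : mkRY K d n (freeF K n i) = F K d n i := rfl

theorem mkRY_freeN : mkRY K d n (freeN K n) = N K d n := rfl

theorem list_ofFn_T : List.ofFn (T K d n) = (List.range (n - 1)).map (Tnat K d n) := by
  refine List.ext_getElem (by simp) fun i h1 h2 => ?_
  have : i < n - 1 := by simpa using h1
  simp [Tnat_of_lt this]

theorem relations_RY (hn : 1 ≤ n) :
    Relations d n (u K) (Tnat K d n) (Fnat K d n) (N K d n) where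
  braid i hi := by
    have := mkRY_rel (Rel.braid (K := K) (d := d) (n := n) ⟨i, by omega⟩ ⟨i + 1, by omega⟩ rfl)
    simpa [mkRY_freeT, Tnat_of_lt (show i < n - 1 by omega),
      Tnat_of_lt (show i + 1 < n - 1 by omega)] using this
  comm i j hij := by
    by_cases hj : j < n - 1
    · have := mkRY_rel (Rel.T_comm (K := K) (d := d) (n := n) ⟨i, by omega⟩ ⟨j, hj⟩ hij)
      simpa [mkRY_freeT, Tnat_of_lt (show i < n - 1 by omega), Tnat_of_lt hj] using this
    · simp [Tnat, hj]
  F_pow i := by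
    by_cases hi : i < n
    · have := mkRY_rel (Rel.F_pow (K := K) (d := d) (n := n) ⟨i, hi⟩)
      simpa [mkRY_freeF, Fnat_of_lt hi] using this
    · simp [Fnat, hi]
  F_comm i j := by
    by_cases hi : i < n
    · by_cases hj : j < n
      · have := mkRY_rel (Rel.F_comm (K := K) (d := d) (n := n) ⟨i, hi⟩ ⟨j, hj⟩)
        simpa [mkRY_freeF, Fnat_of_lt hi, Fnat_of_lt hj] using this
      · simp [Fnat, hj]
    · simp [Fnat, hi]
  F_of_le i hi := dif_neg (by omega)
  quadratic i hi := by
    have hi' : i < n - 1 := by omega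
    have := mkRY_rel (Rel.quadratic (K := K) (d := d) (n := n) ⟨i, hi'⟩)
    refine ⟨(u K - 1) • (F K d n (lo ⟨i, hi'⟩) ^ ((d ^ 2 - d) / 2) *
      mkRY K d n (freeE K d n ⟨i, hi'⟩)), ?_, ?_⟩
    · have hF (j) : F K d n j ∈ Algebra.adjoin (RatFunc K) (Set.range (Fnat K d n)) :=
        Algebra.subset_adjoin ⟨j, Fnat_of_lt j.2⟩
      refine Subalgebra.smul_mem _ (mul_mem (pow_mem (hF _) _) ?_) _
      rw [freeE, map_smul, map_sum]
      refine Subalgebra.smul_mem _ (sum_mem fun k _ => ?_) _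
      rw [map_mul, map_pow, map_pow]
      exact mul_mem (pow_mem (hF _) _) (pow_mem (hF _) _)
    · rw [map_pow, map_add, map_smul, map_smul, map_mul, map_mul, map_pow, map_one, mkRY_freeT,
        mkRY_freeF] at this
      rw [Tnat_of_lt hi', ← sq, this, smul_mul_assoc]
  T_F i j hi := by
    have hi' : i < n - 1 := by omega
    by_cases hj : j < n
    · have := mkRY_rel (Rel.T_F (K := K) (d := d) (n := n) ⟨i, hi'⟩ ⟨j, hj⟩)
      rw [map_mul, map_mul, mkRY_freeT, mkRY_freeF, mkRY_freeF] at this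
      rw [Tnat_of_lt hi', Fnat_of_lt hj, this]
      have h2 := coe_simple ⟨i, hi'⟩ (⟨j, hj⟩ : Fin n)
      rw [← h2, Fnat_of_lt (simple ⟨i, hi'⟩ ⟨j, hj⟩).2]
    · rw [Equiv.swap_apply_of_ne_of_ne (by omega) (by omega)]
      simp [Fnat, hj]
  F_N i hi := by
    have := mkRY_rel (Rel.F_N (K := K) (d := d) (n := n) ⟨i, by omega⟩)
    rw [map_mul, map_mul, mkRY_freeN, mkRY_freeF, mkRY_freeF] at this
    rw [Fnat_of_lt (show i < n by omega), Fnat_of_lt hi]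
    exact this
  N_F_first := by
    have := mkRY_rel (Rel.N_F_first (K := K) (d := d) (n := n) ⟨0, hn⟩ rfl)
    rw [map_mul, mkRY_freeN, mkRY_freeF] at this
    rw [Fnat_of_lt hn, this]
  F_last_N i hi := by
    by_cases hin : i < n
    · have := mkRY_rel (Rel.F_last_N (K := K) (d := d) (n := n) ⟨i, hin⟩ (by simp; omega))
      rw [map_mul, mkRY_freeN, mkRY_freeF] at this
      rw [Fnat_of_lt hin, this]
    · simp [Fnat, hin]
  N_pow_T i hi := by
    have hi' : i < n - 1 := by omega
    have := mkRY_rel (Rel.N_pow_T (K := K) (d := d) (n := n) ⟨i, hi'⟩)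
    rw [map_mul, map_smul, map_pow, mkRY_freeN, mkRY_freeT] at this
    rw [Tnat_of_lt hi', this]
  T_N_pow i hi := by
    have hi' : i < n - 1 := by omega
    have := mkRY_rel (Rel.T_N_pow (K := K) (d := d) (n := n) ⟨i, hi'⟩)
    rw [map_mul, map_smul, map_pow, mkRY_freeN, mkRY_freeT] at this
    rw [Tnat_of_lt hi', this]
  T_N i hi := by
    have := mkRY_rel (Rel.T_N (K := K) (d := d) (n := n) ⟨i, by omega⟩ ⟨i + 1, by omega⟩ rfl)
    rw [map_mul, map_mul, mkRY_freeN, mkRY_freeT, mkRY_freeT] at this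
    rw [Tnat_of_lt (show i < n - 1 by omega), Tnat_of_lt (show i + 1 < n - 1 by omega), this]
  N_T_N := by
    have := mkRY_rel (Rel.N_T_N (K := K) (d := d) (n := n))
    rw [map_mul, map_mul, map_smul, mkRY_freeN, map_list_prod, List.map_ofFn] at this
    rw [← list_ofFn_T]
    exact this

theorem adjoin_generators_eq_top :
    Algebra.adjoin (RatFunc K)
      (Tnat K d n '' {i | i + 1 < n} ∪ Set.range (Fnat K d n) ∪ {N K d n}) = ⊤ := by
  rw [eq_top_iff, ← (AlgHom.range_eq_top (mkRY K d n)).mpr (RingQuot.mkAlgHom_surjective _ _),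
    ← Algebra.map_top, ← FreeAlgebra.adjoin_range_ι, AlgHom.map_adjoin]
  refine Algebra.adjoin_mono ?_
  rintro _ ⟨_, ⟨g, rfl⟩, rfl⟩
  cases g with
  | T i => exact Or.inl (Or.inl ⟨i, by simp; omega, Tnat_of_lt i.2⟩)
  | F i => exact Or.inl (Or.inr ⟨i, Fnat_of_lt i.2⟩)
  | N => exact Or.inr rfl

theorem rank_RY_le (hd : 1 ≤ d) (hn : 1 ≤ n) :
    Module.rank (RatFunc K) (RY K d n) ≤
      ((∑ r ∈ Finset.range (n + 1), d ^ r * n.choose r ^ 2 * r.factorial : ℕ) : Cardinal) :=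
  (relations_RY K d n hn).rank_le hd hn RatFunc.X_ne_zero (adjoin_generators_eq_top K d n)

end Presented

/-! ### The coefficients of the operators `T` -/

/-! ### The operators on basis tensors and the verification of the relations. -/

section Coefficients

variable {A : Type*} [CommRing A] (σ : ℕ → A) (v : A)

/-- The coefficient of `x ⊗ y` in `T (x ⊗ y)`. -/
def coefSame (s t a b : ℕ) : A :=
  if s = t then (if a = b then σ s * v ^ 2 else if b < a then 0 else σ s * (v ^ 2 - 1)) else 0

/-- The coefficient of `y ⊗ x` in `T (x ⊗ y)`. -/
def coefFlip (s t a b : ℕ) : A :=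
  if s = t then (if a = b then 0 else σ s * v) else v

variable {σ v}

theorem coefSame_of_ne {s t : ℕ} (h : s ≠ t) (a b : ℕ) : coefSame σ v s t a b = 0 := if_neg h

theorem coefFlip_of_ne {s t : ℕ} (h : s ≠ t) (a b : ℕ) : coefFlip σ v s t a b = v := if_neg h

/-- The coefficient of `x ⊗ y` in the quadratic relation; `if s = t then σ s else 0` is the
eigenvalue of `F_i^{(d^2-d)/2} E_i`. -/
theorem coef_quadratic_same (hσ : ∀ s, σ s ^ 2 = 1) (s t a b : ℕ) :
    coefSame σ v s t a b ^ 2 + coefFlip σ v s t a b * coefFlip σ v t s b a =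
      v ^ 2 + (v ^ 2 - 1) * ((if s = t then σ s else 0) * coefSame σ v s t a b) := by
  rcases eq_or_ne s t with rfl | hst
  · have h := hσ s
    simp only [coefSame, coefFlip, if_true]
    split_ifs <;> first | (exfalso; omega) | linear_combination v ^ 2 * h
  · simp only [coefSame_of_ne, coefFlip_of_ne, hst, hst.symm, ne_eq, not_false_eq_true, if_false]
    ring

theorem coef_quadratic_flip (s t a b : ℕ) :
    coefSame σ v s t a b * coefFlip σ v s t a b + coefFlip σ v s t a b * coefSame σ v t s b a =
      (v ^ 2 - 1) * ((if s = t then σ s else 0) * coefFlip σ v s t a b) := by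
  rcases eq_or_ne s t with rfl | hst
  · simp only [coefSame, coefFlip, if_true]
    split_ifs <;> first | (exfalso; omega) | ring
  · simp only [coefSame_of_ne, coefFlip_of_ne, hst, hst.symm, ne_eq, not_false_eq_true, if_false]
    ring

/-- The coefficient of `x ⊗ y ⊗ z` in the braid relation. The next two lemmas give those of `y ⊗ x ⊗
z` and `x ⊗ z ⊗ y`; the three remaining ones agree by commutativity of the scalars. -/
theorem coef_braid_same (s t w a b c : ℕ) :
    coefSame σ v s t a b * coefSame σ v t w b c * coefSame σ v s t a b +
        coefFlip σ v s t a b * coefSame σ v s w a c * coefFlip σ v t s b a =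
      coefSame σ v t w b c * coefSame σ v s t a b * coefSame σ v t w b c +
        coefFlip σ v t w b c * coefSame σ v s w a c * coefFlip σ v w t c b := by
  rcases eq_or_ne s t with rfl | hst
  · rcases eq_or_ne s w with rfl | hsw
    · simp only [coefSame, coefFlip, if_true]
      split_ifs <;> first | (exfalso; omega) | ring
    · simp only [coefSame_of_ne hsw]
      ring
  · rcases eq_or_ne t w with rfl | htw
    · simp only [coefSame_of_ne hst]
      ring
    · simp only [coefSame_of_ne hst, coefSame_of_ne htw, coefFlip_of_ne hst, coefFlip_of_ne htw,
        coefFlip_of_ne hst.symm, coefFlip_of_ne htw.symm]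

theorem coef_braid_flip_left (s t w a b c : ℕ) :
    coefSame σ v s t a b * coefSame σ v t w b c * coefFlip σ v s t a b +
        coefFlip σ v s t a b * coefSame σ v s w a c * coefSame σ v t s b a =
      coefSame σ v t w b c * coefFlip σ v s t a b * coefSame σ v s w a c := by
  rcases eq_or_ne s t with rfl | hst
  · rcases eq_or_ne s w with rfl | hsw
    · simp only [coefSame, coefFlip, if_true]
      split_ifs <;> first | (exfalso; omega) | ring
    · simp only [coefSame_of_ne hsw]
      ring
  · rcases eq_or_ne t w with rfl | htw
    · simp only [coefSame_of_ne hst, coefSame_of_ne hst.symm]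
      ring
    · simp only [coefSame_of_ne hst, coefSame_of_ne hst.symm, coefSame_of_ne htw]
      ring

theorem coef_braid_flip_right (s t w a b c : ℕ) :
    coefSame σ v s t a b * coefFlip σ v t w b c * coefSame σ v s w a c =
      coefSame σ v t w b c * coefSame σ v s t a b * coefFlip σ v t w b c +
        coefFlip σ v t w b c * coefSame σ v s w a c * coefSame σ v w t c b := by
  rcases eq_or_ne t w with rfl | htw
  · rcases eq_or_ne s t with rfl | hst
    · simp only [coefSame, coefFlip, if_true]
      split_ifs <;> first | (exfalso; omega) | ring
    · simp only [coefSame_of_ne hst]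
      ring
  · rcases eq_or_ne s t with rfl | hst
    · simp only [coefSame_of_ne htw, coefSame_of_ne htw.symm]
      ring
    · simp only [coefSame_of_ne hst, coefSame_of_ne htw, coefSame_of_ne htw.symm]
      ring

end Coefficients
/-! ### The operators with respect to a basis -/

theorem simple_lo {n : ℕ} (i : Fin (n - 1)) : simple i (lo i) = hi i := Equiv.swap_apply_left _ _

theorem simple_hi {n : ℕ} (i : Fin (n - 1)) : simple i (hi i) = lo i := Equiv.swap_apply_right _ _

theorem simple_of_ne {n : ℕ} {i : Fin (n - 1)} {j : Fin n} (h1 : (j : ℕ) ≠ i)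
    (h2 : (j : ℕ) ≠ i + 1) : simple i j = j :=
  Equiv.swap_apply_of_ne_of_ne (fun h => h1 (congrArg Fin.val h)) fun h => h2 (congrArg Fin.val h)

theorem simple_simple {n : ℕ} (i : Fin (n - 1)) (j : Fin n) : simple i (simple i j) = j :=
  Equiv.swap_apply_self _ _ _

theorem simple_inv {n : ℕ} (i : Fin (n - 1)) : (simple i)⁻¹ = simple i := Equiv.swap_inv _ _

theorem lo_ne_hi {n : ℕ} (i : Fin (n - 1)) : lo i ≠ hi i := by simp [lo, hi, Fin.ext_iff]

theorem coe_finRotate_eq {n : ℕ} (j : Fin n) : (finRotate n j : ℕ) = ((j : ℕ) + 1) % n := by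
  obtain ⟨m, rfl⟩ : ∃ m, n = m + 1 := ⟨n - 1, by have := j.2; omega⟩
  rw [coe_finRotate]
  split_ifs with h
  · simp [h]
  · rw [Nat.mod_eq_of_lt]
    have : (j : ℕ) ≠ m := fun h' => h (Fin.ext h')
    omega

theorem coe_finRotate_pow {n : ℕ} (k : ℕ) (j : Fin n) :
    ((finRotate n ^ k) j : ℕ) = ((j : ℕ) + k) % n := by
  induction k with
  | zero => simp [Nat.mod_eq_of_lt j.2]
  | succ k ih =>
    rw [pow_succ', Equiv.Perm.mul_apply, coe_finRotate_eq, ih, Nat.mod_add_mod, add_assoc]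

variable {d n : ℕ}

theorem upper_eq_add_one (hd : 1 ≤ d) (x : Label d n) : ∃ s : Fin d, upper x = s + 1 := by
  cases x with
  | none => exact ⟨⟨d - 1, by omega⟩, by simp only [upper]; omega⟩
  | some p => exact ⟨p.2, rfl⟩

theorem label_ext {x y : Label d n} (hu : upper x = upper y) (hl : lower x = lower y) : x = y := by
  cases x with
  | none => cases y with
    | none => rfl
    | some p => simp [lower] at hl
  | some p => cases y with
    | none => simp [lower] at hl
    | some q =>
      simp only [lower, upper, add_left_inj] at hl hu
      exact congrArg some (Prod.ext (Fin.ext hl) (Fin.ext hu))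

section Operators

variable {A : Type*} [CommRing A] {M : Type*} [AddCommMonoid M] [Module A M]
  (b : Module.Basis (Fin n → Label d n) A M) (v ξ : A)

/-- The sign attached to an upper index. -/
def sign (A : Type*) [CommRing A] (d s : ℕ) : A := (-1) ^ ((d - 1) * s)

theorem sign_sq (d s : ℕ) : sign A d s ^ 2 = 1 := by
  rw [sign, ← pow_mul, mul_comm, pow_mul]; simp

/-- As `d * (d - 1)` is even, `T` acts on `v_0 ⊗ v_0` by `+u`, which its relations with the powers
of `N` require. -/
theorem sign_self (d : ℕ) : sign A d d = 1 := by
  rw [sign, Even.neg_one_pow]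
  rw [mul_comm]
  exact Nat.even_mul_pred_self d

/-- The coefficient of `x ⊗ y` in `T (x ⊗ y)`, for labels. -/
def labelSame (x y : Label d n) : A :=
  coefSame (sign A d) v (upper x) (upper y) (lower x) (lower y)

/-- The coefficient of `y ⊗ x` in `T (x ⊗ y)`, for labels. -/
def labelFlip (x y : Label d n) : A :=
  coefFlip (sign A d) v (upper x) (upper y) (lower x) (lower y)

/-- The operator `T` in the factors `i` and `i + 1`. -/
noncomputable def genT (i : Fin (n - 1)) : Module.End A M :=
  b.constr A fun f => labelSame v (f (lo i)) (f (hi i)) • b f +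
    labelFlip v (f (lo i)) (f (hi i)) • b (f ∘ simple i)

/-- The operator `F` in the factor `i`. -/
noncomputable def genF (i : Fin n) : Module.End A M :=
  b.constr A fun f => ξ ^ upper (f i) • b f

/-- The number of factors other than `v_0`. -/
def suppCard (f : Fin n → Label d n) : ℕ := (Finset.univ.filter fun k => f k ≠ none).card

/-- The operator `N`. -/
noncomputable def genN : Module.End A M :=
  b.constr A fun f =>
    if ∀ k : Fin n, (k : ℕ) = 0 → f k = none then v ^ suppCard f • b (f ∘ finRotate n) else 0

theorem genT_apply (i : Fin (n - 1)) (f : Fin n → Label d n) :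
    genT b v i (b f) = labelSame v (f (lo i)) (f (hi i)) • b f +
      labelFlip v (f (lo i)) (f (hi i)) • b (f ∘ simple i) := b.constr_basis _ _ _

theorem genF_apply (i : Fin n) (f : Fin n → Label d n) :
    genF b ξ i (b f) = ξ ^ upper (f i) • b f := b.constr_basis _ _ _

theorem genN_apply (f : Fin n → Label d n) :
    genN b v (b f) = if ∀ k : Fin n, (k : ℕ) = 0 → f k = none then
      v ^ suppCard f • b (f ∘ finRotate n) else 0 := b.constr_basis _ _ _

theorem suppCard_comp (f : Fin n → Label d n) (σ : Equiv.Perm (Fin n)) :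
    suppCard (f ∘ σ) = suppCard f := by
  refine Finset.card_bij (fun k _ => σ k) (by simp) (fun _ _ _ _ h => σ.injective h) fun k hk =>
    ⟨σ.symm k, by simpa using hk, by simp⟩

/-- Each rotation preserves the number of factors other than `v_0`, so every step contributes the
same power of `v`. -/
theorem genN_pow_apply {k : ℕ} (hk : k ≤ n) (f : Fin n → Label d n) :
    (genN b v ^ k) (b f) = if ∀ j : Fin n, (j : ℕ) < k → f j = none then
      v ^ (k * suppCard f) • b (f ∘ ⇑(finRotate n ^ k)) else 0 := by
  induction k generalizing f with
  | zero => simp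
  | succ k ih =>
    have hrot (j : Fin n) (hj : (j : ℕ) < k) : finRotate n j = ⟨j + 1, by omega⟩ := by
      refine Fin.ext ?_
      rw [coe_finRotate_eq, Nat.mod_eq_of_lt (by omega)]
    rw [pow_succ, Module.End.mul_apply, genN_apply]
    by_cases h0 : ∀ k : Fin n, (k : ℕ) = 0 → f k = none
    · rw [if_pos h0, map_smul, ih (by omega), suppCard_comp]
      by_cases h1 : ∀ j : Fin n, (j : ℕ) < k + 1 → f j = none
      · rw [if_pos h1, if_pos, smul_smul, ← pow_add, pow_succ' (finRotate n)]
        · congr 2; ring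
        · intro j hj
          rw [Function.comp_apply, hrot j hj]
          exact h1 _ (by simp; omega)
      · rw [if_neg h1, if_neg, smul_zero]
        refine fun h2 => h1 fun j hj => ?_
        rcases Nat.eq_zero_or_pos (j : ℕ) with hj0 | hj0
        · exact h0 j hj0
        · have := h2 ⟨j - 1, by omega⟩ (by simp; omega)
          rw [Function.comp_apply, hrot _ (by simp; omega)] at this
          convert this using 2
          refine Fin.ext ?_
          simp; omega
    · rw [if_neg h0, map_zero, if_neg]
      exact fun h1 => h0 fun j hj => h1 j (by omega)

theorem labelSame_none : labelSame v (none : Label d n) none = v ^ 2 := by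
  simp [labelSame, coefSame, upper, sign_self]

theorem labelFlip_none : labelFlip v (none : Label d n) none = 0 := by
  simp [labelFlip, coefFlip]

theorem labelSame_right_none {x : Label d n} (hx : x ≠ none) : labelSame v x none = 0 := by
  cases x with
  | none => exact absurd rfl hx
  | some p => simp [labelSame, coefSame, lower]

theorem labelFlip_right_none {x : Label d n} (hx : x ≠ none) : labelFlip v x none = v := by
  cases x with
  | none => exact absurd rfl hx
  | some p =>
    rw [labelFlip, coefFlip]
    split_ifs with h1 h2
    · simp [lower] at h2
    · rw [h1]; simp [upper, sign_self]
    · rfl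

theorem comp_simple_of_eq {f : Fin n → Label d n} {i : Fin (n - 1)} (h : f (lo i) = f (hi i)) :
    f ∘ simple i = f := by
  funext j
  rw [Function.comp_apply, simple, Equiv.swap_apply_def]
  split_ifs with h1 h2
  · rw [h1, h]
  · rw [h2, h]
  · rfl

theorem genT_apply_of_none {f : Fin n → Label d n} {i : Fin (n - 1)} (h1 : f (lo i) = none)
    (h2 : f (hi i) = none) : genT b v i (b f) = v ^ 2 • b f := by
  rw [genT_apply, h1, h2, labelSame_none, labelFlip_none, zero_smul, add_zero]

/-- As `v_0` has the least lower index, moving it to the left never produces the term with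
coefficient `u - 1`. -/
theorem genT_apply_of_right_none {f : Fin n → Label d n} {i : Fin (n - 1)} (h : f (hi i) = none) :
    genT b v i (b f) = (if f (lo i) = none then v ^ 2 else v) • b (f ∘ simple i) := by
  split_ifs with h1
  · rw [genT_apply_of_none b v h1 h, comp_simple_of_eq (h1.trans h.symm)]
  · rw [genT_apply, h, labelSame_right_none _ h1, labelFlip_right_none _ h1, zero_smul, zero_add]

theorem braid_simple {i j : Fin (n - 1)} (h : (i : ℕ) + 1 = j) :
    simple i * simple j * simple i = simple j * simple i * simple j := by
  have hij : hi i = lo j := Fin.ext h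
  have h1 : lo i ≠ hi j := by simp [lo, hi, Fin.ext_iff]; omega
  rw [simple, simple, hij]
  have h2 : lo i ≠ lo j := hij ▸ lo_ne_hi i
  have h3 := lo_ne_hi j
  have e1 := Equiv.swap_mul_swap_mul_swap h3.symm h1.symm
  have e2 := Equiv.swap_mul_swap_mul_swap h2 h1
  rw [Equiv.swap_comm (hi j) (lo j)] at e1
  rw [Equiv.swap_comm (lo i) (lo j)] at e2 ⊢
  rw [e1, e2, Equiv.swap_comm]

variable {v ξ}

theorem genT_braid {i j : Fin (n - 1)} (h : (i : ℕ) + 1 = j) :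
    genT b v i * genT b v j * genT b v i = genT b v j * genT b v i * genT b v j := by
  refine b.ext fun f => ?_
  have hij : lo j = hi i := Fin.ext h.symm
  have e1 : simple i (hi j) = hi j := simple_of_ne (by simp [hi]; omega) (by simp [hi]; omega)
  have e2 : simple j (lo i) = lo i := simple_of_ne (by simp [lo]; omega) (by simp [lo]; omega)
  have e3 : simple j (hi i) = hi j := by rw [← hij, simple_lo]
  have e4 : simple j (hi j) = hi i := by rw [simple_hi, hij]
  have hw : f ∘ simple i ∘ simple j ∘ simple i = f ∘ simple j ∘ simple i ∘ simple j :=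
    congrArg (fun σ : Equiv.Perm (Fin n) => f ∘ σ) (braid_simple h)
  have e5 : f ∘ simple i ∘ simple i = f := by funext k; simp [simple_simple]
  have e6 : f ∘ simple j ∘ simple j = f := by funext k; simp [simple_simple]
  simp only [Module.End.mul_apply, genT_apply, map_add, map_smul, Function.comp_apply, hij,
    simple_lo, simple_hi, e1, e2, e3, e4, Function.comp_assoc, hw, e5, e6]
  have c1 := coef_braid_same (σ := sign A d) (v := v) (upper (f (lo i))) (upper (f (hi i)))
    (upper (f (hi j))) (lower (f (lo i))) (lower (f (hi i))) (lower (f (hi j)))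
  have c2 := coef_braid_flip_left (σ := sign A d) (v := v) (upper (f (lo i))) (upper (f (hi i)))
    (upper (f (hi j))) (lower (f (lo i))) (lower (f (hi i))) (lower (f (hi j)))
  have c3 := coef_braid_flip_right (σ := sign A d) (v := v) (upper (f (lo i))) (upper (f (hi i)))
    (upper (f (hi j))) (lower (f (lo i))) (lower (f (hi i))) (lower (f (hi j)))
  simp only [labelSame, labelFlip]
  match_scalars
  · linear_combination c1
  · linear_combination c2
  · linear_combination c3
  all_goals ring

theorem genT_comm {i j : Fin (n - 1)} (h : (i : ℕ) + 1 < j) :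
    genT b v i * genT b v j = genT b v j * genT b v i := by
  refine b.ext fun f => ?_
  have e1 : simple i (lo j) = lo j := simple_of_ne (by simp [lo]; omega) (by simp [lo]; omega)
  have e2 : simple i (hi j) = hi j := simple_of_ne (by simp [hi]; omega) (by simp [hi]; omega)
  have e3 : simple j (lo i) = lo i := simple_of_ne (by simp [lo]; omega) (by simp [lo]; omega)
  have e4 : simple j (hi i) = hi i := simple_of_ne (by simp [hi]; omega) (by simp [hi]; omega)
  have hw : f ∘ simple i ∘ simple j = f ∘ simple j ∘ simple i := by
    have : simple i * simple j = simple j * simple i := by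
      refine (Equiv.Perm.Disjoint.commute fun k => ?_).eq
      by_cases h1 : (k : ℕ) = i ∨ (k : ℕ) = i + 1
      · exact Or.inr (simple_of_ne (by omega) (by omega))
      · exact Or.inl (simple_of_ne (by omega) (by omega))
    exact congrArg (fun σ : Equiv.Perm (Fin n) => f ∘ σ) this
  simp only [Module.End.mul_apply, genT_apply, map_add, map_smul, Function.comp_apply, e1, e2, e3,
    e4, Function.comp_assoc, hw]
  module

theorem genF_pow_apply (i : Fin n) (k : ℕ) (f : Fin n → Label d n) :
    (genF b ξ i ^ k) (b f) = (ξ ^ upper (f i)) ^ k • b f := by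
  induction k with
  | zero => simp
  | succ k ih => rw [pow_succ, Module.End.mul_apply, genF_apply, map_smul, ih, smul_smul, pow_succ']

theorem genF_pow (hξ : ξ ^ d = 1) (i : Fin n) : genF b ξ i ^ d = 1 := by
  refine b.ext fun f => ?_
  rw [genF_pow_apply, ← pow_mul, mul_comm, pow_mul, hξ, one_pow, one_smul, Module.End.one_apply]

theorem genF_comm (i j : Fin n) : genF b ξ i * genF b ξ j = genF b ξ j * genF b ξ i := by
  refine b.ext fun f => ?_
  simp only [Module.End.mul_apply, genF_apply, map_smul, smul_smul, mul_comm]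

/-- The unflipped term occurs only for equal upper indices, and then both factors have the same
eigenvalue under `F`. -/
theorem genT_genF (i : Fin (n - 1)) (j : Fin n) :
    genT b v i * genF b ξ j = genF b ξ (simple i j) * genT b v i := by
  refine b.ext fun f => ?_
  simp only [Module.End.mul_apply, genF_apply, genT_apply, map_add, map_smul, Function.comp_apply,
    simple_simple]
  by_cases h : upper (f (lo i)) = upper (f (hi i))
  · have : upper (f (simple i j)) = upper (f j) := by
      rw [simple, Equiv.swap_apply_def]
      split_ifs with h1 h2
      · rw [h1, h]
      · rw [h2, h]
      · rfl
    rw [this]; module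
  · rw [show labelSame v (f (lo i)) (f (hi i)) = 0 from coefSame_of_ne h _ _]
    module

theorem genF_genN (i : Fin (n - 1)) :
    genF b ξ (lo i) * genN b v = genN b v * genF b ξ (hi i) := by
  refine b.ext fun f => ?_
  have : finRotate n (lo i) = hi i := by
    refine Fin.ext ?_
    rw [coe_finRotate_eq, Nat.mod_eq_of_lt (by simp [lo]; omega)]; rfl
  simp only [Module.End.mul_apply, genF_apply, genN_apply, map_smul]
  split_ifs
  · rw [map_smul, genF_apply, Function.comp_apply, this]; module
  · simp

theorem genN_genF (hξ : ξ ^ d = 1) (j : Fin n) (hj : (j : ℕ) = 0) :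
    genN b v * genF b ξ j = genN b v := by
  refine b.ext fun f => ?_
  rw [Module.End.mul_apply, genF_apply, map_smul, genN_apply]
  split_ifs with h
  · rw [h j hj, upper, hξ, one_smul]
  · simp

theorem genF_last_genN (hξ : ξ ^ d = 1) (j : Fin n) (hj : (j : ℕ) + 1 = n) :
    genF b ξ j * genN b v = genN b v := by
  refine b.ext fun f => ?_
  rw [Module.End.mul_apply, genN_apply]
  split_ifs with h
  · rw [map_smul, genF_apply, Function.comp_apply, h _ (by rw [coe_finRotate_eq, hj]; simp), upper,
      hξ, one_smul]
  · simp

theorem genN_pow_genT (i : Fin (n - 1)) :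
    genN b v ^ ((i : ℕ) + 2) * genT b v i = v ^ 2 • genN b v ^ ((i : ℕ) + 2) := by
  refine b.ext fun f => ?_
  have hk : (i : ℕ) + 2 ≤ n := by omega
  have key : (∀ j : Fin n, (j : ℕ) < (i : ℕ) + 2 → (f ∘ simple i) j = none) ↔
      ∀ j : Fin n, (j : ℕ) < (i : ℕ) + 2 → f j = none := by
    have hlt (j : Fin n) (hj : (j : ℕ) < (i : ℕ) + 2) : (simple i j : ℕ) < (i : ℕ) + 2 := by
      rw [coe_simple, Equiv.swap_apply_def]
      split_ifs <;> omega
    refine ⟨fun h j hj => ?_, fun h j hj => h _ (hlt j hj)⟩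
    have := h _ (hlt j hj)
    rwa [Function.comp_apply, simple_simple] at this
  by_cases h : ∀ j : Fin n, (j : ℕ) < (i : ℕ) + 2 → f j = none
  · rw [Module.End.mul_apply, genT_apply_of_none b v (h _ (by simp [lo])) (h _ (by simp [hi])),
      map_smul, LinearMap.smul_apply]
  · rw [Module.End.mul_apply, genT_apply, map_add, map_smul, map_smul, LinearMap.smul_apply,
      genN_pow_apply b v hk, genN_pow_apply b v hk, if_neg h, if_neg (key.not.mpr h)]
    simp

theorem genT_genN_pow (i : Fin (n - 1)) :
    genT b v i * genN b v ^ (n - (i : ℕ)) = v ^ 2 • genN b v ^ (n - (i : ℕ)) := by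
  refine b.ext fun f => ?_
  rw [Module.End.mul_apply, LinearMap.smul_apply, genN_pow_apply b v (Nat.sub_le _ _)]
  split_ifs with h
  · rw [map_smul, genT_apply_of_none, smul_comm]
    · refine h _ ?_
      rw [coe_finRotate_pow]
      simp only [lo]
      rw [show (i : ℕ) + (n - i) = n by omega, Nat.mod_self]; omega
    · refine h _ ?_
      rw [coe_finRotate_pow]
      simp only [hi]
      rw [show (i : ℕ) + 1 + (n - i) = n + 1 by omega, Nat.add_mod_left,
        Nat.mod_eq_of_lt (by have := i.2; omega)]
      have := i.2
      omega
  · simp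

theorem genT_genN {i j : Fin (n - 1)} (h : (i : ℕ) + 1 = j) :
    genT b v i * genN b v = genN b v * genT b v j := by
  refine b.ext fun f => ?_
  have e1 : finRotate n (lo i) = lo j := by
    refine Fin.ext ?_
    rw [coe_finRotate_eq, Nat.mod_eq_of_lt (by simp [lo]; omega)]; exact h
  have e2 : finRotate n (hi i) = hi j := by
    refine Fin.ext ?_
    rw [coe_finRotate_eq, Nat.mod_eq_of_lt (by simp [hi]; omega)]; simp [hi, h]
  have hσ : finRotate n * simple i = simple j * finRotate n := by
    rw [simple, simple, ← e1, ← e2, Equiv.mul_swap_eq_swap_mul]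
  have hw : (f ∘ finRotate n) ∘ simple i = (f ∘ simple j) ∘ finRotate n :=
    congrArg (fun σ : Equiv.Perm (Fin n) => f ∘ σ) hσ
  have key : (∀ k : Fin n, (k : ℕ) = 0 → (f ∘ simple j) k = none) ↔
      ∀ k : Fin n, (k : ℕ) = 0 → f k = none := by
    refine forall₂_congr fun k hk => ?_
    rw [Function.comp_apply, simple_of_ne (by omega) (by omega)]
  rw [Module.End.mul_apply, Module.End.mul_apply, genT_apply, map_add, map_smul, map_smul,
    genN_apply, genN_apply, suppCard_comp]
  simp only [key]
  split_ifs with h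
  · rw [map_smul, genT_apply, hw, Function.comp_apply, Function.comp_apply, e1, e2]
    module
  · simp

/-- The operator `T` with a natural number as its index. -/
noncomputable def genTnat (b : Module.Basis (Fin n → Label d n) A M) (v : A) (i : ℕ) :
    Module.End A M := if h : i < n - 1 then genT b v ⟨i, h⟩ else 1

/-- `T 0 ⋯ T (m-1)` carries the `v_0` at position `m` to the front, shifting the others. Passing a
`v_0` costs `v ^ 2` and passing any other factor costs `v`; the prefactor supplies the missing
powers. -/
theorem prod_genTnat_apply (m : ℕ) (hm : m < n) (f : Fin n → Label d n)
    (hf : f ⟨m, hm⟩ = none) (g : Fin n → Label d n)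
    (hg0 : ∀ j : Fin n, (j : ℕ) = 0 → g j = none)
    (hg1 : ∀ (j : Fin n) (hj : (j : ℕ) + 1 < n), (j : ℕ) < m → g ⟨j + 1, hj⟩ = f j)
    (hg2 : ∀ j : Fin n, m < j → g j = f j) :
    v ^ (Finset.univ.filter fun j : Fin n => (j : ℕ) < m ∧ f j ≠ none).card •
      ((List.range m).map (genTnat b v)).prod (b f) = v ^ (2 * m) • b g := by
  induction m generalizing f with
  | zero =>
    have : f = g := by
      funext j
      rcases Nat.eq_zero_or_pos (j : ℕ) with h | h
      · rw [hg0 j h, ← hf]; congr 1; exact Fin.ext h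
      · exact (hg2 j h).symm
    simp [this]
  | succ m ih =>
    have hm' : m < n - 1 := by omega
    have hlo : lo ⟨m, hm'⟩ = (⟨m, by omega⟩ : Fin n) := rfl
    have hhi : hi ⟨m, hm'⟩ = (⟨m + 1, hm⟩ : Fin n) := rfl
    have hT : genTnat b v m = genT b v ⟨m, hm'⟩ := dif_pos hm'
    have hne (j : Fin n) (h1 : (j : ℕ) ≠ m) (h2 : (j : ℕ) ≠ m + 1) :
        (f ∘ simple ⟨m, hm'⟩) j = f j := by rw [Function.comp_apply, simple_of_ne h1 h2]
    have hlo' : (f ∘ simple ⟨m, hm'⟩) ⟨m, by omega⟩ = none := by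
      rw [Function.comp_apply, ← hlo, simple_lo, hhi, hf]
    have hhi' : (f ∘ simple ⟨m, hm'⟩) ⟨m + 1, hm⟩ = f ⟨m, by omega⟩ := by
      rw [Function.comp_apply, ← hhi, simple_hi, hlo]
    have IH := ih (by omega) (f ∘ simple ⟨m, hm'⟩) hlo'
      (fun j hj hjm => by rw [hg1 j hj (by omega), hne j (by omega) (by omega)])
      (fun j hj => by
        by_cases hj' : (j : ℕ) = m + 1
        · have e1 : j = ⟨m + 1, hm⟩ := Fin.ext hj'
          rw [e1, hhi', hg1 ⟨m, by omega⟩ hm (by simp)]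
        · rw [hg2 j (by omega), hne j (by omega) hj'])
    have hfilter : (Finset.univ.filter fun j : Fin n =>
          (j : ℕ) < m ∧ (f ∘ simple ⟨m, hm'⟩) j ≠ none) =
        Finset.univ.filter fun j : Fin n => (j : ℕ) < m ∧ f j ≠ none := by
      refine Finset.filter_congr fun j _ => and_congr_right fun hj => ?_
      rw [hne j (by omega) (by omega)]
    rw [hfilter] at IH
    have hcard : (Finset.univ.filter fun j : Fin n => (j : ℕ) < m + 1 ∧ f j ≠ none).card =
        (Finset.univ.filter fun j : Fin n => (j : ℕ) < m ∧ f j ≠ none).card +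
          if f ⟨m, by omega⟩ = none then 0 else 1 := by
      split_ifs with h0
      · rw [add_zero]
        congr 1
        refine Finset.filter_congr fun j _ => ⟨fun h => ⟨?_, h.2⟩, fun h => ⟨by omega, h.2⟩⟩
        refine lt_of_le_of_ne (Nat.lt_succ_iff.mp h.1) fun hj => h.2 ?_
        rw [← h0]; congr 1; exact Fin.ext hj
      · rw [← Finset.card_insert_of_notMem (a := (⟨m, by omega⟩ : Fin n)) (by simp)]
        congr 1
        ext j
        simp only [Finset.mem_filter, Finset.mem_univ, true_and, Finset.mem_insert]
        constructor
        · rintro ⟨h1, h2⟩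
          rcases Nat.lt_succ_iff_lt_or_eq.mp h1 with h1 | h1
          · exact Or.inr ⟨h1, h2⟩
          · exact Or.inl (Fin.ext h1)
        · rintro (rfl | ⟨h1, h2⟩)
          · exact ⟨by simp, h0⟩
          · exact ⟨by omega, h2⟩
    rw [List.range_succ, List.map_append, List.prod_append, hcard]
    simp only [List.map_cons, List.map_nil, List.prod_cons, List.prod_nil, mul_one,
      Module.End.mul_apply]
    rw [hT, genT_apply_of_right_none b v (by rw [hhi, hf]), map_smul, hlo]
    rw [show v ^ (2 * (m + 1)) = v ^ 2 * v ^ (2 * m) by ring, mul_smul, ← IH, smul_smul, smul_smul]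
    congr 1
    split_ifs <;> ring

theorem list_ofFn_genT : List.ofFn (genT b v) = (List.range (n - 1)).map (genTnat b v) := by
  refine List.ext_getElem (by simp) fun i h1 h2 => ?_
  have : i < n - 1 := by simpa using h1
  simp [genTnat, this]

theorem genN_prod_genN (hn : 1 ≤ n) :
    genN b v * (List.ofFn (genT b v)).prod * genN b v = (v ^ 2) ^ (n - 1) • genN b v := by
  refine b.ext fun f => ?_
  rw [list_ofFn_genT, Module.End.mul_apply, Module.End.mul_apply, LinearMap.smul_apply,
    genN_apply]
  split_ifs with h
  · have hlast : (f ∘ finRotate n) ⟨n - 1, by omega⟩ = none := by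
      refine h _ ?_
      rw [coe_finRotate_eq]
      simp only
      rw [show n - 1 + 1 = n by omega, Nat.mod_self]
    have key := prod_genTnat_apply b (v := v) (n - 1) (by omega) (f ∘ finRotate n) hlast f h
      (fun j hj _ => by
        rw [Function.comp_apply]; congr 1; refine Fin.ext ?_
        rw [coe_finRotate_eq, Nat.mod_eq_of_lt hj])
      (fun j hj => by have := j.2; omega)
    have hcard : (Finset.univ.filter fun j : Fin n =>
        (j : ℕ) < n - 1 ∧ (f ∘ finRotate n) j ≠ none).card = suppCard f := by
      rw [← suppCard_comp f (finRotate n), suppCard]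
      congr 1
      refine Finset.filter_congr fun j _ => ⟨fun h => h.2, fun h' => ⟨?_, h'⟩⟩
      by_contra hj
      refine h' ?_
      rw [← hlast]
      congr 1
      exact Fin.ext (by simp; omega)
    rw [hcard] at key
    -- The weight `v ^ suppCard f` of the first `N` is exactly the prefactor needed: this is the
    -- purpose of `u^{ε/2}`.
    rw [map_smul, key, map_smul, genN_apply, if_pos h, ← pow_mul]
  · simp

end Operators
/-! ### The representation -/

section Roots

variable {A : Type*} [CommRing A] [IsDomain A] {ξ : A} {d : ℕ}

/-- For even `d` one has `ξ ^ (d / 2) = -1`; for odd `d` the exponent is a multiple of `d` and both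
sides are `1`. -/
theorem root_pow_eq_sign (hξ : IsPrimitiveRoot ξ d) (hd : 1 ≤ d) (s : ℕ) :
    (ξ ^ s) ^ ((d ^ 2 - d) / 2) = sign A d s := by
  have hdd : d ^ 2 - d = d * (d - 1) := by rw [Nat.mul_sub_one, sq]
  rcases Nat.even_or_odd' d with ⟨e, rfl | rfl⟩
  · have h1 : ξ ^ e = -1 := by
      have h2 : (ξ ^ e) ^ 2 = 1 := by rw [← pow_mul, mul_comm, hξ.pow_eq_one]
      rcases mul_self_eq_one_iff.mp ((sq _).symm.trans h2) with h | h
      · exact absurd h (hξ.pow_ne_one_of_pos_of_lt (by omega) (by omega))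
      · exact h
    rw [hdd, mul_assoc, Nat.mul_div_cancel_left _ two_pos, sign, ← pow_mul, mul_comm s, mul_assoc,
      pow_mul, h1]
  · rw [hdd, Nat.add_sub_cancel, mul_left_comm, Nat.mul_div_cancel_left _ two_pos, sign,
      Nat.add_sub_cancel, mul_assoc, pow_mul (-1 : A) 2, ← pow_mul, mul_left_comm, pow_mul,
      hξ.pow_eq_one]
    simp

/-- A geometric sum; it shows that `E_i` projects onto the tensors whose factors `i`, `i + 1` have
equal upper indices. -/
theorem sum_root_pow (hξ : IsPrimitiveRoot ξ d) (s t : Fin d) :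
    ∑ k ∈ Finset.range d, (ξ ^ ((s : ℕ) + 1)) ^ k * (ξ ^ ((t : ℕ) + 1)) ^ (d - k) =
      if s = t then (d : A) else 0 := by
  have h1 (m : ℕ) : (ξ ^ m) ^ d = 1 := by rw [← pow_mul, mul_comm, pow_mul, hξ.pow_eq_one, one_pow]
  split_ifs with hst
  · subst hst
    rw [Finset.sum_congr rfl fun k hk => by
      rw [← pow_add, Nat.add_sub_cancel' (Finset.mem_range.mp hk).le, h1]]
    simp
  · have hne : ξ ^ ((s : ℕ) + 1) ≠ ξ ^ ((t : ℕ) + 1) := by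
      intro h
      rw [pow_succ, pow_succ] at h
      exact hst (Fin.ext (hξ.pow_inj s.2 t.2
        (mul_right_cancel₀ (hξ.ne_zero (by have := s.2; omega)) h)))
    have h2 := geom_sum₂_mul (ξ ^ ((s : ℕ) + 1)) (ξ ^ ((t : ℕ) + 1)) d
    rw [h1, h1, sub_self] at h2
    have h3 := (mul_eq_zero.mp h2).resolve_right (sub_ne_zero.mpr hne)
    rw [Finset.sum_congr rfl (g := fun k => ξ ^ ((t : ℕ) + 1) *
      ((ξ ^ ((s : ℕ) + 1)) ^ k * (ξ ^ ((t : ℕ) + 1)) ^ (d - 1 - k)))]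
    · rw [← Finset.mul_sum, h3, mul_zero]
    · intro k hk
      have := Finset.mem_range.mp hk
      rw [mul_left_comm, ← pow_succ', show d - 1 - k + 1 = d - k by omega]

end Roots

section Representation

variable {K : Type*} [Field K] [CharZero K] {d n : ℕ} {A : Type*} [CommRing A] [IsDomain A]
  [Algebra (RatFunc K) A] {M : Type*} [AddCommMonoid M] [Module A M] [Module (RatFunc K) M]
  [IsScalarTower (RatFunc K) A M] (b : Module.Basis (Fin n → Label d n) A M) (v ξ : A)

/-- The homomorphism from the free algebra given by the operators. -/
noncomputable def genLift (K : Type*) [Field K] {d n : ℕ} {A : Type*} [CommRing A]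
    [Algebra (RatFunc K) A] {M : Type*} [AddCommMonoid M] [Module A M] [Module (RatFunc K) M]
    [IsScalarTower (RatFunc K) A M] (b : Module.Basis (Fin n → Label d n) A M) (v ξ : A) :
    FreeAlgebra (RatFunc K) (Gen n) →ₐ[RatFunc K] Module.End A M :=
  FreeAlgebra.lift (RatFunc K) fun
    | Gen.T i => genT b v i
    | Gen.F i => genF b ξ i
    | Gen.N => genN b v

omit [CharZero K] [IsDomain A] in
theorem genLift_freeT (i) : genLift K b v ξ (freeT K n i) = genT b v i :=
  FreeAlgebra.lift_ι_apply _ _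

omit [CharZero K] [IsDomain A] in
theorem genLift_freeF (i) : genLift K b v ξ (freeF K n i) = genF b ξ i :=
  FreeAlgebra.lift_ι_apply _ _

omit [CharZero K] [IsDomain A] in
theorem genLift_freeN : genLift K b v ξ (freeN K n) = genN b v :=
  FreeAlgebra.lift_ι_apply _ _

variable {v ξ}

theorem genLift_freeE (hξ : IsPrimitiveRoot ξ d) (hd : 1 ≤ d) (i : Fin (n - 1))
    (f : Fin n → Label d n) : genLift K b v ξ (freeE K d n i) (b f) =
      (if upper (f (lo i)) = upper (f (hi i)) then (1 : A) else 0) • b f := by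
  have hd0 : (d : RatFunc K) ≠ 0 := by
    have : CharZero (RatFunc K) := charZero_of_injective_algebraMap (algebraMap K _).injective
    exact_mod_cast (show d ≠ 0 by omega)
  obtain ⟨s, hs⟩ := upper_eq_add_one hd (f (lo i))
  obtain ⟨t, ht⟩ := upper_eq_add_one hd (f (hi i))
  rw [freeE, map_smul, map_sum, LinearMap.smul_apply, LinearMap.sum_apply]
  simp only [map_mul, map_pow, genLift_freeF, Module.End.mul_apply, genF_pow_apply, map_smul, hs, ht]
  simp only [smul_smul]
  rw [← Finset.sum_smul]
  simp only [mul_comm ((ξ ^ ((t : ℕ) + 1)) ^ _), sum_root_pow hξ, add_left_inj, ← Fin.ext_iff]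
  rw [← algebraMap_smul A, smul_smul]
  congr 1
  split_ifs
  · rw [← map_natCast (algebraMap (RatFunc K) A), ← map_mul, inv_mul_cancel₀ hd0, map_one]
  · rw [mul_zero]

theorem genT_quadratic (hξ : IsPrimitiveRoot ξ d) (hd : 1 ≤ d)
    (hv : v ^ 2 = algebraMap (RatFunc K) A (u K)) (i : Fin (n - 1)) :
    genT b v i ^ 2 = u K • 1 + (u K - 1) •
      (genF b ξ (lo i) ^ ((d ^ 2 - d) / 2) * genLift K b v ξ (freeE K d n i) * genT b v i) := by
  refine b.ext fun f => ?_
  have e5 : f ∘ simple i ∘ simple i = f := by funext k; simp [simple_simple]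
  have hE (g : Fin n → Label d n) :
      (genF b ξ (lo i) ^ ((d ^ 2 - d) / 2)) (genLift K b v ξ (freeE K d n i) (b g)) =
        (if upper (g (lo i)) = upper (g (hi i)) then sign A d (upper (g (lo i))) else 0) • b g := by
    rw [genLift_freeE b hξ hd, map_smul, genF_pow_apply, root_pow_eq_sign hξ hd]
    split_ifs <;> simp
  rw [LinearMap.add_apply, LinearMap.smul_apply, LinearMap.smul_apply, ← algebraMap_smul A (u K),
    ← algebraMap_smul A (u K - 1), map_sub, map_one, ← hv]
  simp only [sq (genT b v i), Module.End.mul_apply, genT_apply, map_add, map_smul, hE,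
    Function.comp_apply, simple_lo, simple_hi, Function.comp_assoc, e5, Module.End.one_apply]
  have c1 := coef_quadratic_same (σ := sign A d) (v := v) (sign_sq d) (upper (f (lo i)))
    (upper (f (hi i))) (lower (f (lo i))) (lower (f (hi i)))
  have c2 := coef_quadratic_flip (σ := sign A d) (v := v) (upper (f (lo i)))
    (upper (f (hi i))) (lower (f (lo i))) (lower (f (hi i)))
  have hsym : (if upper (f (hi i)) = upper (f (lo i)) then sign A d (upper (f (hi i))) else 0) =
      if upper (f (lo i)) = upper (f (hi i)) then sign A d (upper (f (lo i))) else 0 := by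
    by_cases h : upper (f (lo i)) = upper (f (hi i))
    · rw [h]
    · rw [if_neg h, if_neg (Ne.symm h)]
  rw [hsym]
  simp only [labelSame, labelFlip]
  match_scalars
  · linear_combination c1
  · linear_combination c2

theorem genLift_rel (hξ : IsPrimitiveRoot ξ d) (hd : 1 ≤ d) (hn : 1 ≤ n)
    (hv : v ^ 2 = algebraMap (RatFunc K) A (u K)) {x y : FreeAlgebra (RatFunc K) (Gen n)}
    (h : Rel K d n x y) : genLift K b v ξ x = genLift K b v ξ y := by
  have hu (k : ℕ) (φ : Module.End A M) : (v ^ 2) ^ k • φ = u K ^ k • φ := by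
    rw [hv, ← map_pow]
    exact LinearMap.ext fun m => algebraMap_smul A _ _
  have hu1 (φ : Module.End A M) : v ^ 2 • φ = u K • φ := by simpa using hu 1 φ
  have hT := genLift_freeT (K := K) b v ξ
  have hF := genLift_freeF (K := K) b v ξ
  have hN := genLift_freeN (K := K) b v ξ
  induction h with
  | braid i j h => simp only [map_mul, hT]; exact genT_braid b h
  | T_comm i j h => simp only [map_mul, hT]; exact genT_comm b h
  | F_pow i => simp only [map_pow, map_one, hF]; exact genF_pow b hξ.pow_eq_one i
  | F_comm i j => simp only [map_mul, hF]; exact genF_comm b i j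
  | quadratic i =>
    simp only [map_add, map_smul, map_mul, map_pow, map_one, hT, hF]
    exact genT_quadratic b hξ hd hv i
  | T_F i j => simp only [map_mul, hT, hF]; exact genT_genF b i j
  | F_N i => simp only [map_mul, hF, hN]; exact genF_genN b i
  | N_F_first j h => simp only [map_mul, hF, hN]; exact genN_genF b hξ.pow_eq_one j h
  | F_last_N j h => simp only [map_mul, hF, hN]; exact genF_last_genN b hξ.pow_eq_one j h
  | N_pow_T i =>
    simp only [map_mul, map_pow, map_smul, hT, hN]
    rw [genN_pow_genT, hu1]
  | T_N_pow i =>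
    simp only [map_mul, map_pow, map_smul, hT, hN]
    rw [genT_genN_pow, hu1]
  | T_N i j h => simp only [map_mul, hT, hN]; exact genT_genN b h
  | N_T_N =>
    simp only [map_mul, map_smul, hN, map_list_prod, List.map_ofFn]
    rw [← hu, ← genN_prod_genN b hn]
    congr 3
    exact congrArg List.ofFn (funext hT)

/-- The representation given by the operators. -/
noncomputable def genRep (hξ : IsPrimitiveRoot ξ d) (hd : 1 ≤ d) (hn : 1 ≤ n)
    (hv : v ^ 2 = algebraMap (RatFunc K) A (u K)) : RY K d n →ₐ[RatFunc K] Module.End A M :=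
  RingQuot.liftAlgHom (RatFunc K) ⟨genLift K b v ξ, fun _ _ h => genLift_rel b hξ hd hn hv h⟩

variable (hξ : IsPrimitiveRoot ξ d) (hd : 1 ≤ d) (hn : 1 ≤ n)
  (hv : v ^ 2 = algebraMap (RatFunc K) A (u K))

theorem genRep_mkRY (x) : genRep b hξ hd hn hv (mkRY K d n x) = genLift K b v ξ x :=
  RingQuot.liftAlgHom_mkAlgHom_apply _ _ _ _

theorem genRep_T (i) : genRep b hξ hd hn hv (T K d n i) = genT b v i := by
  rw [T, genRep_mkRY, genLift_freeT]

theorem genRep_F (i) : genRep b hξ hd hn hv (F K d n i) = genF b ξ i := by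
  rw [F, genRep_mkRY, genLift_freeF]

theorem genRep_N : genRep b hξ hd hn hv (N K d n) = genN b v := by
  rw [N, genRep_mkRY, genLift_freeN]

end Representation

/-! ### Words and permutations -/

/-! ### Linear independence: leading terms of the standard elements. -/

section Words

/-- The word `k-1, k-2, …, j`. -/
def descWord (k j : ℕ) : List ℕ := (List.range' j (k - j)).reverse

/-- The concatenation of the words `x_i - 1, …, y_i`. -/
def blockWord {r : ℕ} (x y : Fin r → ℕ) : List ℕ :=
  (List.ofFn fun i => descWord (x i) (y i)).flatten

theorem length_blockWord {r : ℕ} (x y : Fin r → ℕ) :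
    (blockWord x y).length = ∑ i, (x i - y i) := by
  rw [blockWord, List.length_flatten, List.map_ofFn, List.sum_ofFn]
  simp [descWord]

theorem lt_of_mem_blockWord {r m : ℕ} {x y : Fin r → ℕ} (hx : ∀ i, x i ≤ m) {i : ℕ}
    (hi : i ∈ blockWord x y) : i < m := by
  simp only [blockWord, List.mem_flatten, List.mem_ofFn] at hi
  obtain ⟨_, ⟨j, rfl⟩, hi⟩ := hi
  simp only [descWord, List.mem_reverse, List.mem_range'_1] at hi
  have := hx j
  omega

/-- The permutation of the natural numbers given by a word. -/
def natPerm (l : List ℕ) : Equiv.Perm ℕ := (l.map fun i => Equiv.swap i (i + 1)).prod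

theorem natPerm_append (l l' : List ℕ) : natPerm (l ++ l') = natPerm l * natPerm l' := by
  simp [natPerm]

theorem natPerm_descWord_of_lt (k j i : ℕ) (hi : i < j ∨ k < i) :
    natPerm (descWord k j) i = i := by
  rcases le_total k j with hkj | hkj
  · simp [descWord, Nat.sub_eq_zero_of_le hkj, natPerm]
  · obtain ⟨m, rfl⟩ := Nat.exists_eq_add_of_le hkj
    induction m with
    | zero => simp [descWord, natPerm]
    | succ m ih =>
      have : descWord (j + (m + 1)) j = (j + m) :: descWord (j + m) j := by
        rw [descWord, descWord, Nat.add_sub_cancel_left, Nat.add_sub_cancel_left,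
          List.range'_concat]
        simp
      rw [this, natPerm, List.map_cons, List.prod_cons, ← natPerm, Equiv.Perm.mul_apply,
        ih (by omega) (by omega), Equiv.swap_apply_of_ne_of_ne (by omega) (by omega)]

theorem natPerm_descWord_self (k j : ℕ) (hkj : j ≤ k) : natPerm (descWord k j) j = k := by
  obtain ⟨m, rfl⟩ := Nat.exists_eq_add_of_le hkj
  induction m with
  | zero => simp [descWord, natPerm]
  | succ m ih =>
    have : descWord (j + (m + 1)) j = (j + m) :: descWord (j + m) j := by
      rw [descWord, descWord, Nat.add_sub_cancel_left, Nat.add_sub_cancel_left,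
        List.range'_concat]
      simp
    rw [this, natPerm, List.map_cons, List.prod_cons, ← natPerm, Equiv.Perm.mul_apply,
      ih (by omega), Equiv.swap_apply_left, add_assoc]

theorem natPerm_blockWord_of_lt {r : ℕ} (x y : Fin r → ℕ) (j : ℕ) (hj : ∀ i, j < y i) :
    natPerm (blockWord x y) j = j := by
  induction r with
  | zero => simp [blockWord, natPerm]
  | succ r ih =>
    rw [blockWord, List.ofFn_succ, List.flatten_cons, natPerm_append, Equiv.Perm.mul_apply]
    have := ih (fun i => x i.succ) (fun i => y i.succ) fun i => hj _
    rw [blockWord] at this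
    rw [this, natPerm_descWord_of_lt _ _ _ (Or.inl (hj 0))]

/-- The blocks to the right act first and fix everything below their lower ends, hence fix `y i`;
the blocks to the left fix everything above their upper ends, hence fix `x i`. -/
theorem natPerm_blockWord {r : ℕ} {x y : Fin r → ℕ} (hx : StrictMono x) (hy : StrictMono y)
    (hyx : ∀ i, y i ≤ x i) (i : Fin r) : natPerm (blockWord x y) (y i) = x i := by
  induction r with
  | zero => exact i.elim0
  | succ r ih =>
    rw [blockWord, List.ofFn_succ, List.flatten_cons, natPerm_append, Equiv.Perm.mul_apply]
    refine Fin.cases ?_ (fun i => ?_) i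
    · have := natPerm_blockWord_of_lt (fun i => x i.succ) (fun i => y i.succ) (y 0)
        fun i => hy (Fin.succ_pos i)
      rw [blockWord] at this
      rw [this, natPerm_descWord_self _ _ (hyx 0)]
    · have := ih (x := fun i => x i.succ) (y := fun i => y i.succ)
        (hx.comp (Fin.strictMono_succ)) (hy.comp (Fin.strictMono_succ)) (fun i => hyx _) i
      rw [blockWord] at this
      rw [this, natPerm_descWord_of_lt _ _ _ (Or.inr (hx (Fin.succ_pos i)))]

/-- The permutation of `n` points given by a word. -/
def wordPerm (n : ℕ) (l : List ℕ) : Equiv.Perm (Fin n) :=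
  (l.map fun i => if h : i < n - 1 then simple ⟨i, h⟩ else 1).prod

theorem coe_wordPerm {n : ℕ} (l : List ℕ) (hl : ∀ i ∈ l, i < n - 1) (j : Fin n) :
    (wordPerm n l j : ℕ) = natPerm l j := by
  induction l with
  | nil => rfl
  | cons i l ih =>
    have hi := hl i List.mem_cons_self
    rw [wordPerm, List.map_cons, List.prod_cons, ← wordPerm, natPerm, List.map_cons,
      List.prod_cons, ← natPerm, Equiv.Perm.mul_apply, Equiv.Perm.mul_apply, dif_pos hi, coe_simple,
      ih fun i hi => hl i (List.mem_cons_of_mem _ hi)]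

theorem wordPerm_castLE {n r : ℕ} (hr : r ≤ n) (l : List (Fin (r - 1))) (j : Fin r) :
    wordPerm n (l.map Fin.val) (Fin.castLE hr j) = Fin.castLE hr ((l.map simple).prod j) := by
  refine Fin.ext ?_
  rw [coe_wordPerm _ (by simp only [List.mem_map]; rintro _ ⟨i, _, rfl⟩; omega)]
  simp only [Fin.val_castLE]
  induction l with
  | nil => rfl
  | cons i l ih =>
    rw [List.map_cons, natPerm, List.map_cons, List.prod_cons, ← natPerm, Equiv.Perm.mul_apply, ih,
      List.map_cons, List.prod_cons, Equiv.Perm.mul_apply, coe_simple]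

theorem wordPerm_lt {n r : ℕ} (l : List ℕ) (hl : ∀ i ∈ l, i < r - 1) (hr : r ≤ n) (j : Fin n) :
    ((wordPerm n l j : Fin n) : ℕ) < r ↔ (j : ℕ) < r := by
  rw [coe_wordPerm _ fun i hi => by have := hl i hi; omega]
  induction l with
  | nil => rfl
  | cons i l ih =>
    have hi := hl i List.mem_cons_self
    rw [natPerm, List.map_cons, List.prod_cons, ← natPerm, Equiv.Perm.mul_apply,
      ← ih fun i hi => hl i (List.mem_cons_of_mem _ hi), Equiv.swap_apply_def]
    split_ifs <;> omega

theorem add_sub_le_of_strictMono {r : ℕ} {e : Fin r → ℕ} (he : StrictMono e) (i j : Fin r)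
    (hij : i ≤ j) : e i + ((j : ℕ) - i) ≤ e j := by
  obtain ⟨j, hj⟩ := j
  have hij' : (i : ℕ) ≤ j := hij
  induction j, hij' using Nat.le_induction with
  | base => simp
  | succ k hk ih =>
    have h1 := ih (by omega) (by simpa [Fin.le_def] using hk)
    have h2 : e ⟨k, by omega⟩ < e ⟨k + 1, hj⟩ := he (by simp)
    simp only at h1 ⊢
    omega

theorem le_of_strictMono {r : ℕ} {e : Fin r → ℕ} (he : StrictMono e) (i : Fin r) :
    (i : ℕ) ≤ e i := by
  have := add_sub_le_of_strictMono he ⟨0, by have := i.2; omega⟩ i (by simp [Fin.le_def])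
  simp only at this
  omega

theorem le_sub_add_of_strictMono {r n : ℕ} {e : Fin r → ℕ} (he : StrictMono e)
    (hn : ∀ i, e i < n) (i : Fin r) : e i ≤ n - r + i := by
  have h1 := i.2
  have := add_sub_le_of_strictMono he i ⟨r - 1, by omega⟩ (by simp [Fin.le_def]; omega)
  have h2 := hn ⟨r - 1, by omega⟩
  simp only at this
  omega

end Words

/-! ### The action of words -/

section Support

variable {d n : ℕ}

/-- The sum of the positions with a label other than `v_0`. -/
def weight (f : Fin n → Label d n) : ℕ := ∑ j with f j ≠ none, (j : ℕ)

theorem weight_comp_simple_le (f : Fin n → Label d n) (i : Fin (n - 1)) :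
    weight (f ∘ simple i) ≤ weight f + 1 := by
  have h1 : weight (f ∘ simple i) = ∑ j with f j ≠ none, (simple i j : ℕ) := by
    refine Finset.sum_bij' (fun j _ => simple i j) (fun j _ => simple i j) ?_ ?_ ?_ ?_ ?_ <;>
      simp [simple_simple]
  have h2 : ∀ j : Fin n, (simple i j : ℕ) ≤ j + if j = lo i then 1 else 0 := by
    intro j
    rw [coe_simple, Equiv.swap_apply_def]
    simp only [Fin.ext_iff, lo]
    split_ifs <;> omega
  rw [h1, weight]
  refine (Finset.sum_le_sum fun j _ => h2 j).trans ?_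
  rw [Finset.sum_add_distrib, Finset.sum_ite_eq']
  split_ifs <;> omega

theorem comp_wordPerm_cons_inv (f : Fin n → Label d n) (i : ℕ) (l : List ℕ) :
    f ∘ ⇑(wordPerm n (i :: l))⁻¹ =
      (f ∘ ⇑(wordPerm n l)⁻¹) ∘ ⇑(if h : i < n - 1 then simple ⟨i, h⟩ else 1) := by
  have : (wordPerm n (i :: l))⁻¹ =
      (wordPerm n l)⁻¹ * (if h : i < n - 1 then simple ⟨i, h⟩ else 1) := by
    rw [wordPerm, List.map_cons, List.prod_cons, mul_inv_rev, ← wordPerm]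
    split_ifs
    · rw [simple_inv]
    · rw [inv_one]
  rw [this]; rfl

/-- A letter moves at most one non-`v_0` factor to the right. Hence a word too short for the
required increase in weight cannot reach a prescribed support, which rules out proper subwords
below. -/
theorem weight_comp_wordPerm_le (f : Fin n → Label d n) (l : List ℕ) :
    weight (f ∘ ⇑(wordPerm n l)⁻¹) ≤ weight f + l.length := by
  induction l with
  | nil => exact le_rfl
  | cons i l ih =>
    rw [comp_wordPerm_cons_inv]
    split_ifs with h
    · rw [List.length_cons]
      exact (weight_comp_simple_le _ _).trans (by omega)
    · exact ih.trans (by simp)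

theorem extend_comp_inv {r : ℕ} {e : Fin r → Fin n} (he : Function.Injective e)
    (L : Fin r → Label d n) (σ : Equiv.Perm (Fin n)) :
    Function.extend e L (fun _ => none) ∘ ⇑σ⁻¹ =
      Function.extend (⇑σ ∘ e) L fun _ => none := by
  funext j
  by_cases h : ∃ i, (⇑σ ∘ e) i = j
  · obtain ⟨i, rfl⟩ := h
    rw [(σ.injective.comp he).extend_apply, Function.comp_apply, Function.comp_apply,
      Equiv.Perm.inv_def, Equiv.symm_apply_apply, he.extend_apply]
  · rw [Function.extend_apply' _ _ _ h, Function.comp_apply, Function.extend_apply']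
    rintro ⟨i, hi⟩
    exact h ⟨i, by rw [Function.comp_apply, hi, Equiv.Perm.inv_def, Equiv.apply_symm_apply]⟩

theorem extend_ne_none_iff {r : ℕ} {e : Fin r → Fin n} (he : Function.Injective e)
    {L : Fin r → Label d n} (hL : ∀ i, L i ≠ none) (j : Fin n) :
    Function.extend e L (fun _ => none) j ≠ none ↔ ∃ i, e i = j := by
  constructor
  · intro h
    by_contra h'
    exact h (Function.extend_apply' _ _ _ h')
  · rintro ⟨i, rfl⟩
    rw [he.extend_apply]; exact hL i

theorem filter_extend {r : ℕ} {e : Fin r → Fin n} (he : Function.Injective e)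
    {L : Fin r → Label d n} (hL : ∀ i, L i ≠ none) :
    (Finset.univ.filter fun j => Function.extend e L (fun _ => none) j ≠ none) =
      Finset.univ.map ⟨e, he⟩ := by
  ext j
  simp [extend_ne_none_iff he hL]

theorem weight_extend {r : ℕ} {e : Fin r → Fin n} (he : Function.Injective e)
    {L : Fin r → Label d n} (hL : ∀ i, L i ≠ none) :
    weight (Function.extend e L fun _ => none) = ∑ i, (e i : ℕ) := by
  rw [weight, filter_extend he hL, Finset.sum_map]; rfl

theorem suppCard_extend {r : ℕ} {e : Fin r → Fin n} (he : Function.Injective e)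
    {L : Fin r → Label d n} (hL : ∀ i, L i ≠ none) :
    suppCard (Function.extend e L fun _ => none) = r := by
  rw [suppCard, filter_extend he hL, Finset.card_map, Finset.card_univ, Fintype.card_fin]

end Support

section WordOperators

variable {d n : ℕ} {A : Type*} [CommRing A] [IsDomain A] {M : Type*} [AddCommMonoid M] [Module A M]
  (b : Module.Basis (Fin n → Label d n) A M) {v : A}

/-- For distinct labels the flip coefficient is `v` or `±v`. For equal labels the flip is trivial
and `±v ^ 2` serves instead. -/
theorem genTnat_apply (hv : v ≠ 0) (i : ℕ) (f : Fin n → Label d n) : ∃ κ : A, κ ≠ 0 ∧ ∃ c : A,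
    genTnat b v i (b f) =
      κ • b (f ∘ ⇑(if h : i < n - 1 then simple ⟨i, h⟩ else (1 : Equiv.Perm (Fin n)))) +
        c • b f := by
  by_cases h : i < n - 1
  · rw [genTnat, dif_pos h, dif_pos h, genT_apply]
    have hsign (s) : sign A d s ≠ 0 := fun h0 => by simpa [h0] using sign_sq (A := A) d s
    by_cases hxy : f (lo ⟨i, h⟩) = f (hi ⟨i, h⟩)
    · refine ⟨labelSame v (f (lo ⟨i, h⟩)) (f (hi ⟨i, h⟩)) +
        labelFlip v (f (lo ⟨i, h⟩)) (f (hi ⟨i, h⟩)), ?_, 0, ?_⟩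
      · rw [hxy, labelSame, labelFlip, coefSame, coefFlip]
        simp [hsign, hv]
      · rw [comp_simple_of_eq hxy, zero_smul, add_zero, add_smul]
    · refine ⟨_, ?_, _, add_comm _ _⟩
      rw [labelFlip, coefFlip]
      split_ifs with h1 h2
      · exact absurd (label_ext h1 h2) hxy
      · exact mul_ne_zero (hsign _) hv
      · exact hv
  · refine ⟨1, one_ne_zero, 0, ?_⟩
    rw [genTnat, dif_neg h, dif_neg h]; simp

/-- The operator given by a word. -/
noncomputable def wordOp (b : Module.Basis (Fin n → Label d n) A M) (v : A) (l : List ℕ) :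
    Module.End A M := (l.map (genTnat b v)).prod

/-- Each letter either permutes or keeps the tensor; the leading term takes the permutation at every
letter, and each remaining term omits at least one. -/
theorem wordOp_apply (hv : v ≠ 0) (l : List ℕ) (f : Fin n → Label d n) :
    ∃ κ : A, κ ≠ 0 ∧ ∃ y ∈ Submodule.span A
        (b '' {g | ∃ l', l'.Sublist l ∧ l'.length < l.length ∧ g = f ∘ ⇑(wordPerm n l')⁻¹}),
      wordOp b v l (b f) = κ • b (f ∘ ⇑(wordPerm n l)⁻¹) + y := by
  induction l with
  | nil => exact ⟨1, one_ne_zero, 0, zero_mem _, by simp [wordOp, wordPerm]⟩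
  | cons i l ih =>
    obtain ⟨κ, hκ, y, hy, h⟩ := ih
    obtain ⟨κ', hκ', c, hc⟩ := genTnat_apply b hv i (f ∘ ⇑(wordPerm n l)⁻¹)
    refine ⟨κ * κ', mul_ne_zero hκ hκ', (κ * c) • b (f ∘ ⇑(wordPerm n l)⁻¹) + genTnat b v i y,
      add_mem (Submodule.smul_mem _ _ (Submodule.subset_span
        ⟨_, ⟨l, List.sublist_cons_self i l, by simp, rfl⟩, rfl⟩)) ?_, ?_⟩
    · clear h
      induction hy using Submodule.span_induction with
      | mem x hx =>
        obtain ⟨_, ⟨l', hl', hlt, rfl⟩, rfl⟩ := hx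
        obtain ⟨κ'', -, c', hc'⟩ := genTnat_apply b hv i (f ∘ ⇑(wordPerm n l')⁻¹)
        rw [hc', ← comp_wordPerm_cons_inv]
        exact add_mem
          (Submodule.smul_mem _ _ (Submodule.subset_span
            ⟨_, ⟨i :: l', hl'.cons_cons i, by simpa using hlt, rfl⟩, rfl⟩))
          (Submodule.smul_mem _ _ (Submodule.subset_span
            ⟨_, ⟨l', hl'.cons i, by simp; omega, rfl⟩, rfl⟩))
      | zero => rw [map_zero]; exact zero_mem _
      | add x z _ _ hx hz => rw [map_add]; exact add_mem hx hz
      | smul a x _ hx => rw [map_smul]; exact Submodule.smul_mem _ _ hx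
    · rw [wordOp, List.map_cons, List.prod_cons, ← wordOp, Module.End.mul_apply, h, map_add,
        map_smul, hc, ← comp_wordPerm_cons_inv]
      module

/-- A linear map that kills the contributions of the proper subwords sees only the leading term. -/
theorem exists_map_wordOp (hv : v ≠ 0) {M' : Type*} [AddCommMonoid M'] [Module A M']
    (φ : M →ₗ[A] M') (l : List ℕ) (f : Fin n → Label d n)
    (hφ : ∀ l' : List ℕ, l'.Sublist l → l'.length < l.length →
      φ (b (f ∘ ⇑(wordPerm n l')⁻¹)) = 0) :
    ∃ κ : A, κ ≠ 0 ∧ φ (wordOp b v l (b f)) = κ • φ (b (f ∘ ⇑(wordPerm n l)⁻¹)) := by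
  obtain ⟨κ, hκ, y, hy, h⟩ := wordOp_apply b hv l f
  refine ⟨κ, hκ, ?_⟩
  have : φ y = 0 := by
    have hle : Submodule.span A
        (b '' {g | ∃ l', l'.Sublist l ∧ l'.length < l.length ∧ g = f ∘ ⇑(wordPerm n l')⁻¹}) ≤
        LinearMap.ker φ := by
      rw [Submodule.span_le]
      rintro _ ⟨_, ⟨l', hl', hlt, rfl⟩, rfl⟩
      exact hφ l' hl' hlt
    exact hle hy
  rw [h, map_add, map_smul, this, add_zero]

theorem wordOp_mem_span (hv : v ≠ 0) (l : List ℕ) (f : Fin n → Label d n) :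
    wordOp b v l (b f) ∈ Submodule.span A
      (b '' {g | ∃ l', l'.Sublist l ∧ g = f ∘ ⇑(wordPerm n l')⁻¹}) := by
  obtain ⟨κ, -, y, hy, h⟩ := wordOp_apply b hv l f
  rw [h]
  refine add_mem (Submodule.smul_mem _ _ (Submodule.subset_span
    ⟨_, ⟨l, List.Sublist.refl l, rfl⟩, rfl⟩)) (Submodule.span_mono ?_ hy)
  exact Set.image_mono fun g ⟨l', hl', _, hg⟩ => ⟨l', hl', hg⟩

end WordOperators

/-! ### The words of the standard elements -/

section StandardWords

variable {d n r : ℕ}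

/-- The word of `T_A`. -/
def leftWord (A : {A : Finset (Fin n) // A.card = r}) : List ℕ :=
  blockWord (fun i => (A.1.orderEmbOfFin A.2 i : ℕ)) fun i : Fin r => (i : ℕ)

/-- The word of `T̄_B`. -/
def rightWord (B : {B : Finset (Fin n) // B.card = r}) : List ℕ :=
  blockWord (fun i : Fin r => n - r + i) fun i => (B.1.orderEmbOfFin B.2 i : ℕ)

/-- The embedding of `Fin r` in `Fin n` as the last `r` elements. -/
def lastEmb (hr : r ≤ n) (i : Fin r) : Fin n := ⟨n - r + i, by omega⟩

theorem lastEmb_injective (hr : r ≤ n) : Function.Injective (lastEmb hr) := by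
  intro i j h
  simp only [lastEmb, Fin.mk.injEq, Nat.add_left_cancel_iff] at h
  exact Fin.ext h

theorem strictMono_orderEmb (A : {A : Finset (Fin n) // A.card = r}) :
    StrictMono fun i => (A.1.orderEmbOfFin A.2 i : ℕ) :=
  fun _ _ h => (A.1.orderEmbOfFin A.2).strictMono h

theorem orderEmb_injective (A : {A : Finset (Fin n) // A.card = r}) :
    Function.Injective (A.1.orderEmbOfFin A.2) := (A.1.orderEmbOfFin A.2).injective

theorem eq_of_forall_orderEmb_mem {A A₀ : {A : Finset (Fin n) // A.card = r}}
    (h : ∀ i, A₀.1.orderEmbOfFin A₀.2 i ∈ A.1) : A = A₀ := by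
  refine Subtype.ext (Finset.eq_of_subset_of_card_le ?_ (A.2.trans A₀.2.symm).le).symm
  intro j hj
  rw [← Finset.mem_coe, ← Finset.range_orderEmbOfFin A₀.1 A₀.2] at hj
  obtain ⟨i, rfl⟩ := hj
  exact h i

theorem orderEmb_mem (A : {A : Finset (Fin n) // A.card = r}) (i : Fin r) :
    A.1.orderEmbOfFin A.2 i ∈ A.1 := Finset.orderEmbOfFin_mem _ _ _

theorem wordPerm_leftWord (hr : r ≤ n) (A : {A : Finset (Fin n) // A.card = r}) (i : Fin r) :
    wordPerm n (leftWord A) (Fin.castLE hr i) = A.1.orderEmbOfFin A.2 i := by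
  refine Fin.ext ?_
  rw [leftWord, coe_wordPerm _ fun j hj => lt_of_mem_blockWord (fun i => by omega) hj, Fin.val_castLE]
  exact natPerm_blockWord (strictMono_orderEmb A) (fun _ _ h => h)
    (le_of_strictMono (strictMono_orderEmb A)) i

theorem wordPerm_rightWord (hr : r ≤ n) (B : {B : Finset (Fin n) // B.card = r}) (i : Fin r) :
    wordPerm n (rightWord B) (B.1.orderEmbOfFin B.2 i) = lastEmb hr i := by
  refine Fin.ext ?_
  rw [rightWord, coe_wordPerm _ fun j hj => lt_of_mem_blockWord (fun i => by have := i.2; omega) hj]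
  refine natPerm_blockWord (x := fun i : Fin r => n - r + i)
    (y := fun i => (B.1.orderEmbOfFin B.2 i : ℕ)) (fun _ _ h => ?_) (strictMono_orderEmb B)
    (le_sub_add_of_strictMono (strictMono_orderEmb B) fun i => Fin.is_lt _) i
  exact Nat.add_lt_add_left h _

theorem sum_add_length_leftWord (A : {A : Finset (Fin n) // A.card = r}) :
    ∑ i : Fin r, (i : ℕ) + (leftWord A).length = ∑ i, (A.1.orderEmbOfFin A.2 i : ℕ) := by
  rw [leftWord, length_blockWord, ← Finset.sum_add_distrib]
  exact Finset.sum_congr rfl fun i _ =>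
    Nat.add_sub_cancel' (le_of_strictMono (strictMono_orderEmb A) i)

theorem sum_add_length_rightWord (B : {B : Finset (Fin n) // B.card = r}) :
    ∑ i, (B.1.orderEmbOfFin B.2 i : ℕ) + (rightWord B).length = ∑ i : Fin r, (n - r + i) := by
  rw [rightWord, length_blockWord, ← Finset.sum_add_distrib]
  exact Finset.sum_congr rfl fun i _ => Nat.add_sub_cancel'
    (le_sub_add_of_strictMono (strictMono_orderEmb B) (fun i => Fin.is_lt _) i)

theorem weight_eq_sum {e : Fin r → Fin n} (he : Function.Injective e) {f : Fin n → Label d n}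
    (h : ∀ j, f j ≠ none ↔ ∃ i, e i = j) : weight f = ∑ i, (e i : ℕ) := by
  have : (Finset.univ.filter fun j => f j ≠ none) = Finset.univ.map ⟨e, he⟩ := by
    ext j; simpa using h j
  rw [weight, this, Finset.sum_map]; rfl

theorem ne_none_iff_of_suppCard (hr : r ≤ n) {f : Fin n → Label d n} (hf : suppCard f = r)
    (h : ∀ j : Fin n, (j : ℕ) < n - r → f j = none) (j : Fin n) :
    f j ≠ none ↔ ∃ i, lastEmb hr i = j := by
  have h1 : (Finset.univ.filter fun j => f j ≠ none) ⊆
      Finset.univ.map ⟨lastEmb hr, lastEmb_injective hr⟩ := by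
    intro j hj
    rw [Finset.mem_map]
    have hj' : n - r ≤ (j : ℕ) := by
      by_contra hlt
      exact (Finset.mem_filter.mp hj).2 (h j (by omega))
    exact ⟨⟨j - (n - r), by omega⟩, Finset.mem_univ _, Fin.ext (by simp [lastEmb]; omega)⟩
  have h2 := Finset.eq_of_subset_of_card_le h1
    (by rw [Finset.card_map, Finset.card_univ, Fintype.card_fin]; exact hf.ge)
  have := congrArg (fun s => j ∈ s) h2
  simpa using this

theorem le_of_suppCard {k : ℕ} {f : Fin n → Label d n}
    (h : ∀ j : Fin n, (j : ℕ) < k → f j = none) : suppCard f ≤ n - k := by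
  have h1 : (Finset.univ.filter fun j => f j ≠ none) ⊆
      Finset.univ.filter fun j : Fin n => k ≤ (j : ℕ) := by
    intro j hj
    rw [Finset.mem_filter] at hj ⊢
    refine ⟨Finset.mem_univ _, ?_⟩
    by_contra hlt
    exact hj.2 (h j (by omega))
  refine (Finset.card_le_card h1).trans ?_
  rw [← Finset.card_map Fin.valEmbedding]
  have h2 : (Finset.univ.filter fun j : Fin n => k ≤ (j : ℕ)).map Fin.valEmbedding ⊆
      Finset.Ico k n := by
    intro j hj
    simp only [Finset.mem_map, Finset.mem_filter, Finset.mem_univ, true_and,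
      Fin.valEmbedding_apply] at hj
    obtain ⟨i, hi, rfl⟩ := hj
    exact Finset.mem_Ico.mpr ⟨hi, i.2⟩
  simpa using Finset.card_le_card h2

end StandardWords

/-! ### Leading coefficients -/

section Leading

variable {d n r : ℕ} {A : Type*} [CommRing A] [IsDomain A] {M : Type*} [AddCommMonoid M] [Module A M]
  (b : Module.Basis (Fin n → Label d n) A M) {v ξ : A}

/-- `N ^ (n - r)` survives only on tensors supported on the last `r` positions. Reaching them from
`B₀` raises the weight by the length of `rightWord B₀`, which no proper subword of `rightWord B` can
do; the full word does it only if `B = B₀`. -/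
theorem genN_pow_rightWord (hv : v ≠ 0) (hr : r ≤ n) (B B₀ : {B : Finset (Fin n) // B.card = r})
    (hlen : (rightWord B).length ≤ (rightWord B₀).length) {L : Fin r → Label d n}
    (hL : ∀ i, L i ≠ none) : ∃ κ : A, (κ ≠ 0 ↔ B = B₀) ∧
      (genN b v ^ (n - r)) (wordOp b v (rightWord B)
        (b (Function.extend (B₀.1.orderEmbOfFin B₀.2) L fun _ => none))) =
      κ • b (Function.extend (Fin.castLE hr) L fun _ => none) := by
  have hsum := sum_add_length_rightWord B₀
  have hinj := orderEmb_injective B₀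
  have hinj' (σ : Equiv.Perm (Fin n)) : Function.Injective (σ ∘ B₀.1.orderEmbOfFin B₀.2) :=
    σ.injective.comp hinj
  obtain ⟨κ, hκ, h⟩ := exists_map_wordOp b hv (genN b v ^ (n - r)) (rightWord B)
    (Function.extend (B₀.1.orderEmbOfFin B₀.2) L fun _ => none) (by
      intro l' _ hlt
      rw [genN_pow_apply b v (Nat.sub_le _ _), if_neg]
      intro h0
      have h1 := weight_comp_wordPerm_le
        (Function.extend (B₀.1.orderEmbOfFin B₀.2) L fun _ => none) l'
      rw [weight_extend hinj hL, weight_eq_sum (lastEmb_injective hr)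
        (ne_none_iff_of_suppCard hr ((suppCard_comp _ _).trans (suppCard_extend hinj hL)) h0)] at h1
      simp only [lastEmb] at h1
      omega)
  rw [h, genN_pow_apply b v (Nat.sub_le _ _), extend_comp_inv hinj]
  by_cases hB : B = B₀
  · subst hB
    have h2 : ⇑(wordPerm n (rightWord B)) ∘ ⇑(B.1.orderEmbOfFin B.2) = lastEmb hr :=
      funext (wordPerm_rightWord hr B)
    rw [h2, if_pos]
    · refine ⟨κ * v ^ ((n - r) * suppCard (Function.extend (lastEmb hr) L fun _ => none)),
        ⟨fun _ => rfl, fun _ => mul_ne_zero hκ (pow_ne_zero _ hv)⟩, ?_⟩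
      rw [smul_smul]
      congr 2
      have h3 := extend_comp_inv (lastEmb_injective hr) L (finRotate n ^ (n - r))⁻¹
      rw [inv_inv] at h3
      rw [h3]
      congr 1
      funext i
      rw [Function.comp_apply, Equiv.Perm.inv_eq_iff_eq]
      refine Fin.ext ?_
      have := i.2
      rw [coe_finRotate_pow, Fin.val_castLE, Nat.mod_eq_of_lt (by omega)]
      exact Nat.add_comm _ _
    · intro j hj
      refine Function.extend_apply' _ _ _ ?_
      rintro ⟨i, rfl⟩
      simp [lastEmb] at hj
  · refine ⟨0, by simp [hB], ?_⟩
    rw [if_neg, smul_zero, zero_smul]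
    intro h0
    refine hB (eq_of_forall_orderEmb_mem fun i => ?_)
    have h1 := (ne_none_iff_of_suppCard hr (suppCard_extend (hinj' _) hL) h0
      (wordPerm n (rightWord B) (B₀.1.orderEmbOfFin B₀.2 i))).mp
      ((extend_ne_none_iff (hinj' _) hL _).mpr ⟨i, rfl⟩)
    obtain ⟨k, hk⟩ := h1
    rw [← wordPerm_rightWord hr B k] at hk
    rw [← (wordPerm n (rightWord B)).injective hk]
    exact orderEmb_mem B k

/-- With more than `r` factors other than `v_0`, the first `n - r` cannot all be `v_0`, however the
factors are permuted. -/
theorem genN_pow_rightWord_eq_zero (hv : v ≠ 0) {r' : ℕ} (hr : r < r')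
    (hr' : r' ≤ n) (B : {B : Finset (Fin n) // B.card = r})
    {f : Fin n → Label d n} (hf : suppCard f = r') :
    (genN b v ^ (n - r)) (wordOp b v (rightWord B) (b f)) = 0 := by
  have hz (σ : Equiv.Perm (Fin n)) : (genN b v ^ (n - r)) (b (f ∘ ⇑σ)) = 0 := by
    rw [genN_pow_apply b v (Nat.sub_le _ _), if_neg]
    intro h0
    have := le_of_suppCard h0
    rw [suppCard_comp, hf] at this
    omega
  obtain ⟨κ, -, h⟩ := exists_map_wordOp b hv (genN b v ^ (n - r)) (rightWord B) f
    fun l' _ _ => hz _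
  rw [h, hz, smul_zero]

/-- The span of the basis tensors whose first `r` factors are exactly those other than `v_0`. -/
def initialSpan (b : Module.Basis (Fin n → Label d n) A M) (r : ℕ) : Submodule A M :=
  Submodule.span A (b '' {h | ∀ j, h j ≠ none ↔ (j : ℕ) < r})

/-- The weight argument again: the tensor read off is supported on `X₀`, whose weight exceeds that
of the initial segment by the length of `leftWord X₀`. -/
theorem coord_leftWord (hv : v ≠ 0) (hr : r ≤ n) (X X₀ : {X : Finset (Fin n) // X.card = r})
    (hlen : (leftWord X).length ≤ (leftWord X₀).length) {h₀ : Fin n → Label d n}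
    (hh₀ : ∀ j, h₀ j ≠ none ↔ (j : ℕ) < r) : ∃ κ : A, (κ ≠ 0 ↔ X = X₀) ∧
      ∀ z ∈ initialSpan b r, b.coord (h₀ ∘ ⇑(wordPerm n (leftWord X₀))⁻¹)
        (wordOp b v (leftWord X) z) = κ * b.coord h₀ z := by
  set g := h₀ ∘ ⇑(wordPerm n (leftWord X₀))⁻¹ with hg
  have hcast {h : Fin n → Label d n} (hh : ∀ j, h j ≠ none ↔ (j : ℕ) < r) (j : Fin n) :
      h j ≠ none ↔ ∃ i, Fin.castLE hr i = j := by
    rw [hh]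
    exact ⟨fun hj => ⟨⟨j, hj⟩, rfl⟩, by rintro ⟨i, rfl⟩; exact i.2⟩
  have hsupp {h : Fin n → Label d n} (hh : ∀ j, h j ≠ none ↔ (j : ℕ) < r)
      (Y : {X : Finset (Fin n) // X.card = r}) (j : Fin n) :
      (h ∘ ⇑(wordPerm n (leftWord Y))⁻¹) j ≠ none ↔ ∃ i, Y.1.orderEmbOfFin Y.2 i = j := by
    rw [Function.comp_apply, hcast hh]
    refine exists_congr fun i => ?_
    rw [eq_comm, Equiv.Perm.inv_eq_iff_eq, wordPerm_leftWord, eq_comm]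
  have hφ {h : Fin n → Label d n} (hh : ∀ j, h j ≠ none ↔ (j : ℕ) < r) (l' : List ℕ)
      (hlt : l'.length < (leftWord X).length) :
      b.coord g (b (h ∘ ⇑(wordPerm n l')⁻¹)) = 0 := by
    rw [Module.Basis.coord_apply, b.repr_self, Finsupp.single_eq_of_ne]
    intro heq
    have h1 := weight_comp_wordPerm_le h l'
    rw [← heq, hg, weight_eq_sum (orderEmb_injective X₀) (hsupp hh₀ X₀),
      weight_eq_sum (Fin.castLE_injective hr) (hcast hh), ← sum_add_length_leftWord] at h1
    simp only [Fin.val_castLE] at h1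
    omega
  -- One scalar must serve the whole of `initialSpan b r`, since `T_A` is applied after `F_m T_ω`,
  -- whose value is not a single tensor.
  have hlin (κ : A) (hκ : ∀ h : Fin n → Label d n, (∀ j, h j ≠ none ↔ (j : ℕ) < r) →
      b.coord g (wordOp b v (leftWord X) (b h)) = κ * b.coord h₀ (b h)) :
      ∀ z ∈ initialSpan b r, b.coord g (wordOp b v (leftWord X) z) = κ * b.coord h₀ z := by
    intro z hz
    induction hz using Submodule.span_induction with
    | mem x hx =>
      obtain ⟨h, hh, rfl⟩ := hx
      exact hκ h hh
    | zero => simp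
    | add x y _ _ hx hy => rw [map_add, map_add, map_add, hx, hy, mul_add]
    | smul a x _ hx => rw [map_smul, map_smul, map_smul, hx, smul_eq_mul, smul_eq_mul, mul_left_comm]
  by_cases hX : X = X₀
  · subst hX
    obtain ⟨κ, hκ, h1⟩ := exists_map_wordOp b hv (b.coord g) (leftWord X) h₀
      fun l' _ hlt => hφ hh₀ l' hlt
    refine ⟨κ, by simp [hκ], hlin κ fun h hh => ?_⟩
    by_cases hhh : h = h₀
    · subst hhh
      rw [h1, ← hg, Module.Basis.coord_apply, Module.Basis.coord_apply, b.repr_self, b.repr_self,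
        Finsupp.single_eq_same, Finsupp.single_eq_same, smul_eq_mul]
    · obtain ⟨κ', -, h2⟩ := exists_map_wordOp b hv (b.coord g) (leftWord X) h
        fun l' _ hlt => hφ hh l' hlt
      have h3 : g ≠ h ∘ ⇑(wordPerm n (leftWord X))⁻¹ := by
        intro h3
        refine hhh (funext fun j => ?_)
        have := congrFun h3 (wordPerm n (leftWord X) j)
        simpa [hg] using this.symm
      rw [h2, Module.Basis.coord_apply, Module.Basis.coord_apply, b.repr_self, b.repr_self,
        Finsupp.single_eq_of_ne h3, Finsupp.single_eq_of_ne (Ne.symm hhh), smul_zero, mul_zero]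
  · refine ⟨0, by simp [hX], hlin 0 fun h hh => ?_⟩
    obtain ⟨κ', -, h2⟩ := exists_map_wordOp b hv (b.coord g) (leftWord X) h
      fun l' _ hlt => hφ hh l' hlt
    have h3 : g ≠ h ∘ ⇑(wordPerm n (leftWord X))⁻¹ := by
      intro h3
      refine hX (eq_of_forall_orderEmb_mem fun i => ?_)
      have h4 := (hsupp hh₀ X₀ _).mpr ⟨i, rfl⟩
      rw [← hg, h3] at h4
      obtain ⟨k, hk⟩ := (hsupp hh X _).mp h4
      rw [← hk]
      exact orderEmb_mem X k
    rw [h2, Module.Basis.coord_apply, b.repr_self, Finsupp.single_eq_of_ne h3, smul_zero, zero_mul]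

/-- Distinct labels make the permuted tensors distinct, so the coordinate sees only words with
product `ω₀`. A proper subword of the reduced word of `ω` is shorter than any word for `ω₀`. -/
theorem coord_reducedWord (hv : v ≠ 0) (hr : r ≤ n) (ω ω₀ : Equiv.Perm (Fin r))
    (hlen : (reducedWord ω).length ≤ (reducedWord ω₀).length) {L : Fin r → Label d n}
    (hL : ∀ i, L i ≠ none) (hLinj : Function.Injective L) : ∃ κ : A, (κ ≠ 0 ↔ ω = ω₀) ∧
      b.coord (Function.extend (Fin.castLE hr ∘ ω₀) L fun _ => none)
        (wordOp b v ((reducedWord ω).map Fin.val)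
          (b (Function.extend (Fin.castLE hr) L fun _ => none))) = κ := by
  have hspec (ω : Equiv.Perm (Fin r)) : IsReducedWord (reducedWord ω) ω :=
    (exists_reducedWord ω).choose_spec
  have hinj := Fin.castLE_injective hr
  have hcoord (l : List (Fin (r - 1))) :
      b.coord (Function.extend (Fin.castLE hr ∘ ω₀) L fun _ => none)
        (b ((Function.extend (Fin.castLE hr) L fun _ => none) ∘
          ⇑(wordPerm n (l.map Fin.val))⁻¹)) = if (l.map simple).prod = ω₀ then 1 else 0 := by
    rw [extend_comp_inv hinj, Module.Basis.coord_apply, b.repr_self]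
    have h1 : ⇑(wordPerm n (l.map Fin.val)) ∘ Fin.castLE hr =
        Fin.castLE hr ∘ (l.map simple).prod := funext (wordPerm_castLE hr l)
    rw [h1]
    split_ifs with h
    · rw [h, Finsupp.single_eq_same]
    · rw [Finsupp.single_eq_of_ne]
      intro heq
      refine h (Equiv.ext fun i => ?_)
      have h2 := congrFun heq ((Fin.castLE hr ∘ ω₀) i)
      rw [(hinj.comp ω₀.injective).extend_apply] at h2
      have h3 := (extend_ne_none_iff (hinj.comp (l.map simple).prod.injective) hL _).mp
        (h2 ▸ hL i)
      obtain ⟨k, hk⟩ := h3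
      rw [← hk, (hinj.comp (l.map simple).prod.injective).extend_apply] at h2
      have h4 := hLinj h2
      subst h4
      exact hinj hk
  obtain ⟨κ, hκ, h⟩ := exists_map_wordOp b hv
    (b.coord (Function.extend (Fin.castLE hr ∘ ω₀) L fun _ => none))
    ((reducedWord ω).map Fin.val) (Function.extend (Fin.castLE hr) L fun _ => none) (by
      intro l' hl' hlt
      obtain ⟨l, -, rfl⟩ := List.sublist_map_iff.mp hl'
      rw [hcoord, if_neg]
      intro hl
      have := (hspec ω₀).2 l hl
      rw [List.length_map, List.length_map] at hlt
      omega)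
  refine ⟨_, ?_, rfl⟩
  rw [h, hcoord, (hspec ω).1]
  split_ifs with hω
  · simp [hω, hκ]
  · simp [hω]

theorem reducedWord_mem_initialSpan (hv : v ≠ 0) (hr : r ≤ n) (ω : Equiv.Perm (Fin r))
    {L : Fin r → Label d n} (hL : ∀ i, L i ≠ none) :
    wordOp b v ((reducedWord ω).map Fin.val)
      (b (Function.extend (Fin.castLE hr) L fun _ => none)) ∈ initialSpan b r := by
  refine Submodule.span_mono ?_ (wordOp_mem_span b hv _ _)
  refine Set.image_mono ?_
  rintro _ ⟨l', hl', rfl⟩ j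
  have hlt : ∀ i ∈ l', i < r - 1 := by
    intro i hi
    obtain ⟨k, _, rfl⟩ := List.mem_map.mp (hl'.subset hi)
    exact k.2
  rw [Function.comp_apply, extend_ne_none_iff (Fin.castLE_injective hr) hL]
  have h1 := wordPerm_lt l' hlt hr ((wordPerm n l')⁻¹ j)
  rw [Equiv.Perm.inv_def, Equiv.apply_symm_apply] at h1
  rw [h1, Equiv.Perm.inv_def]
  exact ⟨by rintro ⟨i, hi⟩; rw [← hi]; exact i.2, fun hj => ⟨⟨_, hj⟩, rfl⟩⟩

/-- The operator `F_m`. -/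
noncomputable def monomialOp (b : Module.Basis (Fin n → Label d n) A M) (ξ : A) (hr : r ≤ n)
    (m : Fin r → ZMod d) : Module.End A M :=
  (List.ofFn fun i : Fin r => genF b ξ (Fin.castLE hr i) ^ (m i).val).prod

omit [IsDomain A] in
theorem list_prod_diagonal {s : ℕ} (φ : Fin s → Module.End A M) (c : Fin s → A) (x : M)
    (h : ∀ i, φ i x = c i • x) : (List.ofFn φ).prod x = (∏ i, c i) • x := by
  induction s with
  | zero => simp
  | succ s ih =>
    rw [List.ofFn_succ, List.prod_cons, Module.End.mul_apply,
      ih (fun i => φ i.succ) (fun i => c i.succ) fun i => h _, map_smul, h, Fin.prod_univ_succ,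
      smul_smul, mul_comm]

omit [IsDomain A] in
theorem monomialOp_apply (hr : r ≤ n) (m : Fin r → ZMod d) (f : Fin n → Label d n) :
    monomialOp b ξ hr m (b f) =
      (∏ i, (ξ ^ upper (f (Fin.castLE hr i))) ^ (m i).val) • b f :=
  list_prod_diagonal _ _ _ fun _ => genF_pow_apply b _ _ f

omit [IsDomain A] in
theorem coord_monomialOp (hr : r ≤ n) (m : Fin r → ZMod d) (h : Fin n → Label d n) (z : M) :
    b.coord h (monomialOp b ξ hr m z) =
      (∏ i, (ξ ^ upper (h (Fin.castLE hr i))) ^ (m i).val) * b.coord h z := by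
  have : b.coord h ∘ₗ monomialOp b ξ hr m =
      (∏ i, (ξ ^ upper (h (Fin.castLE hr i))) ^ (m i).val) • b.coord h := by
    refine b.ext fun f => ?_
    rw [LinearMap.comp_apply, monomialOp_apply, map_smul, LinearMap.smul_apply]
    by_cases hf : f = h
    · rw [hf]
    · rw [Module.Basis.coord_apply, b.repr_self, Finsupp.single_eq_of_ne (Ne.symm hf), smul_zero,
        smul_zero]
  exact LinearMap.congr_fun this z

omit [IsDomain A] in
theorem monomialOp_mem_initialSpan (hr : r ≤ n) (m : Fin r → ZMod d) :
    ∀ z ∈ initialSpan b r, monomialOp b ξ hr m z ∈ initialSpan b r := by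
  intro z hz
  induction hz using Submodule.span_induction with
  | mem x hx =>
    obtain ⟨h, hh, rfl⟩ := hx
    rw [monomialOp_apply]
    exact Submodule.smul_mem _ _ (Submodule.subset_span ⟨h, hh, rfl⟩)
  | zero => rw [map_zero]; exact zero_mem _
  | add x y _ _ hx hy => rw [map_add]; exact add_mem hx hy
  | smul a x _ hx => rw [map_smul]; exact Submodule.smul_mem _ _ hx

/-- The operator of a standard element. -/
noncomputable def stdOp (b : Module.Basis (Fin n → Label d n) A M) (v ξ : A)
    (p : Σ r : Fin (n + 1), Index d n r) : Module.End A M :=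
  wordOp b v (leftWord p.2.1) * monomialOp b ξ (Nat.lt_succ_iff.mp p.1.2) p.2.2.2.1 *
    wordOp b v ((reducedWord p.2.2.2.2).map Fin.val) * genN b v ^ (n - (p.1 : ℕ)) *
      wordOp b v (rightWord p.2.2.1)

/-- The vector on which the leading term of a standard element is read off. -/
noncomputable def testLabel (B : {B : Finset (Fin n) // B.card = r}) (L : Fin r → Label d n) :
    Fin n → Label d n := Function.extend (B.1.orderEmbOfFin B.2) L fun _ => none

/-- The three leading-term lemmas combined. The scalar `κ` does not depend on `m`, which enters only
through the product of powers of roots of unity. -/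
theorem coord_stdOp (hv : v ≠ 0) (r : Fin (n + 1)) {L : Fin r → Label d n}
    (hL : ∀ i, L i ≠ none) (hLinj : Function.Injective L)
    (X X₀ B B₀ : {X : Finset (Fin n) // X.card = r}) (ω ω₀ : Equiv.Perm (Fin r))
    (hB : (rightWord B).length ≤ (rightWord B₀).length)
    (hX : B = B₀ → (leftWord X).length ≤ (leftWord X₀).length)
    (hω : B = B₀ → X = X₀ → (reducedWord ω).length ≤ (reducedWord ω₀).length) :
    ∃ κ : A, (κ ≠ 0 ↔ X = X₀ ∧ B = B₀ ∧ ω = ω₀) ∧ ∀ m,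
      b.coord ((Function.extend (Fin.castLE (Nat.lt_succ_iff.mp r.2) ∘ ω₀) L fun _ => none) ∘
          ⇑(wordPerm n (leftWord X₀))⁻¹)
        (stdOp b v ξ ⟨r, X, B, m, ω⟩ (b (testLabel B₀ L))) =
      κ * ∏ i, (ξ ^ upper (L (ω₀⁻¹ i))) ^ (m i).val := by
  have hr : (r : ℕ) ≤ n := Nat.lt_succ_iff.mp r.2
  have hinj := (Fin.castLE_injective hr).comp ω₀.injective
  obtain ⟨κ₁, hκ₁, h1⟩ := genN_pow_rightWord b hv hr B B₀ hB hL
  have happ (m) : stdOp b v ξ ⟨r, X, B, m, ω⟩ (b (testLabel B₀ L)) =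
      κ₁ • wordOp b v (leftWord X) (monomialOp b ξ hr m
        (wordOp b v ((reducedWord ω).map Fin.val)
          (b (Function.extend (Fin.castLE hr) L fun _ => none)))) := by
    simp only [stdOp, Module.End.mul_apply]
    rw [testLabel, h1, map_smul, map_smul, map_smul]
  by_cases hBB : B = B₀
  swap
  · refine ⟨0, by simp [hBB], fun m => ?_⟩
    rw [happ, not_not.mp (fun h => hBB (hκ₁.mp h)), zero_smul, map_zero, zero_mul]
  obtain ⟨κ₂, hκ₂, h2⟩ := coord_leftWord b hv hr X X₀ (hX hBB)
    (h₀ := Function.extend (Fin.castLE hr ∘ ω₀) L fun _ => none) (by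
      intro j
      rw [extend_ne_none_iff hinj hL]
      exact ⟨by rintro ⟨i, rfl⟩; exact (ω₀ i).2,
        fun hj => ⟨ω₀.symm ⟨j, hj⟩, Fin.ext (by simp)⟩⟩)
  have h3 (m) := h2 _ (monomialOp_mem_initialSpan b (ξ := ξ) hr m _
    (reducedWord_mem_initialSpan b hv hr ω hL))
  by_cases hXX : X = X₀
  swap
  · refine ⟨0, by simp [hXX], fun m => ?_⟩
    rw [happ, map_smul, h3, not_not.mp (fun h => hXX (hκ₂.mp h))]
    simp
  obtain ⟨κ₃, hκ₃, h4⟩ := coord_reducedWord b hv hr ω ω₀ (hω hBB hXX) hL hLinj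
  refine ⟨κ₁ * (κ₂ * κ₃), ?_, fun m => ?_⟩
  · rw [mul_ne_zero_iff, mul_ne_zero_iff, hκ₁, hκ₂, hκ₃]
    tauto
  · rw [happ, map_smul, h3, coord_monomialOp, h4, smul_eq_mul]
    have h5 (i) : Function.extend (Fin.castLE hr ∘ ω₀) L (fun _ => none) (Fin.castLE hr i) =
        L (ω₀⁻¹ i) := by
      have := hinj.extend_apply L (fun _ => none) (ω₀⁻¹ i)
      rwa [Function.comp_apply, Equiv.Perm.inv_def, Equiv.apply_symm_apply] at this
    simp only [h5]
    ring

theorem stdOp_apply_eq_zero (hv : v ≠ 0) {f : Fin n → Label d n} (p : Σ r : Fin (n + 1), Index d n r)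
    (hf : (p.1 : ℕ) < suppCard f) (hf' : suppCard f ≤ n) : stdOp b v ξ p (b f) = 0 := by
  simp only [stdOp, Module.End.mul_apply]
  rw [genN_pow_rightWord_eq_zero b hv hf hf' p.2.2.1 rfl]
  simp

end Leading

/-! ### Linear independence -/

section Independence

variable {d n : ℕ} {A : Type*} [CommRing A] [IsDomain A] {v ξ : A}

theorem sum_root_pow_mul (hξ : IsPrimitiveRoot ξ d) [NeZero d] (a c : ZMod d) :
    ∑ t : Fin d, (ξ ^ ((t : ℕ) + 1)) ^ a.val * (ξ ^ ((t : ℕ) + 1)) ^ (d - c.val) =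
      if a = c then (d : A) else 0 := by
  have ha := ZMod.val_lt a
  have hc := ZMod.val_lt c
  have h1 (t : ℕ) : (ξ ^ (t + 1)) ^ a.val * (ξ ^ (t + 1)) ^ (d - c.val) =
      ξ ^ (a.val + (d - c.val)) * (ξ ^ (a.val + (d - c.val))) ^ t := by
    rw [← pow_add, ← pow_mul, ← pow_succ', ← pow_mul, mul_comm]
  simp only [h1]
  rw [← Finset.mul_sum, Fin.sum_univ_eq_sum_range]
  have h2 := mul_neg_geom_sum (ξ ^ (a.val + (d - c.val))) d
  rw [← pow_mul, mul_comm _ d, pow_mul, hξ.pow_eq_one, one_pow, sub_self] at h2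
  split_ifs with hac
  · rw [hac, show c.val + (d - c.val) = d by omega, hξ.pow_eq_one]
    simp
  · rcases mul_eq_zero.mp h2 with h3 | h3
    · exfalso
      have h4 := (hξ.pow_eq_one_iff_dvd _).mp (sub_eq_zero.mp h3).symm
      obtain ⟨k, hk⟩ := h4
      -- The exponent `a.val + (d - c.val)` lies strictly between `0` and `2 * d`.
      have hk1 : k = 1 := by
        rcases k with _ | _ | k
        · omega
        · rfl
        · have : d * (k + 1 + 1) = d * k + 2 * d := by ring
          have := Nat.zero_le (d * k)
          omega
      subst hk1
      exact hac (ZMod.val_injective d (by omega))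
    · rw [h3, mul_zero]

/-- Fourier inversion on `(ℤ/d)^r`: summing against the inverse character of `m₀` isolates `d ^ r *
c m₀`. -/
theorem eq_zero_of_forall_sum_root_pow (hξ : IsPrimitiveRoot ξ d) [NeZero d] (hd : (d : A) ≠ 0)
    {r : ℕ} (c : (Fin r → ZMod d) → A)
    (h : ∀ t : Fin r → Fin d, ∑ m, c m * ∏ i, (ξ ^ ((t i : ℕ) + 1)) ^ (m i).val = 0)
    (m₀ : Fin r → ZMod d) : c m₀ = 0 := by
  have h1 : ∑ t : Fin r → Fin d, (∑ m, c m * ∏ i, (ξ ^ ((t i : ℕ) + 1)) ^ (m i).val) *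
      ∏ i, (ξ ^ ((t i : ℕ) + 1)) ^ (d - (m₀ i).val) = 0 :=
    Finset.sum_eq_zero fun t _ => by rw [h t, zero_mul]
  have h2 (m : Fin r → ZMod d) : ∑ t : Fin r → Fin d,
      ∏ i, ((ξ ^ ((t i : ℕ) + 1)) ^ (m i).val * (ξ ^ ((t i : ℕ) + 1)) ^ (d - (m₀ i).val)) =
      if m = m₀ then (d : A) ^ r else 0 := by
    have := Finset.prod_univ_sum (fun _ : Fin r => (Finset.univ : Finset (Fin d))) fun i t =>
      (ξ ^ ((t : ℕ) + 1)) ^ (m i).val * (ξ ^ ((t : ℕ) + 1)) ^ (d - (m₀ i).val)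
    rw [Fintype.piFinset_univ] at this
    rw [← this]
    simp only [sum_root_pow_mul hξ]
    split_ifs with hm
    · subst hm; simp
    · obtain ⟨i, hi⟩ := Function.ne_iff.mp hm
      exact Finset.prod_eq_zero (Finset.mem_univ i) (if_neg hi)
  simp only [Finset.sum_mul] at h1
  rw [Finset.sum_comm] at h1
  simp only [mul_assoc, ← Finset.prod_mul_distrib, ← Finset.mul_sum, h2, mul_ite, mul_zero,
    Finset.sum_ite_eq', Finset.mem_univ, if_true] at h1
  exact (mul_eq_zero.mp h1).resolve_right (pow_ne_zero _ hd)

variable {M : Type*} [AddCommMonoid M] [Module A M] (b : Module.Basis (Fin n → Label d n) A M)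

/-- The order in which leading terms are compared. -/
noncomputable def leadingKey (p : Σ r : Fin (n + 1), Index d n r) : ℕ ×ₗ (ℕ ×ₗ (ℕ ×ₗ ℕ)) :=
  toLex ((p.1 : ℕ), toLex ((rightWord p.2.2.1).length,
    toLex ((leftWord p.2.1).length, (reducedWord p.2.2.2.2).length)))

/-- A nonzero coefficient with maximal `leadingKey` is isolated up to the choice of `m`, and Fourier
inversion then shows that it vanishes. -/
theorem eq_zero_of_sum_smul_stdOp [NeZero d] (hξ : IsPrimitiveRoot ξ d) (hd : (d : A) ≠ 0)
    (hv : v ≠ 0) {c : (Σ r : Fin (n + 1), Index d n r) → A}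
    (hc : ∑ p, c p • stdOp b v ξ p = 0) : ∀ p, c p = 0 := by
  classical
  by_contra! hne
  obtain ⟨p, hp⟩ := hne
  obtain ⟨p₀, hp₀, hmax⟩ := Finset.exists_max_image (Finset.univ.filter fun p => c p ≠ 0)
    leadingKey ⟨p, by simpa using hp⟩
  obtain ⟨r, X₀, B₀, m₀, ω₀⟩ := p₀
  have hr : (r : ℕ) ≤ n := Nat.lt_succ_iff.mp r.2
  refine (Finset.mem_filter.mp hp₀).2 ?_
  set emb : (Fin r → ZMod d) → Σ r : Fin (n + 1), Index d n r := fun m => ⟨r, X₀, B₀, m, ω₀⟩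
    with hemb
  have hinj : Function.Injective emb := by
    intro m m' h
    simpa [hemb] using h
  refine eq_zero_of_forall_sum_root_pow hξ hd (fun m => c (emb m)) (fun t => ?_) m₀
  -- The lower indices make the labels distinct, leaving the upper indices free. The twist by `ω₀`
  -- undoes the `ω₀⁻¹` of `coord_stdOp`.
  set L : Fin r → Label d n := fun i => some (Fin.castLE hr i, t (ω₀ i)) with hLdef
  have hL : ∀ i, L i ≠ none := fun i => by simp [hLdef]
  have hLinj : Function.Injective L := fun i j h => by
    simp only [hLdef, Option.some.injEq, Prod.mk.injEq] at h
    exact Fin.castLE_injective hr h.1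
  set g := (Function.extend (Fin.castLE hr ∘ ω₀) L fun _ => none) ∘
    ⇑(wordPerm n (leftWord X₀))⁻¹ with hg
  have hsum : ∑ p, c p * b.coord g (stdOp b v ξ p (b (testLabel B₀ L))) = 0 := by
    have := congrArg (fun φ : Module.End A M => b.coord g (φ (b (testLabel B₀ L)))) hc
    simpa only [LinearMap.sum_apply, LinearMap.smul_apply, map_sum, map_smul, smul_eq_mul,
      LinearMap.zero_apply, map_zero] using this
  obtain ⟨κ, hκ, h1⟩ := coord_stdOp b hv (ξ := ξ) r hL hLinj X₀ X₀ B₀ B₀ ω₀ ω₀ le_rfl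
    (fun _ => le_rfl) fun _ _ => le_rfl
  have hκ0 : κ ≠ 0 := hκ.mpr ⟨rfl, rfl, rfl⟩
  have hzero : ∀ p ∉ Set.range emb,
      c p * b.coord g (stdOp b v ξ p (b (testLabel B₀ L))) = 0 := by
    intro p hp
    by_cases hcp : c p = 0
    · rw [hcp, zero_mul]
    have hle := hmax p (Finset.mem_filter.mpr ⟨Finset.mem_univ _, hcp⟩)
    have hsc : suppCard (testLabel B₀ L) = r := suppCard_extend (orderEmb_injective B₀) hL
    simp only [leadingKey, Prod.Lex.toLex_le_toLex] at hle
    -- A smaller `r` kills a test vector with more factors other than `v_0`; for equal `r`,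
    -- maximality supplies the length hypotheses of `coord_stdOp`.
    rcases hle with hlt | ⟨heq, hle⟩
    · rw [stdOp_apply_eq_zero b hv p (by rw [hsc]; exact hlt) (by rw [hsc]; exact hr), map_zero,
        mul_zero]
    · obtain ⟨r', X, B, m, ω⟩ := p
      obtain rfl : r' = r := Fin.ext heq
      simp only at hle
      obtain ⟨κ', hκ', h2⟩ := coord_stdOp b hv (ξ := ξ) r' hL hLinj X X₀ B B₀ ω ω₀
        (by rcases hle with h | ⟨h, -⟩ <;> omega)
        (fun hB => by
          subst hB
          rcases hle with h | ⟨-, h | ⟨h, -⟩⟩ <;> omega)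
        (fun hB hX => by
          subst hB hX
          rcases hle with h | ⟨-, h | ⟨-, h⟩⟩
          · omega
          · omega
          · exact h)
      have hκ0' : κ' = 0 := by
        by_contra h
        obtain ⟨rfl, rfl, rfl⟩ := hκ'.mp h
        exact hp ⟨m, rfl⟩
      rw [h2, hκ0', zero_mul, mul_zero]
  have hred := Fintype.sum_of_injective emb hinj
    (fun m => c (emb m) * b.coord g (stdOp b v ξ (emb m) (b (testLabel B₀ L))))
    (fun p => c p * b.coord g (stdOp b v ξ p (b (testLabel B₀ L)))) hzero fun _ => rfl
  rw [hsum] at hred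
  simp only [hemb, hg, h1] at hred
  refine (mul_eq_zero.mp ?_).resolve_left hκ0
  rw [Finset.mul_sum, ← hred]
  refine Finset.sum_congr rfl fun m _ => ?_
  rw [mul_left_comm]
  congr 2
  refine Finset.prod_congr rfl fun i _ => ?_
  simp only [hLdef, upper, Equiv.Perm.inv_def, Equiv.apply_symm_apply]

end Independence

/-! ### Transfer to the algebra, and the choice of scalars. -/

section Conclusion

variable {K : Type*} [Field K] [CharZero K] {d n : ℕ} {A : Type*} [CommRing A] [IsDomain A]
  [Algebra (RatFunc K) A] {M : Type*} [AddCommMonoid M] [Module A M] [Module (RatFunc K) M]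
  [IsScalarTower (RatFunc K) A M] (b : Module.Basis (Fin n → Label d n) A M) {v ξ : A}
  (hξ : IsPrimitiveRoot ξ d) (hd : 1 ≤ d) (hn : 1 ≤ n)
  (hv : v ^ 2 = algebraMap (RatFunc K) A (u K))

theorem genRep_Tnat (i : ℕ) : genRep b hξ hd hn hv (Tnat K d n i) = genTnat b v i := by
  rw [Tnat, genTnat]
  split_ifs
  · rw [genRep_T]
  · rw [map_one]

theorem genRep_word (l : List ℕ) :
    genRep b hξ hd hn hv ((l.map (Tnat K d n)).prod) = wordOp b v l := by
  rw [map_list_prod, List.map_map, wordOp]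
  congr 1
  exact List.map_congr_left fun i _ => genRep_Tnat b hξ hd hn hv i

omit [CharZero K] in
theorem ofFn_Tshift_prod {r : ℕ} (x y : Fin r → ℕ) :
    (List.ofFn fun i => Tshift K d n (x i) (y i)).prod =
      ((blockWord x y).map (Tnat K d n)).prod := by
  rw [blockWord, List.map_flatten, List.prod_flatten, List.map_map, List.map_ofFn]
  rfl

theorem genRep_stdElt (p : Σ r : Fin (n + 1), Index d n r) :
    genRep b hξ hd hn hv (stdElt K d n p) = stdOp b v ξ p := by
  have h1 : (Tperm K d n p.2.2.2.2) =
      (((reducedWord p.2.2.2.2).map Fin.val).map (Tnat K d n)).prod := by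
    rw [Tperm]
    congr 2
    exact (List.map_eq_flatMap).symm
  rw [stdElt, map_mul, map_mul, map_mul, map_mul, map_pow, genRep_N, h1, genRep_word, stdOp]
  congr 1
  · congr 2
    congr 1
    · rw [Tset, ofFn_Tshift_prod, genRep_word]; rfl
    · rw [Fpow, map_list_prod, List.map_ofFn, monomialOp]
      congr 2
      funext i
      rw [Function.comp_apply, map_pow, genRep_F]
  · rw [TsetBar, ofFn_Tshift_prod, genRep_word]; rfl

theorem eq_zero_of_genRep_sum_eq_zero [NeZero d]
    {c : (Σ r : Fin (n + 1), Index d n r) → RatFunc K}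
    (hc : genRep b hξ hd hn hv (∑ p, c p • stdElt K d n p) = 0) : ∀ p, c p = 0 := by
  have hinj := (algebraMap (RatFunc K) A).injective
  have hchar : CharZero (RatFunc K) := charZero_of_injective_algebraMap (algebraMap K _).injective
  have hd0 : (d : A) ≠ 0 := by
    rw [← map_natCast (algebraMap (RatFunc K) A), Ne, map_eq_zero_iff _ hinj]
    exact_mod_cast (show d ≠ 0 by omega)
  have hv0 : v ≠ 0 := by
    rintro rfl
    rw [zero_pow two_ne_zero, eq_comm, map_eq_zero_iff _ hinj] at hv
    exact RatFunc.X_ne_zero hv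
  simp only [map_sum, map_smul, genRep_stdElt] at hc
  have hsmul (a : RatFunc K) (φ : Module.End A M) : a • φ = algebraMap (RatFunc K) A a • φ :=
    LinearMap.ext fun m => (algebraMap_smul A a (φ m)).symm
  simp only [hsmul] at hc
  exact fun p => (map_eq_zero_iff _ hinj).mp (eq_zero_of_sum_smul_stdOp b hξ hd0 hv0 hc p)

include b hξ hd hn hv in
theorem linearIndependent_stdElt_of_basis : LinearIndependent (RatFunc K) (stdElt K d n) := by
  have : NeZero d := ⟨by omega⟩
  rw [Fintype.linearIndependent_iff]
  exact fun c hc => eq_zero_of_genRep_sum_eq_zero b hξ hd hn hv (by rw [hc, map_zero])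

/-- An element of the kernel expands in the standard elements, and their images are linearly
independent. -/
theorem injective_genRep
    (hspan : Submodule.span (RatFunc K) (Set.range (stdElt K d n)) = ⊤) :
    Function.Injective (genRep b hξ hd hn hv) := by
  have : NeZero d := ⟨by omega⟩
  refine (injective_iff_map_eq_zero _).mpr fun x hx => ?_
  obtain ⟨c, rfl⟩ := (Submodule.mem_span_range_iff_exists_fun _).mp (hspan ▸ Submodule.mem_top :
    x ∈ Submodule.span (RatFunc K) (Set.range (stdElt K d n)))
  have h2 := eq_zero_of_genRep_sum_eq_zero b hξ hd hn hv hx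
  exact Finset.sum_eq_zero fun p _ => by rw [h2 p, zero_smul]

/-- A square has even degree, while the indeterminate has degree `1`. -/
theorem irreducible_sq_sub_u (K : Type*) [Field K] :
    Irreducible (Polynomial.X ^ 2 - Polynomial.C (u K)) := by
  refine X_pow_sub_C_irreducible_of_prime Nat.prime_two fun x hx => ?_
  have hx0 : x ≠ 0 := by
    rintro rfl
    rw [zero_pow two_ne_zero] at hx
    exact RatFunc.X_ne_zero hx.symm
  have := congrArg RatFunc.intDegree hx
  rw [sq, RatFunc.intDegree_mul hx0 hx0, RatFunc.intDegree_X] at this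
  omega

instance isDomain_S (K : Type*) [Field K] : IsDomain (S K) := by
  have : Fact (Irreducible (Polynomial.X ^ 2 - Polynomial.C (u K))) := ⟨irreducible_sq_sub_u K⟩
  exact inferInstanceAs (IsDomain (AdjoinRoot _))

theorem v_sq (K : Type*) [Field K] : RookYH.v K ^ 2 = algebraMap (RatFunc K) (S K) (u K) := by
  have := AdjoinRoot.eval₂_root (Polynomial.X ^ 2 - Polynomial.C (u K))
  rw [Polynomial.eval₂_sub, Polynomial.eval₂_pow, Polynomial.eval₂_X, Polynomial.eval₂_C,
    sub_eq_zero] at this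
  exact this

/-- The algebraic closure of `K(u)` contains both a primitive `d`-th root of unity and a square root
of `u`. Any free module on the label functions carries the operators, so no tensor product is needed
here. -/
theorem linearIndependent_stdElt (K : Type*) [Field K] [CharZero K] {d n : ℕ} (hd : 1 ≤ d)
    (hn : 1 ≤ n) : LinearIndependent (RatFunc K) (stdElt K d n) := by
  have hchar : CharZero (RatFunc K) := charZero_of_injective_algebraMap (algebraMap K _).injective
  have hchar' : CharZero (AlgebraicClosure (RatFunc K)) :=
    charZero_of_injective_algebraMap (algebraMap (RatFunc K) _).injective
  have : NeZero d := ⟨by omega⟩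
  obtain ⟨ξ, hξ⟩ := HasEnoughRootsOfUnity.exists_primitiveRoot (AlgebraicClosure (RatFunc K)) d
  obtain ⟨w, hw⟩ := IsAlgClosed.exists_pow_nat_eq
    (algebraMap (RatFunc K) (AlgebraicClosure (RatFunc K)) (u K)) two_pos
  exact linearIndependent_stdElt_of_basis (K := K)
    (Finsupp.basisSingleOne (R := AlgebraicClosure (RatFunc K)) (ι := Fin n → Label d n))
    hξ hd hn hw

theorem card_index (d n : ℕ) [NeZero d] : Fintype.card (Σ r : Fin (n + 1), Index d n r) =
    ∑ r ∈ Finset.range (n + 1), d ^ r * n.choose r ^ 2 * r.factorial := by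
  rw [Fintype.card_sigma, ← Fin.sum_univ_eq_sum_range
    (fun r => d ^ r * n.choose r ^ 2 * r.factorial)]
  refine Finset.sum_congr rfl fun r _ => ?_
  rw [Fintype.card_prod, Fintype.card_prod, Fintype.card_prod, Fintype.card_finset_len,
    Fintype.card_fin, Fintype.card_fun, ZMod.card, Fintype.card_fin, Fintype.card_perm,
    Fintype.card_fin]
  ring

theorem opF_eq_genF (K : Type*) [Field K] (d n : ℕ) {ξ : S K} (hξ : ξ ^ d = 1) (i : Fin n) :
    opF K d n ξ i = genF (tensorBasis K d n) ξ i := by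
  refine (tensorBasis K d n).ext fun f => ?_
  rw [genF_apply, opF, Module.Basis.constr_basis]
  cases h : f i with
  | none => simp [upper, hξ]
  | some p => rfl

theorem opT_eq_genT (K : Type*) [Field K] (d n : ℕ) (i : Fin (n - 1)) :
    opT K d n i = genT (tensorBasis K d n) (RookYH.v K) i := by
  refine (tensorBasis K d n).ext fun f => ?_
  rw [genT_apply, opT, Module.Basis.constr_basis, labelSame, labelFlip, coefSame, coefFlip, sign]
  by_cases h1 : upper (f (lo i)) = upper (f (hi i))
  · by_cases h2 : lower (f (lo i)) = lower (f (hi i))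
    · simp [h1, h2]
    · by_cases h3 : lower (f (hi i)) < lower (f (lo i))
      · simp [h1, h2, h3]
      · simp [h1, h2, h3]
  · simp [h1]

theorem opN_eq_genN (K : Type*) [Field K] (d n : ℕ) :
    opN K d n = genN (tensorBasis K d n) (RookYH.v K) := rfl

end Conclusion

end RookYH

theorem mainTheorem2 {K : Type*} [Field K] [CharZero K] (d n : ℕ) (hd : 1 ≤ d) (hn : 1 ≤ n) :
    LinearIndependent (RatFunc K) (RookYH.stdElt K d n) ∧
    Submodule.span (RatFunc K) (RookYH.stdSet K d n) = ⊤ ∧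
    (RookYH.stdSet K d n).ncard =
      ∑ r ∈ Finset.range (n + 1), d ^ r * n.choose r ^ 2 * r.factorial ∧
    Module.rank (RatFunc K) (RookYH.RY K d n) =
      ((∑ r ∈ Finset.range (n + 1), d ^ r * n.choose r ^ 2 * r.factorial : ℕ) : Cardinal) ∧
    ∀ ξ : RookYH.S K, IsPrimitiveRoot ξ d →
      ∃ ρ : RookYH.RY K d n →ₐ[RatFunc K] Module.End (RookYH.S K) (RookYH.TensorU K d n),
        (∀ i, ρ (RookYH.F K d n i) = RookYH.opF K d n ξ i) ∧
        (∀ i, ρ (RookYH.T K d n i) = RookYH.opT K d n i) ∧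
        ρ (RookYH.N K d n) = RookYH.opN K d n ∧
        (n ≤ d → Function.Injective ρ) := by
  have : NeZero d := ⟨by omega⟩
  have hli := RookYH.linearIndependent_stdElt K hd hn
  have hle := RookYH.rank_RY_le K d n hd hn
  have hfin : Module.Finite (RatFunc K) (RookYH.RY K d n) :=
    Module.rank_lt_aleph0_iff.mp (hle.trans_lt (Cardinal.natCast_lt_aleph0))
  have hfr : Module.finrank (RatFunc K) (RookYH.RY K d n) =
      ∑ r ∈ Finset.range (n + 1), d ^ r * n.choose r ^ 2 * r.factorial := by
    -- The layers bound the dimension above, the independent standard elements bound it below.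
    -- Spanning then follows by counting, without straightening products into standard form.
    refine le_antisymm (Module.finrank_le_of_rank_le hle) ?_
    rw [← RookYH.card_index]
    exact hli.fintype_card_le_finrank
  have hspan : Submodule.span (RatFunc K) (Set.range (RookYH.stdElt K d n)) = ⊤ :=
    hli.span_eq_top_of_card_eq_finrank' ((RookYH.card_index d n).trans hfr.symm)
  refine ⟨hli, hspan, ?_, ?_, fun ξ hξ => ?_⟩
  · rw [RookYH.stdSet, ← Set.image_univ, Set.ncard_image_of_injective _ hli.injective,
      Set.ncard_univ, Nat.card_eq_fintype_card, RookYH.card_index]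
  · rw [← Module.finrank_eq_rank, hfr]
  · refine ⟨RookYH.genRep (RookYH.tensorBasis K d n) hξ
      hd hn (RookYH.v_sq K), fun i => ?_,
      fun i => ?_, ?_, fun _ => ?_⟩
    · rw [RookYH.genRep_F, RookYH.opF_eq_genF K d n hξ.pow_eq_one]
    · rw [RookYH.genRep_T, RookYH.opT_eq_genT]
    · rw [RookYH.genRep_N, RookYH.opN_eq_genN]
    · exact RookYH.injective_genRep (RookYH.tensorBasis K d n)
        hξ hd hn (RookYH.v_sq K) hspan
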